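/- Let $n\ge 1$ and let $\Gamma:\mathbb R\to\mathbb R^{n+1}$ be a curve of class $C^{2,1}$ (here and below Lipschitz conditions are local) parameterised by arc length, with a relatively parallel adapted frame $(T,N_1,\dots,N_n)$: $T=\Gamma'$, the frame is orthonormal and locally Lipschitz, and almost everywhere $T'=\sum_j k_jN_j$ and $N_j'=-k_jT$, where $k_j=\Gamma''\cdot N_j$. Let $\Theta:\mathbb R\to\mathbb R^n$ be of class $C^{1,1}$ with $\Theta_1^2+\dots+\Theta_n^2=1$, and suppose that $k\cdot\Theta,\ (k\cdot\Theta)',\ |\Theta'|,\ |\Theta''|\in L^\infty(\mathbb R)$. For $a>0$ put $\Omega_0=\mathbb R\times(-a,a)$, $\Pi=\mathbb R\times(-1,1)$, $E_1=(\pi/2a)^2$ and $$f(s,t)=\sqrt{[1-t\,(k\cdot\Theta)(s)]^2+t^2|\Theta'(s)|^2}.$$ Let $H$ be the self-adjoint operator in $\mathcal H=L^2(\Omega_0,f\,ds\,dt)$ associated with the form $h[\psi]=\int_{\Omega_0}|\partial_1\psi|^2f^{-1}\,ds\,dt+\int_{\Omega_0}|\partial_2\psi|^2f\,ds\,dt$,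 whose domain is the closure of $C_0^\infty(\Omega_0)$ in the norm $(h[\psi]+\|\psi\|_{\mathcal H}^2)^{1/2}$; let $\hat H=UHU^{-1}$ in $L^2(\Pi)$, where $(U\psi)(s,u)=\sqrt{a f(s,au)}\,\psi(s,au)$. Let $$H_{\rm eff}=-\frac{d^2}{ds^2}-\frac14(k\cdot\Theta)^2+\frac12|\Theta'|^2\quad\text{in }L^2(\mathbb R),\qquad z_0=-\frac14\|k\cdot\Theta\|_{L^\infty(\mathbb R)}^2 .$$ Let $\pi:L^2(\mathbb R)\to L^2(\Pi)$ be the isometry $(\pi\varphi)(s,u)=\varphi(s)\cos(\pi u/2)$, and for a bounded operator $R$ on $L^2(\mathbb R)$ let $R\oplus 0$ be the operator equal to $\pi R\pi^{-1}$ on the range of $\pi$ and to $0$ on its orthogonal complement. Then for every real $z<z_0$ one has $z\in\rho(H_{\rm eff})$, and there exist $a_0>0$ and $C>0$ such that for all $0<a\le a_0$: $a\|k\cdot\Theta\|_{L^\infty(\mathbb R)}<1$, $z\in\rho(\hat H)$, $z\in\rho(\hat H-E_1)$, and $$\big\|(\hat H-E_1-z)^{-1}-(H_{\rm eff}-z)^{-1}\oplus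 0\big\|_{L^2(\Pi)\to L^2(\Pi)}\le C\,a .$$ -/

import Mathlib

open MeasureTheory
open scoped ContDiff ENNReal

noncomputable section

namespace QuantumStrip

/-! ### Operators associated with forms, and resolvents -/

section Abstract

variable {E F : Type*} [NormedAddCommGroup E] [InnerProductSpace ℂ E]
  [NormedAddCommGroup F] [InnerProductSpace ℂ F]

/-- Let `G` be (the graph of) a "gradient", `(ψ, g) ∈ G` meaning that `ψ` lies in the form domain
and has gradient `g`.  The form is `h(φ, ψ) = ⟪p, g⟫` for `(φ, p), (ψ, g) ∈ G`.  This is the graph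
of the operator associated with `h` in the sense of the representation theorem:
`ψ ∈ Dom H` and `H ψ = w` iff `ψ ∈ Dom h` and `h(φ, ψ) = ⟪φ, w⟫` for every `φ ∈ Dom h`. -/
def energyGraph (G : Submodule ℂ (E × F)) : Submodule ℂ (E × E) where
  carrier := {x | ∃ g : F, (x.1, g) ∈ G ∧ ∀ y ∈ G, inner ℂ y.2 g = inner ℂ y.1 x.2}
  zero_mem' := ⟨0, G.zero_mem, by simp⟩
  add_mem' := by
    rintro x y ⟨g, hg, hx⟩ ⟨g', hg', hy⟩
    refine ⟨g + g', G.add_mem hg hg', fun z hz => ?_⟩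
    simp [hx z hz, hy z hz]
  smul_mem' := by
    rintro c x ⟨g, hg, hx⟩
    refine ⟨c • g, G.smul_mem c hg, fun z hz => ?_⟩
    simp [hx z hz]

/-- The operator associated with the form of a gradient `G` (when the form domain is dense, the
graph above is single valued, and this is the linear operator with that graph). -/
def energyOperator (G : Submodule ℂ (E × F)) : E →ₗ.[ℂ] E :=
  (energyGraph G).toLinearPMap

/-- For an isometry `U : E → F`, the operator `U T U⁻¹`, with domain `U (Dom T)`. -/
def transport (U : E →ₗᵢ[ℂ] F) (T : E →ₗ.[ℂ] E) : F →ₗ.[ℂ] F :=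
  (T.graph.map (U.toLinearMap.prodMap U.toLinearMap)).toLinearPMap

/-- The bounded operator `R` is the inverse `(T - z)⁻¹` of `T - z : Dom T → E`. -/
def IsResolventAt (T : E →ₗ.[ℂ] E) (z : ℂ) (R : E →L[ℂ] E) : Prop :=
  (∀ w : E, ∃ hw : R w ∈ T.domain, T ⟨R w, hw⟩ - z • R w = w) ∧
    ∀ ψ : T.domain, R (T ψ - z • (ψ : E)) = ψ

/-- The resolvent set `ρ(T)`: those `z` for which `T - z : Dom T → E` has a bounded inverse. -/
def resSet (T : E →ₗ.[ℂ] E) : Set ℂ := {z | ∃ R : E →L[ℂ] E, IsResolventAt T z R}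

open Classical in
/-- The resolvent `(T - z)⁻¹`, for `z ∈ ρ(T)`; by convention `0` if `z ∉ ρ(T)`. -/
def res (T : E →ₗ.[ℂ] E) (z : ℂ) : E →L[ℂ] E :=
  if h : ∃ R : E →L[ℂ] E, IsResolventAt T z R then h.choose else 0

/-- For an isometry `J : E → F` of Hilbert spaces and a bounded operator `R` on `E`, the operator
`J R J⁻¹ ⊕ 0` on `F = Ran J ⊕ (Ran J)ᗮ`; here `J† = J⁻¹ P`, with `P` the orthogonal projection
onto `Ran J`. -/
def directSumZero [CompleteSpace E] [CompleteSpace F] (J : E →ₗᵢ[ℂ] F) (R : E →L[ℂ] E) :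
    F →L[ℂ] F :=
  J.toContinuousLinearMap ∘L R ∘L ContinuousLinearMap.adjoint J.toContinuousLinearMap

end Abstract

/-! ### The geometry of a strip -/

/-- The data of a strip in `ℝ^{n+1}`: a unit-speed `C^{1,1}` curve `Γ`, a relatively parallel
adapted frame `(T, N_1, …, N_n)` with `T = Γ'`, and a twisting vector `Θ` of class `C^{0,1}`.  The
components of the curvature vector are `k_j = Γ'' · N_j`; they are locally bounded because `Γ'` is
locally Lipschitz.  Lipschitz conditions are local ones. -/
structure Strip (n : ℕ) where
  /-- the reference curve -/
  Γ : ℝ → EuclideanSpace ℝ (Fin (n + 1))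
  /-- the normal vector fields of the frame -/
  N : Fin n → ℝ → EuclideanSpace ℝ (Fin (n + 1))
  /-- the twisting vector -/
  Θ : ℝ → EuclideanSpace ℝ (Fin n)
  contDiff_Γ : ContDiff ℝ 1 Γ
  locallyLipschitz_tangent : LocallyLipschitz (deriv Γ)
  unit_speed : ∀ s, ‖deriv Γ s‖ = 1
  locallyLipschitz_N : ∀ j, LocallyLipschitz (N j)
  orthonormal_N : ∀ s, Orthonormal ℝ fun j => N j s
  normal_N : ∀ s j, inner ℝ (deriv Γ s) (N j s) = 0
  deriv_tangent : ∀ᵐ s, deriv (deriv Γ) s = ∑ j, (inner ℝ (deriv (deriv Γ) s) (N j s)) • N j s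
  deriv_N : ∀ j, ∀ᵐ s,
    deriv (N j) s = -(inner ℝ (deriv (deriv Γ) s) (N j s)) • deriv Γ s
  locallyLipschitz_Θ : LocallyLipschitz Θ
  sum_sq_Θ : ∀ s, ∑ j, Θ s j ^ 2 = 1

namespace Strip

variable {n : ℕ} (S : Strip n)

/-- The component `k_j` of the curvature vector. -/
def k (j : Fin n) (s : ℝ) : ℝ := inner ℝ (deriv (deriv S.Γ) s) (S.N j s)

/-- The function `k · Θ`. -/
def kΘ (s : ℝ) : ℝ := ∑ j, S.k j s * S.Θ s j

/-- The Jacobian `f(s,t) = √((1 - t k(s)·Θ(s))² + t² |Θ'(s)|²)`. -/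
def f (p : ℝ × ℝ) : ℝ :=
  √((1 - p.2 * S.kΘ p.1) ^ 2 + p.2 ^ 2 * ‖deriv S.Θ p.1‖ ^ 2)

/-- The number `‖k · Θ‖_{L^∞(ℝ)}`. -/
def normKΘ : ℝ := (eLpNorm S.kΘ ∞ volume).toReal

/-- The effective potential `V_eff = -(1/4) (k·Θ)² + (1/2) |Θ'|²`. -/
def Veff (s : ℝ) : ℝ := -(1 / 4) * S.kΘ s ^ 2 + (1 / 2) * ‖deriv S.Θ s‖ ^ 2

/-- The number `z₀ = -(1/4) ‖k·Θ‖²_{L^∞(ℝ)}`. -/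
def z₀ : ℝ := -(1 / 4) * S.normKΘ ^ 2

/-- The regularity and global boundedness hypotheses for the thin-strip limit:
`Γ ∈ C^{2,1}`, `Θ ∈ C^{1,1}`, and `k·Θ, (k·Θ)', |Θ'|, |Θ''| ∈ L^∞(ℝ)`. -/
structure ThinAssumption : Prop where
  contDiff_Γ : ContDiff ℝ 2 S.Γ
  locallyLipschitz_Γ : LocallyLipschitz (deriv (deriv S.Γ))
  contDiff_Θ : ContDiff ℝ 1 S.Θ
  locallyLipschitz_Θ : LocallyLipschitz (deriv S.Θ)
  bounded_kΘ : MemLp S.kΘ ∞ volume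
  bounded_deriv_kΘ : MemLp (deriv S.kΘ) ∞ volume
  bounded_deriv_Θ : MemLp (deriv S.Θ) ∞ volume
  bounded_deriv_deriv_Θ : MemLp (deriv (deriv S.Θ)) ∞ volume

theorem measurable_kΘ : Measurable S.kΘ := by
  unfold kΘ k
  have hN : ∀ j, Measurable (S.N j) := fun j => (S.locallyLipschitz_N j).continuous.measurable
  have hT : Continuous S.Θ := S.locallyLipschitz_Θ.continuous
  have hΘ : ∀ j, Measurable fun s => S.Θ s j := fun j =>
    ((EuclideanSpace.proj (𝕜 := ℝ) j).continuous.comp hT).measurable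
  exact Finset.measurable_sum _ fun j _ =>
    ((measurable_deriv _).inner (hN j)).mul (hΘ j)

theorem measurable_f : Measurable S.f := by
  unfold f
  have h1 := S.measurable_kΘ
  have h2 : Measurable (deriv S.Θ) := measurable_deriv _
  fun_prop

end Strip

/-! ### Hilbert spaces and operators -/

/-- The straight strip `Ω₀ = ℝ × (-a,a)`. -/
def Ω₀ (a : ℝ) : Set (ℝ × ℝ) := Set.univ ×ˢ Set.Ioo (-a) a

/-- The first transverse Dirichlet eigenvalue `E₁ = (π / (2a))²`. -/
def E₁ (a : ℝ) : ℝ := (Real.pi / (2 * a)) ^ 2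

/-- The Hilbert space `L²(Π)`, where `Π = ℝ × (-1,1)`. -/
abbrev L2Strip : Type := Lp ℂ 2 ((volume : Measure (ℝ × ℝ)).restrict (Ω₀ 1))

/-- The Hilbert space `L²(ℝ)`. -/
abbrev L2Line : Type := Lp ℂ 2 (volume : Measure ℝ)

/-- The measure `f(s,t) ds dt` on `Ω₀`. -/
def weighted (f : ℝ × ℝ → ℝ) (a : ℝ) : Measure (ℝ × ℝ) :=
  ((volume : Measure (ℝ × ℝ)).restrict (Ω₀ a)).withDensity fun p => ENNReal.ofReal (f p)

/-- The space `C_0^∞(X)` of complex-valued test functions on a set `X`. -/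
def IsTest {V : Type*} [NormedAddCommGroup V] [NormedSpace ℝ V] (X : Set V) (φ : V → ℂ) : Prop :=
  ContDiff ℝ ∞ φ ∧ HasCompactSupport φ ∧ tsupport φ ⊆ X

theorem IsTest.zero {V : Type*} [NormedAddCommGroup V] [NormedSpace ℝ V] (X : Set V) :
    IsTest X (fun _ : V => (0 : ℂ)) :=
  ⟨contDiff_const, HasCompactSupport.zero, by simp [tsupport]⟩

theorem IsTest.add {V : Type*} [NormedAddCommGroup V] [NormedSpace ℝ V] {X : Set V}
    {φ χ : V → ℂ} (hφ : IsTest X φ) (hχ : IsTest X χ) : IsTest X (fun p => φ p + χ p) :=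
  ⟨hφ.1.add hχ.1, hφ.2.1.add hχ.2.1,
    (tsupport_add φ χ).trans (Set.union_subset hφ.2.2 hχ.2.2)⟩

theorem IsTest.const_mul {V : Type*} [NormedAddCommGroup V] [NormedSpace ℝ V] {X : Set V}
    {φ : V → ℂ} (c : ℂ) (hφ : IsTest X φ) : IsTest X (fun p => c * φ p) :=
  ⟨contDiff_const.mul hφ.1, hφ.2.1.mul_left,
    (tsupport_mul_subset_right (f := fun _ => c) (g := φ)).trans hφ.2.2⟩

theorem coeFn_add_ae {α : Type*} [MeasurableSpace α] {μ : Measure α} (u v : Lp ℂ 2 μ) :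
    ∀ᵐ p ∂μ, (u + v : Lp ℂ 2 μ) p = u p + v p := Lp.coeFn_add u v

theorem coeFn_zero_ae {α : Type*} [MeasurableSpace α] (μ : Measure α) :
    ∀ᵐ p ∂μ, (0 : Lp ℂ 2 μ) p = 0 := Lp.coeFn_zero ℂ 2 μ

section StripOperator

/-- The Riemannian gradient on test functions: the set of all
`(φ, (f⁻¹ ∂₁φ, ∂₂φ)) ∈ 𝓗 × (𝓗 × 𝓗)` with `φ ∈ C_0^∞(Ω₀)`, where `𝓗 = L²(Ω₀, f ds dt)`.
Note that `‖f⁻¹ ∂₁φ‖²_𝓗 + ‖∂₂φ‖²_𝓗 = ∫ |∂₁φ|² / f + ∫ |∂₂φ|² f = h[φ]`. -/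
def testGradient (f : ℝ × ℝ → ℝ) (a : ℝ) :
    Submodule ℂ (Lp ℂ 2 (weighted f a) ×
      WithLp 2 (Lp ℂ 2 (weighted f a) × Lp ℂ 2 (weighted f a))) where
  carrier := {x | ∃ φ : ℝ × ℝ → ℂ, IsTest (Ω₀ a) φ ∧
    (∀ᵐ p ∂(weighted f a), x.1 p = φ p) ∧
    (∀ᵐ p ∂(weighted f a), x.2.fst p = ((f p)⁻¹ : ℝ) * fderiv ℝ φ p (1, 0)) ∧
    (∀ᵐ p ∂(weighted f a), x.2.snd p = fderiv ℝ φ p (0, 1))}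
  zero_mem' := by
    refine ⟨fun _ => 0, IsTest.zero _, ?_, ?_, ?_⟩ <;>
    · filter_upwards [coeFn_zero_ae (weighted f a)] with p hp
      refine hp.trans ?_
      simp
  add_mem' := by
    rintro x y ⟨φ, hφ, h0, h1, h2⟩ ⟨χ, hχ, k0, k1, k2⟩
    have hd : ∀ p, fderiv ℝ (fun p => φ p + χ p) p = fderiv ℝ φ p + fderiv ℝ χ p := fun p =>
      fderiv_fun_add (hφ.1.differentiable (by simp) p) (hχ.1.differentiable (by simp) p)
    refine ⟨_, hφ.add hχ, ?_, ?_, ?_⟩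
    · filter_upwards [h0, k0, coeFn_add_ae x.1 y.1] with p hp kp hs
      exact hs.trans (by rw [hp, kp])
    · filter_upwards [h1, k1, coeFn_add_ae x.2.fst y.2.fst] with p hp kp hs
      exact hs.trans (by rw [hp, kp, hd, add_apply, mul_add])
    · filter_upwards [h2, k2, coeFn_add_ae x.2.snd y.2.snd] with p hp kp hs
      exact hs.trans (by rw [hp, kp, hd, add_apply])
  smul_mem' := by
    rintro c x ⟨φ, hφ, h0, h1, h2⟩
    have hd : ∀ p, fderiv ℝ (fun p => c * φ p) p = c • fderiv ℝ φ p := fun p =>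
      fderiv_const_mul (hφ.1.differentiable (by simp) p) c
    refine ⟨_, hφ.const_mul c, ?_, ?_, ?_⟩
    · filter_upwards [h0, Lp.coeFn_smul c x.1] with p hp hs
      simp [hs, hp]
    · filter_upwards [h1, Lp.coeFn_smul c x.2.fst] with p hp hs
      simp [hs, hp, hd, mul_left_comm]
    · filter_upwards [h2, Lp.coeFn_smul c x.2.snd] with p hp hs
      simp [hs, hp, hd]

/-- The scaling `(s,u) ↦ (s, a u)` from `Π` to `Ω₀`. -/
def scale (a : ℝ) (p : ℝ × ℝ) : ℝ × ℝ := (p.1, a * p.2)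

/-- The function `(s,u) ↦ √(a f(s, a u)) ψ(s, a u)`. -/
def transformFun (f : ℝ × ℝ → ℝ) (a : ℝ) (ψ : ℝ × ℝ → ℂ) (p : ℝ × ℝ) : ℂ :=
  (√(a * f (scale a p)) : ℝ) * ψ (scale a p)

theorem measurable_scale (a : ℝ) : Measurable (scale a) := by
  unfold scale; fun_prop

theorem map_scale {a : ℝ} (ha : 0 < a) :
    ((volume : Measure (ℝ × ℝ)).restrict (Ω₀ 1)).map (scale a) =
      ENNReal.ofReal a⁻¹ • (volume : Measure (ℝ × ℝ)).restrict (Ω₀ a) := by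
  have hpre : scale a ⁻¹' (Ω₀ a) = Ω₀ 1 := by
    ext p
    simp only [scale, Ω₀, Set.mem_preimage, Set.mem_prod, Set.mem_univ, true_and, Set.mem_Ioo]
    constructor
    · rintro ⟨h1, h2⟩
      constructor <;> nlinarith
    · rintro ⟨h1, h2⟩
      constructor <;> nlinarith
  have hmeas : MeasurableSet (Ω₀ a) := MeasurableSet.univ.prod measurableSet_Ioo
  have hfull : (volume : Measure (ℝ × ℝ)).map (scale a) = ENNReal.ofReal a⁻¹ • volume := by
    have h : scale a = Prod.map id (fun x => a * x) := rfl
    rw [h, Measure.volume_eq_prod, ← Measure.map_prod_map _ _ measurable_id (by fun_prop),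
      Measure.map_id, Real.map_volume_mul_left ha.ne', abs_of_pos (inv_pos.2 ha),
      Measure.prod_smul_right]
  rw [← hpre, ← Measure.restrict_map (measurable_scale a) hmeas, hfull, Measure.restrict_smul]

theorem ae_scale {f : ℝ × ℝ → ℝ} (hf : Measurable f) {a : ℝ} (ha : 0 < a) {Q : ℝ × ℝ → Prop}
    (h : ∀ᵐ p ∂(weighted f a), Q p) :
    ∀ᵐ p ∂((volume : Measure (ℝ × ℝ)).restrict (Ω₀ 1)), 0 < f (scale a p) → Q (scale a p) := by
  rw [weighted, ae_withDensity_iff hf.ennreal_ofReal] at h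
  have h' : ∀ᵐ p ∂(((volume : Measure (ℝ × ℝ)).restrict (Ω₀ 1)).map (scale a)),
      ENNReal.ofReal (f p) ≠ 0 → Q p := by
    rw [map_scale ha]
    exact Measure.ae_smul_measure h _
  filter_upwards [ae_of_ae_map (measurable_scale a).aemeasurable h'] with p hp hpos
  exact hp (by simpa using hpos)

theorem transformFun_congr {f : ℝ × ℝ → ℝ} (hf : Measurable f) {a : ℝ} (ha : 0 < a)
    {ψ χ : ℝ × ℝ → ℂ} (h : ψ =ᵐ[weighted f a] χ) :
    transformFun f a ψ =ᵐ[(volume : Measure (ℝ × ℝ)).restrict (Ω₀ 1)] transformFun f a χ := by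
  filter_upwards [ae_scale hf ha h] with p hp
  unfold transformFun
  rcases lt_or_ge 0 (f (scale a p)) with h0 | h0
  · rw [hp h0]
  · rw [Real.sqrt_eq_zero'.2 (mul_nonpos_of_nonneg_of_nonpos ha.le h0)]
    simp

theorem measurable_transformFun {f : ℝ × ℝ → ℝ} (hf : Measurable f) {a : ℝ}
    {ψ : ℝ × ℝ → ℂ} (hψ : Measurable ψ) : Measurable (transformFun f a ψ) := by
  unfold transformFun
  have := measurable_scale a
  fun_prop

theorem eLpNorm_transformFun {f : ℝ × ℝ → ℝ} (hf : Measurable f) {a : ℝ} (ha : 0 < a)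
    {ψ : ℝ × ℝ → ℂ} (hψ : Measurable ψ) :
    eLpNorm (transformFun f a ψ) 2 ((volume : Measure (ℝ × ℝ)).restrict (Ω₀ 1)) =
      eLpNorm ψ 2 (weighted f a) := by
  have key : ∫⁻ p in Ω₀ 1, ‖transformFun f a ψ p‖ₑ ^ (2 : ℝ) =
      ∫⁻ p, ‖ψ p‖ₑ ^ (2 : ℝ) ∂weighted f a := by
    have hm : Measurable fun p => ENNReal.ofReal (f p) * ‖ψ p‖ₑ ^ (2 : ℝ) := by fun_prop
    rw [weighted, lintegral_withDensity_eq_lintegral_mul _ hf.ennreal_ofReal (by fun_prop)]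
    have h1 : ∀ p, ‖transformFun f a ψ p‖ₑ ^ (2 : ℝ) =
        ENNReal.ofReal a * (ENNReal.ofReal (f (scale a p)) * ‖ψ (scale a p)‖ₑ ^ (2 : ℝ)) := by
      intro p
      unfold transformFun
      rw [enorm_mul, ENNReal.mul_rpow_of_nonneg _ _ (by norm_num), ← mul_assoc,
        ← ENNReal.ofReal_mul ha.le]
      congr 1
      rw [← ofReal_norm, Complex.norm_real, Real.norm_of_nonneg (Real.sqrt_nonneg _),
        ENNReal.ofReal_rpow_of_nonneg (Real.sqrt_nonneg _) (by norm_num)]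
      rcases le_or_gt 0 (a * f (scale a p)) with h0 | h0
      · congr 1
        rw [Real.rpow_two, Real.sq_sqrt h0]
      · rw [Real.sqrt_eq_zero'.2 h0.le, ENNReal.ofReal_of_nonpos h0.le]
        simp
    simp_rw [h1]
    rw [lintegral_const_mul _ (show Measurable fun p => ENNReal.ofReal (f (scale a p)) *
        ‖ψ (scale a p)‖ₑ ^ (2 : ℝ) from hm.comp (measurable_scale a)),
      ← lintegral_map hm (measurable_scale a), map_scale ha, lintegral_smul_measure, smul_eq_mul,
      ← mul_assoc, ← ENNReal.ofReal_mul ha.le, mul_inv_cancel₀ ha.ne', ENNReal.ofReal_one, one_mul]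
    rfl
  rw [eLpNorm_eq_lintegral_rpow_enorm_toReal (by norm_num) (by norm_num),
    eLpNorm_eq_lintegral_rpow_enorm_toReal (by norm_num) (by norm_num)]
  simp only [ENNReal.toReal_ofNat]
  rw [key]

theorem memLp_transformFun {f : ℝ × ℝ → ℝ} (hf : Measurable f) {a : ℝ} (ha : 0 < a)
    (ψ : Lp ℂ 2 (weighted f a)) :
    MemLp (transformFun f a ψ) 2 ((volume : Measure (ℝ × ℝ)).restrict (Ω₀ 1)) := by
  have hψ := (Lp.stronglyMeasurable ψ).measurable
  refine ⟨(measurable_transformFun hf hψ).aestronglyMeasurable, ?_⟩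
  rw [eLpNorm_transformFun hf ha hψ]
  exact (Lp.memLp ψ).2

/-- The transform `U : L²(Ω₀, f ds dt) → L²(Π)`, `(Uψ)(s,u) = √(a f(s, a u)) ψ(s, a u)`.  It is
isometric, and it is onto, hence unitary, as soon as `f` is positive almost everywhere. -/
def unitaryTransform {f : ℝ × ℝ → ℝ} (hf : Measurable f) {a : ℝ} (ha : 0 < a) :
    Lp ℂ 2 (weighted f a) →ₗᵢ[ℂ] L2Strip where
  toFun ψ := (memLp_transformFun hf ha ψ).toLp (transformFun f a ψ)
  map_add' ψ χ := by
    rw [← MemLp.toLp_add]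
    apply MemLp.toLp_congr
    refine (transformFun_congr hf ha (Lp.coeFn_add ψ χ)).trans (Filter.Eventually.of_forall ?_)
    intro p
    simp [transformFun, mul_add]
  map_smul' c ψ := by
    rw [RingHom.id_apply, ← MemLp.toLp_const_smul]
    apply MemLp.toLp_congr
    refine (transformFun_congr hf ha (Lp.coeFn_smul c ψ)).trans (Filter.Eventually.of_forall ?_)
    intro p
    simp [transformFun, mul_left_comm]
  norm_map' ψ := by
    simp only [LinearMap.coe_mk, AddHom.coe_mk]
    rw [Lp.norm_toLp, eLpNorm_transformFun hf ha (Lp.stronglyMeasurable ψ).measurable,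
      Lp.norm_def]

end StripOperator

namespace Strip

variable {n : ℕ} (S : Strip n)

/-- The form domain `Dom(h)`, the closure of `C_0^∞(Ω₀)` for the norm `√(h[ψ] + ‖ψ‖²)`, realised
as the set of all pairs `(ψ, (f⁻¹ ∂₁ψ, ∂₂ψ))` with `ψ ∈ Dom(h)`: it is the closure of the
corresponding set of pairs for test functions. -/
def gradient (a : ℝ) :
    Submodule ℂ (Lp ℂ 2 (weighted S.f a) ×
      WithLp 2 (Lp ℂ 2 (weighted S.f a) × Lp ℂ 2 (weighted S.f a))) :=
  (testGradient S.f a).topologicalClosure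

/-- The Dirichlet Laplace-Beltrami operator `H` in `L²(Ω₀, f ds dt)`, associated with the form
`h[ψ] = ∫ |∂₁ψ|² / f + ∫ |∂₂ψ|² f` with domain `Dom(h)`. -/
def H (a : ℝ) : Lp ℂ 2 (weighted S.f a) →ₗ.[ℂ] Lp ℂ 2 (weighted S.f a) :=
  energyOperator (S.gradient a)

/-- The operator `Ĥ = U H U⁻¹` in `L²(Π)`. -/
def Hhat {a : ℝ} (ha : 0 < a) : L2Strip →ₗ.[ℂ] L2Strip :=
  transport (unitaryTransform S.measurable_f ha) (S.H a)

end Strip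

/-! ### The effective operator on the line -/

theorem integrable_test_mul {φ : ℝ → ℂ} (h : Continuous φ) (h' : HasCompactSupport φ)
    (ψ : L2Line) : Integrable fun s => φ s * ψ s :=
  (h.memLp_of_hasCompactSupport h' (p := 2)).integrable_mul (Lp.memLp ψ)

/-- The set of pairs `(ψ, ψ')` with `ψ ∈ W^{1,2}(ℝ)`: both `ψ` and its weak derivative `ψ'` are
in `L²(ℝ)`. -/
def sobolevLine : Submodule ℂ (L2Line × L2Line) where
  carrier := {x | ∀ φ : ℝ → ℂ, IsTest Set.univ φ →
    ∫ s, deriv φ s * x.1 s = -∫ s, φ s * x.2 s}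
  zero_mem' := by
    intro φ _
    have h : ∀ χ : ℝ → ℂ, ∫ s, χ s * (0 : L2Line) s = 0 := fun χ => by
      refine integral_eq_zero_of_ae ?_
      filter_upwards [coeFn_zero_ae (volume : Measure ℝ)] with s hs
      rw [hs, mul_zero, Pi.zero_apply]
    simp only [Prod.fst_zero, Prod.snd_zero, h, neg_zero]
  add_mem' := by
    intro x y hx hy φ hφ
    have h : ∀ χ : ℝ → ℂ, Continuous χ → HasCompactSupport χ → ∀ u v : L2Line,
        ∫ s, χ s * (u + v : L2Line) s = (∫ s, χ s * u s) + ∫ s, χ s * v s := by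
      intro χ hc hs u v
      rw [← integral_add (integrable_test_mul hc hs u) (integrable_test_mul hc hs v)]
      refine integral_congr_ae ?_
      filter_upwards [coeFn_add_ae u v] with s h
      rw [h, mul_add]
    rw [Prod.fst_add, Prod.snd_add, h _ (hφ.1.continuous_deriv (by simp)) hφ.2.1.deriv,
      h _ hφ.1.continuous hφ.2.1, hx φ hφ, hy φ hφ]
    ring
  smul_mem' := by
    intro c x hx φ hφ
    have h : ∀ (χ : ℝ → ℂ) (u : L2Line),
        ∫ s, χ s * (c • u : L2Line) s = c * ∫ s, χ s * u s := by
      intro χ u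
      rw [← integral_const_mul]
      refine integral_congr_ae ?_
      filter_upwards [Lp.coeFn_smul c u] with s h
      rw [h, Pi.smul_apply, smul_eq_mul, mul_left_comm]
    rw [Prod.smul_fst, Prod.smul_snd, h, h, hx φ hφ]
    ring

/-- The operator `-d²/ds²` in `L²(ℝ)`, associated with the form `∫ |ψ'|²` on `W^{1,2}(ℝ)`. -/
def lineLaplacian : L2Line →ₗ.[ℂ] L2Line := energyOperator sobolevLine

/-- The operator of multiplication by `V` in `L²(ℝ)`, on its maximal domain. -/
def mulOperator (V : ℝ → ℝ) : L2Line →ₗ.[ℂ] L2Line :=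
  Submodule.toLinearPMap
    { carrier := {x : L2Line × L2Line | ∀ᵐ s, x.2 s = (V s : ℂ) * x.1 s}
      zero_mem' := by
        show ∀ᵐ s, (0 : L2Line) s = (V s : ℂ) * (0 : L2Line) s
        filter_upwards [coeFn_zero_ae (volume : Measure ℝ)] with s hs
        rw [hs, mul_zero]
      add_mem' := by
        intro x y (hx : ∀ᵐ s, x.2 s = (V s : ℂ) * x.1 s) (hy : ∀ᵐ s, y.2 s = (V s : ℂ) * y.1 s)
        show ∀ᵐ s, (x.2 + y.2 : L2Line) s = (V s : ℂ) * (x.1 + y.1 : L2Line) s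
        filter_upwards [hx, hy, coeFn_add_ae x.1 y.1, coeFn_add_ae x.2 y.2] with s h1 h2 h3 h4
        rw [h3, h4, h1, h2, mul_add]
      smul_mem' := by
        intro c x (hx : ∀ᵐ s, x.2 s = (V s : ℂ) * x.1 s)
        show ∀ᵐ s, (c • x.2 : L2Line) s = (V s : ℂ) * (c • x.1 : L2Line) s
        filter_upwards [hx, Lp.coeFn_smul c x.1, Lp.coeFn_smul c x.2] with s h1 h2 h3
        simp [h1, h2, h3, mul_left_comm] }

/-- The effective operator `H_eff = -d²/ds² + V_eff` in `L²(ℝ)`. -/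
def Strip.Heff {n : ℕ} (S : Strip n) : L2Line →ₗ.[ℂ] L2Line :=
  lineLaplacian + mulOperator S.Veff

/-! ### The embedding onto the first transverse mode -/

/-- The normalised first Dirichlet eigenfunction `χ̂₁(u) = cos(π u / 2)` of `(-1,1)`. -/
def χ₁ (u : ℝ) : ℝ := Real.cos (Real.pi / 2 * u)

/-- The function `(s,u) ↦ φ(s) χ̂₁(u)`. -/
def modeFun (φ : ℝ → ℂ) (p : ℝ × ℝ) : ℂ := φ p.1 * (χ₁ p.2 : ℝ)

theorem restrict_strip : (volume : Measure (ℝ × ℝ)).restrict (Ω₀ 1) =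
    (volume : Measure ℝ).prod ((volume : Measure ℝ).restrict (Set.Ioo (-1) 1)) := by
  rw [Ω₀, Measure.volume_eq_prod, ← Measure.prod_restrict, Measure.restrict_univ]

theorem lintegral_χ₁ : ∫⁻ u in Set.Ioo (-1 : ℝ) 1, ‖(χ₁ u : ℂ)‖ₑ ^ (2 : ℝ) = 1 := by
  have h1 : ∀ u, ‖(χ₁ u : ℂ)‖ₑ ^ (2 : ℝ) = ENNReal.ofReal (χ₁ u ^ 2) := fun u => by
    rw [← ofReal_norm, Complex.norm_real,
      ENNReal.ofReal_rpow_of_nonneg (norm_nonneg _) (by norm_num), Real.rpow_two]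
    simp
  have hc : Continuous fun u => χ₁ u ^ 2 := by unfold χ₁; fun_prop
  simp_rw [h1]
  rw [← ofReal_integral_eq_lintegral_ofReal
      (hc.integrableOn_Icc.mono_set Set.Ioo_subset_Icc_self)
      (Filter.Eventually.of_forall fun u => sq_nonneg _),
    ← integral_Ioc_eq_integral_Ioo, ← intervalIntegral.integral_of_le (by norm_num)]
  have h2 : ∫ u in (-1 : ℝ)..1, χ₁ u ^ 2 = 1 := by
    unfold χ₁
    have hpi : Real.pi / 2 ≠ 0 := by positivity
    rw [intervalIntegral.integral_comp_mul_left (fun x => Real.cos x ^ 2) hpi, integral_cos_sq]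
    simp
  rw [h2, ENNReal.ofReal_one]

theorem measurable_χ₁ : Measurable χ₁ := by unfold χ₁; fun_prop

theorem measurable_modeFun {φ : ℝ → ℂ} (hφ : Measurable φ) : Measurable (modeFun φ) := by
  unfold modeFun
  have := measurable_χ₁
  fun_prop

theorem eLpNorm_modeFun {φ : ℝ → ℂ} (hφ : Measurable φ) :
    eLpNorm (modeFun φ) 2 ((volume : Measure (ℝ × ℝ)).restrict (Ω₀ 1)) = eLpNorm φ 2 volume := by
  have hχ := measurable_χ₁
  rw [eLpNorm_eq_lintegral_rpow_enorm_toReal (by norm_num) (by norm_num),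
    eLpNorm_eq_lintegral_rpow_enorm_toReal (by norm_num) (by norm_num)]
  simp only [ENNReal.toReal_ofNat, modeFun, enorm_mul]
  congr 1
  simp_rw [ENNReal.mul_rpow_of_nonneg _ _ (show (0 : ℝ) ≤ 2 by norm_num)]
  rw [restrict_strip, lintegral_prod_mul (f := fun s => ‖φ s‖ₑ ^ (2 : ℝ))
    (g := fun u => ‖(χ₁ u : ℂ)‖ₑ ^ (2 : ℝ)) (by fun_prop) (by fun_prop), lintegral_χ₁, mul_one]

theorem memLp_modeFun (φ : L2Line) :
    MemLp (modeFun φ) 2 ((volume : Measure (ℝ × ℝ)).restrict (Ω₀ 1)) := by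
  have hφ := (Lp.stronglyMeasurable φ).measurable
  refine ⟨(measurable_modeFun hφ).aestronglyMeasurable, ?_⟩
  rw [eLpNorm_modeFun hφ]
  exact (Lp.memLp φ).2

theorem modeFun_congr {φ ψ : ℝ → ℂ} (h : φ =ᵐ[volume] ψ) :
    modeFun φ =ᵐ[(volume : Measure (ℝ × ℝ)).restrict (Ω₀ 1)] modeFun ψ := by
  rw [restrict_strip]
  have h' := Measure.quasiMeasurePreserving_fst (μ := (volume : Measure ℝ))
    (ν := (volume : Measure ℝ).restrict (Set.Ioo (-1) 1)) |>.ae_eq_comp h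
  filter_upwards [h'] with p hp
  have hp' : φ p.1 = ψ p.1 := hp
  simp [modeFun, hp']

/-- The isometry `L²(ℝ) → L²(Π)`, `φ ↦ φ ⊗ χ̂₁`, onto the space of the first transverse mode. -/
def modeEmbedding : L2Line →ₗᵢ[ℂ] L2Strip where
  toFun φ := (memLp_modeFun φ).toLp (modeFun φ)
  map_add' φ ψ := by
    rw [← MemLp.toLp_add]
    apply MemLp.toLp_congr
    refine (modeFun_congr (Lp.coeFn_add φ ψ)).trans (Filter.Eventually.of_forall ?_)
    intro p
    simp [modeFun, add_mul]
  map_smul' c φ := by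
    rw [RingHom.id_apply, ← MemLp.toLp_const_smul]
    apply MemLp.toLp_congr
    refine (modeFun_congr (Lp.coeFn_smul c φ)).trans (Filter.Eventually.of_forall ?_)
    intro p
    simp [modeFun, mul_assoc]
  norm_map' φ := by
    simp only [LinearMap.coe_mk, AddHom.coe_mk]
    rw [Lp.norm_toLp, eLpNorm_modeFun (Lp.stronglyMeasurable φ).measurable, Lp.norm_def]

end QuantumStrip

end

open MeasureTheory
open scoped ContDiff ENNReal

noncomputable section

namespace QuantumStrip

/-! ### Weak solutions of form equations and the resolvents they define -/

section FormResolvent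

variable {E F : Type*} [NormedAddCommGroup E] [InnerProductSpace ℂ E]
  [NormedAddCommGroup F] [InnerProductSpace ℂ F]

/-! The heart of the matter is an exact factorisation by a transverse ground state. The function
`mode a = χ₁(t/a) / √(a f)` is the preimage under `U` of the first Dirichlet eigenfunction, and its
logarithmic derivative `β` in `t` obeys the Riccati equation `∂₂(fβ) = -(E₁ + V) f - fβ²`
(`hasDerivAt_f_mul_β`) with an explicit potential `V`. Integrated against `|ψ|²` this gives, without
error term, `∫ f|∂₂ψ|² = ∫ f|(∂₂ - β)ψ|² + ∫ (E₁ + V) f|ψ|²` (`integral_ground_state`). Here `V -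
Veff = O(a)` uniformly (`abs_V_sub_Veff_le`), and `∂₂ - β`, which annihilates the mode, controls the
distance to it: the part of `ψ` orthogonal to the first mode has squared norm at most `2a²‖(∂₂ -
β)ψ‖²` (`norm_sub_mode_le`, `norm_sub_proj_le`).

Hence `H - E₁ - z` is bounded below by a positive constant for small `a`, since `Veff ≥ z₀ > z`, and
the part of `R v` orthogonal to the mode is `O(a)`, where `R` is the resolvent of the strip
(`energy_lower_bound`). The part along the mode is compared weakly in `norm_formResolvent_sub_le`.
Let `J` embed the mode and let `Re` be the resolvent of the effective operator. The equation for `R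
v` is tested with `J (Re (J* w))`, the equation for `Re (J* w)` with `J* (R v)`. What does not
cancel is multiplication by `f⁻¹ - f`, by `m = ∂₁f / (2f)` and its product with `f⁻¹`, and by `V -
Veff`, all of norm `O(a)`.

Testing is legitimate because `J` carries test functions into the form domain (`exists_gradient_J`),
`J*` carries the form domain into `W^{1,2}(ℝ)` (`proj_mem_sobolevLine`), and test functions are
dense in `W^{1,2}(ℝ)` (`sobolevLine_le_closure`). Only first derivatives of the coefficients occur,
so Lipschitz regularity suffices. The geometry enters solely through `κ = k·Θ` and `σ = |Θ'|²`
(`exists_profile`). Weak solutions are turned into operator resolvents by `exists_isFormResolvent`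
and `IsFormResolvent.isResolventAt`. -/

/-- `R` solves the weak equation `⟪φ', ψ'⟫ + ⟪φ, W ψ⟫ = ⟪φ, w⟫` with `ψ = R w`. -/
def IsFormResolvent (G : Submodule ℂ (E × F)) (W R : E →L[ℂ] E) : Prop :=
  ∀ w, ∃ g, (R w, g) ∈ G ∧ ∀ y ∈ G, inner ℂ y.2 g + inner ℂ y.1 (W (R w)) = inner ℂ y.1 w

/-- Lax–Milgram on the graph itself: `G`, with the norm of the Hilbert sum, is a Hilbert space, and
on it the form is represented by `A = p₂*p₂ + p₁*Wp₁`. Coercivity in the norm of `E` improves to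
coercivity in the graph norm because `W` is bounded, so `A` is invertible and `R = p₁A⁻¹p₁*`. -/
theorem exists_isFormResolvent [CompleteSpace E] [CompleteSpace F] (G : Submodule ℂ (E × F))
    (hG : IsClosed (G : Set (E × F))) (W : E →L[ℂ] E) {c : ℝ} (hc : 0 < c)
    (h : ∀ x ∈ G, c * ‖x.1‖ ^ 2 ≤ ‖x.2‖ ^ 2 + (inner ℂ x.1 (W x.1)).re) :
    ∃ R, IsFormResolvent G W R := by
  let e : WithLp 2 (E × F) ≃L[ℂ] E × F := WithLp.prodContinuousLinearEquiv 2 ℂ E F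
  let V : Submodule ℂ (WithLp 2 (E × F)) := G.comap e.toLinearMap
  have hV : IsClosed (V : Set (WithLp 2 (E × F))) := hG.preimage e.continuous
  have : CompleteSpace V := hV.completeSpace_coe
  let p₁ : V →L[ℂ] E := ContinuousLinearMap.fst ℂ E F ∘L e.toContinuousLinearMap ∘L V.subtypeL
  let p₂ : V →L[ℂ] F := ContinuousLinearMap.snd ℂ E F ∘L e.toContinuousLinearMap ∘L V.subtypeL
  let A : V →L[ℂ] V := ContinuousLinearMap.adjoint p₂ ∘L p₂ +
    ContinuousLinearMap.adjoint p₁ ∘L W ∘L p₁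
  have hA : ∀ x y : V, inner ℂ x (A y) = inner ℂ (p₂ x) (p₂ y) + inner ℂ (p₁ x) (W (p₁ y)) := by
    intro x y
    simp only [A, add_apply, ContinuousLinearMap.comp_apply, inner_add_right,
      ContinuousLinearMap.adjoint_inner_right]
  have hnorm : ∀ x : V, ‖x‖ ^ 2 = ‖p₁ x‖ ^ 2 + ‖p₂ x‖ ^ 2 := fun x =>
    WithLp.prod_norm_sq_eq_of_L2 (x : WithLp 2 (E × F))
  -- With `Q` the value of the form, `‖p₁x‖² ≤ Q/c` and `‖p₂x‖² ≤ Q + ‖W‖‖p₁x‖² ≤ (1 + ‖W‖/c) Q`;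
  -- the sum of these bounds is `D Q`.
  set D : ℝ := 1 / c + (1 + ‖W‖ / c) with hD
  have hD0 : 0 < D := by positivity
  have hlow : ∀ x : V, ‖x‖ ^ 2 ≤ D * (inner ℂ x (A x)).re := by
    intro x
    have hx := h (p₁ x, p₂ x) x.2
    have hq : (inner ℂ x (A x)).re = ‖p₂ x‖ ^ 2 + (inner ℂ (p₁ x) (W (p₁ x))).re := by
      rw [hA, Complex.add_re]
      congr 1
      exact inner_self_eq_norm_sq (𝕜 := ℂ) (p₂ x)
    simp only at hx
    rw [← hq] at hx
    have hw : -(‖W‖ * ‖p₁ x‖ ^ 2) ≤ (inner ℂ (p₁ x) (W (p₁ x))).re := by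
      have h1 : |(inner ℂ (p₁ x) (W (p₁ x))).re| ≤ ‖p₁ x‖ * (‖W‖ * ‖p₁ x‖) :=
        (Complex.abs_re_le_norm _).trans ((norm_inner_le_norm _ _).trans
          (mul_le_mul_of_nonneg_left (W.le_opNorm _) (norm_nonneg _)))
      nlinarith [neg_abs_le (inner ℂ (p₁ x) (W (p₁ x))).re]
    set Q := (inner ℂ x (A x)).re
    have h1 : ‖p₁ x‖ ^ 2 ≤ Q / c := by rw [le_div_iff₀ hc]; linarith
    have h2 : ‖W‖ * ‖p₁ x‖ ^ 2 ≤ ‖W‖ * (Q / c) := mul_le_mul_of_nonneg_left h1 (norm_nonneg _)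
    rw [hnorm, hD]
    have : (1 / c + (1 + ‖W‖ / c)) * Q = Q / c + Q + ‖W‖ * (Q / c) := by ring
    rw [this]
    linarith
  have hunit : IsUnit A := by
    refine ContinuousLinearMap.isUnit_of_forall_le_norm_inner_map A
      (c := ⟨D⁻¹, (inv_pos.2 hD0).le⟩) (by exact_mod_cast inv_pos.2 hD0) fun x => ?_
    rw [norm_inner_symm]
    refine le_trans ?_ (Complex.re_le_norm _)
    change ‖x‖ ^ 2 * D⁻¹ ≤ _
    rw [← div_eq_mul_inv, div_le_iff₀ hD0, mul_comm]
    exact hlow x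
  obtain ⟨u, hu⟩ := hunit
  refine ⟨p₁ ∘L (u⁻¹ : (V →L[ℂ] V)ˣ).1 ∘L ContinuousLinearMap.adjoint p₁, fun w => ?_⟩
  set x : V := (u⁻¹ : (V →L[ℂ] V)ˣ).1 (ContinuousLinearMap.adjoint p₁ w) with hx
  have hAx : A x = ContinuousLinearMap.adjoint p₁ w := by
    rw [hx, ← hu]
    change ((u : V →L[ℂ] V) * (u⁻¹ : (V →L[ℂ] V)ˣ).1) _ = _
    rw [Units.mul_inv]
    rfl
  refine ⟨p₂ x, x.2, fun y hy => ?_⟩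
  have := hA ⟨e.symm y, by simpa [V] using hy⟩ x
  rw [hAx, ContinuousLinearMap.adjoint_inner_right] at this
  exact this.symm

/-- Test the equation for `R w` with `R v` and conversely: both pairings equal the same form value
when `W` is symmetric. -/
theorem IsFormResolvent.inner_eq {G : Submodule ℂ (E × F)} {W R : E →L[ℂ] E}
    (hR : IsFormResolvent G W R) (hW : ∀ x y, inner ℂ (W x) y = inner ℂ x (W y)) (v w : E) :
    inner ℂ (R v) w = inner ℂ v (R w) := by
  obtain ⟨g, hg, hg'⟩ := hR w
  obtain ⟨k, hk, hk'⟩ := hR v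
  have h1 := hg' _ hk
  have h2 := congrArg (starRingEnd ℂ) (hk' _ hg)
  simp only [map_add, inner_conj_symm] at h2
  rw [← h1, ← h2, hW]

/-- Uniqueness: the difference of two solutions, tested against itself, makes the coercive form
vanish. -/
theorem IsFormResolvent.eq_of_weak {G : Submodule ℂ (E × F)} {W R : E →L[ℂ] E}
    (hR : IsFormResolvent G W R) {c : ℝ} (hc : 0 < c)
    (h : ∀ x ∈ G, c * ‖x.1‖ ^ 2 ≤ ‖x.2‖ ^ 2 + (inner ℂ x.1 (W x.1)).re) {ψ w : E} {g : F}
    (hψ : (ψ, g) ∈ G)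
    (hw : ∀ y ∈ G, inner ℂ y.2 g + inner ℂ y.1 (W ψ) = inner ℂ y.1 w) : R w = ψ := by
  obtain ⟨k, hk, hk'⟩ := hR w
  have hd := G.sub_mem hk hψ
  have h0 := h _ hd
  have e1 := hk' _ hd
  have e2 := hw _ hd
  simp only [Prod.fst_sub, Prod.snd_sub, map_sub] at h0 e1 e2
  have e3 : inner ℂ (k - g) (k - g) + inner ℂ (R w - ψ) (W (R w) - W ψ) = 0 := by
    rw [inner_sub_right (k - g), inner_sub_right (R w - ψ)]
    linear_combination e1 - e2
  have e4 := congrArg Complex.re e3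
  rw [Complex.add_re, Complex.zero_re] at e4
  have e5 : (inner ℂ (k - g) (k - g)).re = ‖k - g‖ ^ 2 := inner_self_eq_norm_sq (𝕜 := ℂ) _
  have : ‖R w - ψ‖ ^ 2 ≤ 0 := by
    by_contra hcon
    push Not at hcon
    nlinarith
  have : ‖R w - ψ‖ = 0 := by nlinarith [norm_nonneg (R w - ψ)]
  exact sub_eq_zero.1 (norm_eq_zero.1 this)

/-- Density of the form domain makes the energy graph single valued, without which
`Submodule.toLinearPMap` would not return an operator with this graph. -/
theorem energyGraph_snd_eq_zero {G : Submodule ℂ (E × F)}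
    (hG : ∀ w : E, (∀ y ∈ G, inner ℂ y.1 w = 0) → w = 0) :
    ∀ x ∈ energyGraph G, x.1 = 0 → x.2 = 0 := by
  rintro ⟨ψ, w⟩ ⟨g, hg, hw⟩ h0
  simp only at h0 hg hw ⊢
  have h1 := hw _ hg
  simp only [h0, inner_zero_left] at h1
  have h2 : g = 0 := inner_self_eq_zero.1 h1
  refine hG w fun y hy => ?_
  rw [← hw y hy, h2, inner_zero_right]

/-- A criterion for being a resolvent, in terms of the graph. -/
theorem isResolventAt_of_graph {T : E →ₗ.[ℂ] E} {z : ℂ} {R : E →L[ℂ] E}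
    (h1 : ∀ w, (R w, w + z • R w) ∈ T.graph)
    (h2 : ∀ x ∈ T.graph, R (x.2 - z • x.1) = x.1) : IsResolventAt T z R := by
  refine ⟨fun w => ?_, fun ψ => h2 _ (T.mem_graph ψ)⟩
  obtain ⟨y, hy, hy'⟩ := T.mem_graph_iff.1 (h1 w)
  simp only at hy hy'
  have hw : R w ∈ T.domain := hy ▸ y.2
  refine ⟨hw, ?_⟩
  have : (⟨R w, hw⟩ : T.domain) = y := Subtype.ext hy.symm
  rw [this, hy']
  simp

/-- A left inverse and a right inverse coincide, so the resolvent picked by choice in `res` is any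
operator known to satisfy `IsResolventAt`. -/
theorem res_eq {T : E →ₗ.[ℂ] E} {z : ℂ} {R : E →L[ℂ] E} (h : IsResolventAt T z R) :
    res T z = R := by
  have hex : ∃ R : E →L[ℂ] E, IsResolventAt T z R := ⟨R, h⟩
  rw [res, dif_pos hex]
  ext w
  obtain ⟨hw, hw'⟩ := hex.choose_spec.1 w
  have := h.2 ⟨_, hw⟩
  rw [hw'] at this
  exact this.symm

/-- Existence of weak solutions gives the right inverse, their uniqueness the left inverse. The
bounded potential `V` is kept apart from the form so that one statement serves both the effective
operator and the strip, where `V = 0`. -/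
theorem IsFormResolvent.isResolventAt {G : Submodule ℂ (E × F)} {V R : E →L[ℂ] E} {z : ℂ}
    (hR : IsFormResolvent G (V - z • ContinuousLinearMap.id ℂ E) R) {c : ℝ} (hc : 0 < c)
    (h : ∀ x ∈ G, c * ‖x.1‖ ^ 2 ≤
      ‖x.2‖ ^ 2 + (inner ℂ x.1 ((V - z • ContinuousLinearMap.id ℂ E) x.1)).re)
    {T : E →ₗ.[ℂ] E} (hT : ∀ x : E × E, x ∈ T.graph ↔ (x.1, x.2 - V x.1) ∈ energyGraph G) :
    IsResolventAt T z R := by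
  refine isResolventAt_of_graph (fun w => ?_) fun x hx => ?_
  · obtain ⟨g, hg, hg'⟩ := hR w
    refine (hT _).2 ⟨g, hg, fun y hy => ?_⟩
    have := hg' y hy
    simp only [sub_apply, smul_apply, ContinuousLinearMap.id_apply, inner_sub_right,
      inner_add_right] at this ⊢
    linear_combination this
  · obtain ⟨g, hg, hg'⟩ := (hT x).1 hx
    refine hR.eq_of_weak hc h hg fun y hy => ?_
    have := hg' y hy
    simp only [sub_apply, smul_apply, ContinuousLinearMap.id_apply, inner_sub_right] at this ⊢
    linear_combination this

theorem mem_graph_energyOperator {G : Submodule ℂ (E × F)}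
    (hG : ∀ w : E, (∀ y ∈ G, inner ℂ y.1 w = 0) → w = 0) (x : E × E) :
    x ∈ (energyOperator G).graph ↔ x ∈ energyGraph G := by
  rw [energyOperator, Submodule.toLinearPMap_graph_eq _ (energyGraph_snd_eq_zero hG)]

/-- For a surjective isometry the adjoint is the inverse, so `directSumZero U R` is just the
conjugate `U R U⁻¹`, with nothing extended by zero. -/
theorem isResolventAt_transport [CompleteSpace E] [CompleteSpace F] {T : E →ₗ.[ℂ] E} {z : ℂ}
    {R : E →L[ℂ] E} (h : IsResolventAt T z R) (U : E →ₗᵢ[ℂ] F)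
    (hU : Function.Surjective U) : IsResolventAt (transport U T) z (directSumZero U R) := by
  have hadj : ∀ w, ContinuousLinearMap.adjoint U.toContinuousLinearMap (U w) = w := fun w =>
    ext_inner_left ℂ fun v => by
      rw [ContinuousLinearMap.adjoint_inner_right]
      exact U.inner_map_map v w
  have hR : ∀ v, directSumZero U R (U v) = U (R v) := fun v => by
    change U (R (ContinuousLinearMap.adjoint U.toContinuousLinearMap (U v))) = _
    rw [hadj]
  have hgraph : (transport U T).graph =
      T.graph.map (U.toLinearMap.prodMap U.toLinearMap) := by
    refine Submodule.toLinearPMap_graph_eq _ ?_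
    rintro x ⟨y, hy, rfl⟩ hx
    have h1 : y.1 = 0 := U.injective (by simpa using hx)
    have h2 : y.2 = 0 := LinearPMap.graph_fst_eq_zero_snd T hy h1
    simp [h2]
  refine isResolventAt_of_graph (fun w => ?_) fun x hx => ?_
  · obtain ⟨v, rfl⟩ := hU w
    obtain ⟨hw, hw'⟩ := h.1 v
    rw [hgraph]
    refine ⟨(R v, v + z • R v), ?_, ?_⟩
    · have := T.mem_graph ⟨R v, hw⟩
      rwa [sub_eq_iff_eq_add.1 hw'] at this
    · rw [hR]
      exact Prod.ext rfl (by simp)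
  · rw [hgraph] at hx
    obtain ⟨y, hy, rfl⟩ := hx
    obtain ⟨ψ, hψ, hψ'⟩ := T.mem_graph_iff.1 hy
    have := h.2 ψ
    rw [hψ, hψ'] at this
    change directSumZero U R (U y.2 - z • U y.1) = U y.1
    rw [← map_smul, ← map_sub, hR, this]

end FormResolvent

end QuantumStrip

namespace QuantumStrip

/-! ### Abstract comparison of a two-dimensional and a one-dimensional resolvent -/

section Comparison

set_option linter.unusedSectionVars false

variable {E K : Type*} [NormedAddCommGroup E] [InnerProductSpace ℂ E] [CompleteSpace E]
  [NormedAddCommGroup K] [InnerProductSpace ℂ K] [CompleteSpace K]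

theorem re_inner_self {X : Type*} [NormedAddCommGroup X] [InnerProductSpace ℂ X] (x : X) :
    (inner ℂ x x).re = ‖x‖ ^ 2 := inner_self_eq_norm_sq (𝕜 := ℂ) x

/-- Moves the comparison from `L²(Π)` to the weighted space: the mode embedding factors through the
transform `U`, so `U` can be pulled out of the difference of resolvents. -/
theorem directSumZero_comp {L : Type*} [NormedAddCommGroup L] [InnerProductSpace ℂ L]
    [CompleteSpace L] (U : E →ₗᵢ[ℂ] L) (J : K →ₗᵢ[ℂ] E) (R : K →L[ℂ] K) :
    directSumZero (U.comp J) R = directSumZero U (directSumZero J R) := by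
  have : (U.comp J).toContinuousLinearMap =
      U.toContinuousLinearMap ∘L J.toContinuousLinearMap := rfl
  rw [directSumZero, this, ContinuousLinearMap.adjoint_comp]
  rfl

theorem norm_directSumZero_le (J : K →ₗᵢ[ℂ] E) (R : K →L[ℂ] K) : ‖directSumZero J R‖ ≤ ‖R‖ := by
  have hJ : ‖J.toContinuousLinearMap‖ ≤ 1 := J.norm_toContinuousLinearMap_le
  have hJ' : ‖ContinuousLinearMap.adjoint J.toContinuousLinearMap‖ ≤ 1 := by
    rwa [LinearIsometryEquiv.norm_map]
  calc ‖directSumZero J R‖ ≤ ‖J.toContinuousLinearMap‖ *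
        (‖R‖ * ‖ContinuousLinearMap.adjoint J.toContinuousLinearMap‖) :=
        (ContinuousLinearMap.opNorm_comp_le _ _).trans
          (mul_le_mul_of_nonneg_left (ContinuousLinearMap.opNorm_comp_le _ _) (norm_nonneg _))
    _ ≤ 1 * (‖R‖ * 1) := by gcongr
    _ = ‖R‖ := by ring

theorem directSumZero_sub (J : K →ₗᵢ[ℂ] E) (R R' : K →L[ℂ] K) :
    directSumZero J (R - R') = directSumZero J R - directSumZero J R' := by
  ext x
  simp [directSumZero]

theorem continuous_snd_fst : Continuous fun x : E × WithLp 2 (E × E) => x.2.fst :=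
  (WithLp.prod_continuous_ofLp 2 E E).fst.comp continuous_snd

theorem continuous_snd_snd : Continuous fun x : E × WithLp 2 (E × E) => x.2.snd :=
  (WithLp.prod_continuous_ofLp 2 E E).snd.comp continuous_snd

/-- The form domain is a closure, so with this lemma estimates that are continuous in the graph norm
need only be proved for test functions. -/
theorem forall_mem_closure_le {X : Type*} [NormedAddCommGroup X] [NormedSpace ℂ X]
    {T : Submodule ℂ X} {u v : X → ℝ} (hu : Continuous u) (hv : Continuous v)
    (h : ∀ x ∈ T, u x ≤ v x) : ∀ x ∈ T.topologicalClosure, u x ≤ v x := fun _ hx =>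
  closure_minimal (s := (T : Set X)) (t := {x | u x ≤ v x}) h (isClosed_le hu hv) hx

theorem forall_mem_closure_eq {X Y : Type*} [NormedAddCommGroup X] [NormedSpace ℂ X]
    [TopologicalSpace Y] [T2Space Y]
    {T : Submodule ℂ X} {u v : X → Y} (hu : Continuous u) (hv : Continuous v)
    (h : ∀ x ∈ T, u x = v x) : ∀ x ∈ T.topologicalClosure, u x = v x := fun _ hx =>
  closure_minimal (s := (T : Set X)) (t := {x | u x = v x}) h (isClosed_eq hu hv) hx

theorem norm_inner_clm_le {ε : ℝ} {A : E →L[ℂ] E} (hA : ‖A‖ ≤ ε) (x y : E) :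
    ‖inner ℂ x (A y)‖ ≤ ε * (‖x‖ * ‖y‖) :=
  calc ‖inner ℂ x (A y)‖ ≤ ‖x‖ * ‖A y‖ := norm_inner_le_norm _ _
    _ ≤ ‖x‖ * (ε * ‖y‖) := by
      gcongr
      exact (A.le_opNorm _).trans (mul_le_mul_of_nonneg_right hA (norm_nonneg _))
    _ = ε * (‖x‖ * ‖y‖) := by ring

theorem le_div_of_mul_sq_le {c r X : ℝ} (hc : 0 < c) (hr : 0 ≤ r) (hX : 0 ≤ X)
    (h : c * r ^ 2 ≤ X * r) : r ≤ X / c := by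
  rw [le_div_iff₀ hc]
  rcases hr.eq_or_lt with rfl | hr'
  · simpa using hX
  · nlinarith

/-- From `r² ≤ X s ≤ X²/c`; the condition `c ≤ 1` lets gradients obey the same bound `X / c` as the
functions themselves, instead of `X / √c`. -/
theorem le_div_of_sq_le_mul {c r s X : ℝ} (hc : 0 < c) (hc1 : c ≤ 1) (hX : 0 ≤ X)
    (hs : s ≤ X / c) (h : r ^ 2 ≤ X * s) : r ≤ X / c := by
  refine abs_le_of_sq_le_sq' ?_ (by positivity) |>.2
  calc r ^ 2 ≤ X * s := h
    _ ≤ X * (X / c) := by gcongr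
    _ = (X ^ 2 / c ^ 2) * c := by field_simp
    _ ≤ (X ^ 2 / c ^ 2) * 1 := by gcongr
    _ = (X / c) ^ 2 := by ring

set_option maxHeartbeats 1000000 in
/-- Comparison of the resolvent of a two-dimensional form with that of a one-dimensional form,
`J` being the embedding of the first transverse mode. -/
theorem norm_formResolvent_sub_le {T : Submodule ℂ (E × WithLp 2 (E × E))}
    {S₀ S : Submodule ℂ (K × K)} (hS₀ : ∀ x ∈ S, x ∈ S₀.topologicalClosure)
    (hS : IsClosed (S : Set (K × K)))
    (J : K →ₗᵢ[ℂ] E) {Mf Mi Mm MV R : E →L[ℂ] E} {Ve Re : K →L[ℂ] K} {e z c ε a : ℝ}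
    (hc : 0 < c) (hc1 : c ≤ 1) (hε : 0 ≤ ε) (ha : 0 < a)
    (hR : IsFormResolvent T.topologicalClosure
      ((0 : E →L[ℂ] E) - ((e + z : ℝ) : ℂ) • ContinuousLinearMap.id ℂ E) R)
    (hRe : IsFormResolvent S (Ve - (z : ℂ) • ContinuousLinearMap.id ℂ K) Re)
    (hVe : ∀ x, c * ‖x‖ ^ 2 ≤ (inner ℂ x ((Ve - (z : ℂ) • ContinuousLinearMap.id ℂ K) x)).re)
    (hMf : ∀ x y, inner ℂ (Mf x) y = inner ℂ x (Mf y))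
    (hMm : ∀ x y, inner ℂ (Mm x) y = inner ℂ x (Mm y))
    (h1 : ∀ x ∈ T, c * ‖x.1‖ ^ 2 + ‖x.2.fst‖ ^ 2 + (2 * a ^ 2)⁻¹ *
      ‖x.1 - J (ContinuousLinearMap.adjoint J.toContinuousLinearMap x.1)‖ ^ 2 ≤
        ‖x.2‖ ^ 2 - (e + z) * ‖x.1‖ ^ 2)
    (h2 : ∀ x ∈ T, (ContinuousLinearMap.adjoint J.toContinuousLinearMap x.1,
      ContinuousLinearMap.adjoint J.toContinuousLinearMap (Mf x.2.fst + Mm x.1)) ∈ S)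
    (h3 : ∀ y ∈ S₀, ∃ g : WithLp 2 (E × E), (J y.1, g) ∈ T.topologicalClosure ∧
      g.fst = Mi (J y.2) - Mi (Mm (J y.1)) ∧
      ∀ x ∈ T, inner ℂ x.2.snd g.snd = (e : ℂ) * inner ℂ x.1 (J y.1) + inner ℂ x.1 (MV (J y.1)))
    (b1 : ‖Mi - Mf‖ ≤ ε) (b2 : ‖Mm‖ ≤ ε) (b3 : ‖Mi ∘L Mm‖ ≤ ε)
    (b4 : ∀ y, ‖MV (J y) - J (Ve y)‖ ≤ ε * ‖y‖) :
    ‖R - directSumZero J Re‖ ≤ 4 * ε / c ^ 2 + 2 * a / c := by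
  set J' := ContinuousLinearMap.adjoint J.toContinuousLinearMap with hJ'
  have hJJ : ∀ x y, inner ℂ (J x) y = inner ℂ x (J' y) := fun x y =>
    (ContinuousLinearMap.adjoint_inner_right J.toContinuousLinearMap x y).symm
  have hJJ2 : ∀ x y, inner ℂ y (J x) = inner ℂ (J' y) x := fun x y =>
    (ContinuousLinearMap.adjoint_inner_left J.toContinuousLinearMap x y).symm
  have hJn : ∀ y, ‖J' y‖ ≤ ‖y‖ := fun y => by
    have : ‖J'‖ ≤ 1 := by
      rw [hJ', LinearIsometryEquiv.norm_map]
      exact J.norm_toContinuousLinearMap_le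
    simpa using (J'.le_opNorm y).trans (mul_le_mul_of_nonneg_right this (norm_nonneg _))
  have c1 := continuous_snd_fst (E := E)
  have c2 := continuous_snd_snd (E := E)
  have h1' := forall_mem_closure_le (by fun_prop) (by fun_prop) h1
  have h2' : ∀ x ∈ T.topologicalClosure, (J' x.1, J' (Mf x.2.fst + Mm x.1)) ∈ S := fun x hx =>
    closure_minimal (s := (T : Set (E × WithLp 2 (E × E))))
      (t := {x | (J' x.1, J' (Mf x.2.fst + Mm x.1)) ∈ S}) h2
      (hS.preimage (f := fun x : E × WithLp 2 (E × E) => (J' x.1, J' (Mf x.2.fst + Mm x.1)))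
        (by fun_prop)) hx
  -- The strip equation with datum `v` is tested with `J y.1`. By `h3` the large number `e` appears
  -- in `⟪x.2.snd, g.snd⟫` exactly as in the form and cancels; what remains beyond the
  -- one-dimensional form evaluated at `J' x` is four terms, each carrying one of the small
  -- operators of `b1`–`b4`.
  have key : ∀ x ∈ T.topologicalClosure, ∀ v : E,
      (∀ y ∈ T.topologicalClosure, inner ℂ x.2 y.2 - ((e + z : ℝ) : ℂ) * inner ℂ x.1 y.1 =
        inner ℂ v y.1) → ∀ y ∈ S₀,
      ‖inner ℂ v (J y.1) - (inner ℂ (J' (Mf x.2.fst + Mm x.1)) y.2 +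
        inner ℂ (J' x.1) (Ve y.1 - (z : ℂ) • y.1))‖ ≤
      ε * ((‖x.2.fst‖ + ‖x.1‖) * (‖y.2‖ + ‖y.1‖)) := by
    intro x hx v hv y hy
    obtain ⟨g, hg, hg1, hg2⟩ := h3 y hy
    have hg2' := forall_mem_closure_eq (X := E × WithLp 2 (E × E)) (by fun_prop) (by fun_prop)
      hg2 x hx
    have e1 := hv _ hg
    rw [WithLp.prod_inner_apply] at e1
    change inner ℂ x.2.fst g.fst + inner ℂ x.2.snd g.snd - _ = _ at e1
    rw [hg2', hg1] at e1
    have e2 : inner ℂ v (J y.1) - (inner ℂ (J' (Mf x.2.fst + Mm x.1)) y.2 +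
        inner ℂ (J' x.1) (Ve y.1 - (z : ℂ) • y.1)) =
        inner ℂ x.2.fst ((Mi - Mf) (J y.2)) - inner ℂ x.2.fst ((Mi ∘L Mm) (J y.1)) -
        inner ℂ x.1 (Mm (J y.2)) + inner ℂ x.1 (MV (J y.1) - J (Ve y.1)) := by
      rw [← e1, ← hJJ2, ← hJJ2]
      simp only [map_sub, map_smul, inner_sub_right, inner_add_left, inner_smul_right, hMf, hMm,
        sub_apply, ContinuousLinearMap.comp_apply]
      push_cast
      ring
    rw [e2]
    have n1 := norm_inner_clm_le b1 x.2.fst (J y.2)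
    have n2 := norm_inner_clm_le b3 x.2.fst (J y.1)
    have n3 := norm_inner_clm_le b2 x.1 (J y.2)
    have n4 : ‖inner ℂ x.1 (MV (J y.1) - J (Ve y.1))‖ ≤ ε * (‖x.1‖ * ‖y.1‖) :=
      (norm_inner_le_norm _ _).trans
        ((mul_le_mul_of_nonneg_left (b4 y.1) (norm_nonneg _)).trans_eq (by ring))
    simp only [J.norm_map] at n1 n2 n3
    refine (norm_add_le _ _).trans ?_
    refine (add_le_add ((norm_sub_le _ _).trans (add_le_add (norm_sub_le _ _) le_rfl))
      le_rfl).trans ?_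
    nlinarith
  -- Both sides are continuous in `y`, so the estimate passes from the core `S₀` to `S`, where the
  -- solutions of the line equation live.
  have key' : ∀ x ∈ T.topologicalClosure, ∀ v : E,
      (∀ y ∈ T.topologicalClosure, inner ℂ x.2 y.2 - ((e + z : ℝ) : ℂ) * inner ℂ x.1 y.1 =
        inner ℂ v y.1) → ∀ y ∈ S,
      ‖inner ℂ v (J y.1) - (inner ℂ (J' (Mf x.2.fst + Mm x.1)) y.2 +
        inner ℂ (J' x.1) (Ve y.1 - (z : ℂ) • y.1))‖ ≤
      ε * ((‖x.2.fst‖ + ‖x.1‖) * (‖y.2‖ + ‖y.1‖)) := fun x hx v hv y hy =>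
    forall_mem_closure_le (by fun_prop) (by fun_prop) (key x hx v hv) y (hS₀ y hy)
  have hL : ∀ x : E, ((0 : E →L[ℂ] E) - ((e + z : ℝ) : ℂ) • ContinuousLinearMap.id ℂ E) x =
      -(((e + z : ℝ) : ℂ) • x) := fun x => zero_sub _
  have hsym : ∀ x y : E, inner ℂ (((0 : E →L[ℂ] E) -
      ((e + z : ℝ) : ℂ) • ContinuousLinearMap.id ℂ E) x) y =
      inner ℂ x (((0 : E →L[ℂ] E) - ((e + z : ℝ) : ℂ) • ContinuousLinearMap.id ℂ E) y) := by
    intro x y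
    rw [hL, hL, inner_neg_left, inner_neg_right, inner_smul_left, inner_smul_right,
      Complex.conj_ofReal]
  have hmain : ∀ v w : E, ‖inner ℂ v ((R - directSumZero J Re) w)‖ ≤
      (4 * ε / c ^ 2 + 2 * a / c) * (‖v‖ * ‖w‖) := by
    intro v w
    obtain ⟨p, hp, hp'⟩ := hR v
    obtain ⟨d, hd, hd'⟩ := hRe (J' w)
    have hv : ∀ y ∈ T.topologicalClosure,
        inner ℂ p y.2 - ((e + z : ℝ) : ℂ) * inner ℂ (R v) y.1 = inner ℂ v y.1 := by
      intro y hy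
      have := congrArg (starRingEnd ℂ) (hp' y hy)
      simp only [map_add, inner_conj_symm] at this
      rw [← this]
      rw [hL, inner_neg_left, inner_smul_left, Complex.conj_ofReal, sub_eq_add_neg]
    -- Here `y` is the solution of the line equation with datum `J' w`. That equation, tested with
    -- `J' (R v)` and its derivative from `h2'`, then turns the one-dimensional form value into `⟪J'
    -- (R v), J' w⟫`.
    have hb := key' _ hp v hv _ hd
    have hd2 := hd' _ (h2' _ hp)
    simp only [sub_apply, smul_apply, ContinuousLinearMap.id_apply] at hd2
    rw [hd2] at hb
    have hQ := h1' _ hp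
    have hQ2 := congrArg Complex.re (hv _ hp)
    simp only [Complex.sub_re, Complex.re_ofReal_mul] at hQ2
    rw [show (inner ℂ p p).re = ‖p‖ ^ 2 from re_inner_self _,
      show (inner ℂ (R v) (R v)).re = ‖R v‖ ^ 2 from re_inner_self _] at hQ2
    simp only at hQ
    rw [hQ2] at hQ
    have hQ3 : (inner ℂ v (R v)).re ≤ ‖v‖ * ‖R v‖ :=
      (Complex.re_le_norm _).trans (norm_inner_le_norm _ _)
    have hD := hd' _ hd
    have hD2 := congrArg Complex.re hD
    simp only [Complex.add_re] at hD2
    rw [show (inner ℂ d d).re = ‖d‖ ^ 2 from re_inner_self _] at hD2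
    have hD3 : (inner ℂ (Re (J' w)) (J' w)).re ≤ ‖Re (J' w)‖ * ‖w‖ :=
      (Complex.re_le_norm _).trans ((norm_inner_le_norm _ _).trans
        (mul_le_mul_of_nonneg_left (hJn w) (norm_nonneg _)))
    have hD4 := hVe (Re (J' w))
    set X := ‖v‖ with hX
    set Y := ‖w‖ with hY
    have hX0 : 0 ≤ X := norm_nonneg _
    have hY0 : 0 ≤ Y := norm_nonneg _
    have hP0 : 0 ≤ (2 * a ^ 2)⁻¹ * ‖R v - J (J' (R v))‖ ^ 2 := by positivity
    have hP1 := sq_nonneg ‖p.fst‖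
    have hP2 : 0 ≤ c * ‖R v‖ ^ 2 := by positivity
    have hP3 : 0 ≤ c * ‖Re (J' w)‖ ^ 2 := by positivity
    have hP4 := sq_nonneg ‖d‖
    have r1 : ‖R v‖ ≤ X / c := le_div_of_mul_sq_le hc (norm_nonneg _) hX0 (by linarith)
    have r2 : ‖p.fst‖ ≤ X / c := le_div_of_sq_le_mul hc hc1 hX0 r1 (by linarith)
    have r3 : ‖Re (J' w)‖ ≤ Y / c := le_div_of_mul_sq_le hc (norm_nonneg _) hY0 (by linarith)
    have r4 : ‖d‖ ≤ Y / c := le_div_of_sq_le_mul hc hc1 hY0 r3 (by linarith)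
    -- The gap term of `h1` has weight `(2a²)⁻¹`, which exceeds the square of `(2a)⁻¹`; the
    -- orthogonal part is therefore bounded by `2a X / c`.
    have r5 : ‖R v - J (J' (R v))‖ ≤ 2 * a * (X / c) := by
      have : (2 * a)⁻¹ * ‖R v - J (J' (R v))‖ ≤ X / c := by
        refine le_div_of_sq_le_mul hc hc1 hX0 r1 ?_
        have : ((2 * a)⁻¹ * ‖R v - J (J' (R v))‖) ^ 2 =
            1 / 2 * ((2 * a ^ 2)⁻¹ * ‖R v - J (J' (R v))‖ ^ 2) := by
          field_simp
        rw [this]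
        linarith
      rwa [inv_mul_le_iff₀ (by positivity)] at this
    -- Symmetry moves `R` onto `v`; then `R v` is split into its part orthogonal to the mode,
    -- handled by `r5`, and its part along the mode, handled by `hb`.
    have hsplit : inner ℂ v ((R - directSumZero J Re) w) =
        inner ℂ (R v - J (J' (R v))) w -
          (inner ℂ v (J (Re (J' w))) - inner ℂ (J' (R v)) (J' w)) := by
      rw [sub_apply, inner_sub_right, ← hR.inner_eq hsym, inner_sub_left, hJJ]
      change _ - inner ℂ v (J (Re (J' w))) = _
      ring
    rw [hsplit]
    calc _ ≤ ‖inner ℂ (R v - J (J' (R v))) w‖ +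
          ‖inner ℂ v (J (Re (J' w))) - inner ℂ (J' (R v)) (J' w)‖ := norm_sub_le _ _
      _ ≤ 2 * a * (X / c) * Y + ε * ((X / c + X / c) * (Y / c + Y / c)) := by
        refine add_le_add ((norm_inner_le_norm _ _).trans ?_) (hb.trans ?_)
        · gcongr
        · gcongr
      _ = _ := by
        field_simp
        ring
  refine ContinuousLinearMap.opNorm_le_bound _ (by positivity) fun w => ?_
  -- The bilinear bound becomes an operator norm bound by taking for `v` the image of `w` under the
  -- difference.
  have h := hmain ((R - directSumZero J Re) w) w
  rw [inner_self_eq_norm_sq_to_K, norm_pow, RCLike.norm_ofReal, abs_norm] at h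
  rcases (norm_nonneg ((R - directSumZero J Re) w)).eq_or_lt with h0 | h0
  · rw [← h0]
    positivity
  · refine le_of_mul_le_mul_left ?_ h0
    linarith

end Comparison

end QuantumStrip

namespace QuantumStrip

/-! ### Multiplication operators -/

section Mul

variable {α : Type*} [MeasurableSpace α] {μ : Measure α}

theorem memLp_bounded_mul {g : α → ℝ} (hg : Measurable g) {C : ℝ} (hC : ∀ᵐ p ∂μ, |g p| ≤ C)
    {ψ : α → ℂ} (hψ : MemLp ψ 2 μ) : MemLp (fun p => (g p : ℂ) * ψ p) 2 μ := by
  refine hψ.of_le_mul (c := C) ((Complex.measurable_ofReal.comp hg).aestronglyMeasurable.mul hψ.1)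
    ?_
  filter_upwards [hC] with p hp
  rw [norm_mul, Complex.norm_real, Real.norm_eq_abs]
  gcongr

/-- Multiplication by a bounded measurable real function. -/
def mulL {g : α → ℝ} (hg : Measurable g) {C : ℝ} (hC : ∀ᵐ p ∂μ, |g p| ≤ C) :
    Lp ℂ 2 μ →L[ℂ] Lp ℂ 2 μ :=
  LinearMap.mkContinuous
    { toFun := fun ψ => (memLp_bounded_mul hg hC (Lp.memLp ψ)).toLp _
      map_add' := fun ψ χ => by
        rw [← MemLp.toLp_add]
        refine MemLp.toLp_congr _ _ ?_
        filter_upwards [coeFn_add_ae ψ χ] with p hp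
        rw [hp, mul_add]
        rfl
      map_smul' := fun c ψ => by
        rw [RingHom.id_apply, ← MemLp.toLp_const_smul]
        refine MemLp.toLp_congr _ _ ?_
        filter_upwards [Lp.coeFn_smul c ψ] with p hp
        rw [hp, Pi.smul_apply, Pi.smul_apply, smul_eq_mul, smul_eq_mul, mul_left_comm] } C (fun ψ => by
      refine Lp.norm_le_mul_norm_of_ae_le_mul ?_
      filter_upwards [hC, MemLp.coeFn_toLp (memLp_bounded_mul hg hC (Lp.memLp ψ))] with p hp h
      simp only [LinearMap.coe_mk, AddHom.coe_mk]
      rw [h, norm_mul, Complex.norm_real, Real.norm_eq_abs]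
      gcongr)

theorem coeFn_mulL {g : α → ℝ} (hg : Measurable g) {C : ℝ} (hC : ∀ᵐ p ∂μ, |g p| ≤ C)
    (ψ : Lp ℂ 2 μ) : ∀ᵐ p ∂μ, mulL hg hC ψ p = (g p : ℂ) * ψ p :=
  MemLp.coeFn_toLp (memLp_bounded_mul hg hC (Lp.memLp ψ))

theorem inner_eq_integral (x y : Lp ℂ 2 μ) :
    inner ℂ x y = ∫ p, (starRingEnd ℂ) (x p) * y p ∂μ := by
  rw [L2.inner_def]
  simp [mul_comm]

theorem inner_mulL {g : α → ℝ} (hg : Measurable g) {C : ℝ} (hC : ∀ᵐ p ∂μ, |g p| ≤ C)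
    (x y : Lp ℂ 2 μ) : inner ℂ (mulL hg hC x) y = inner ℂ x (mulL hg hC y) := by
  rw [inner_eq_integral, inner_eq_integral]
  refine integral_congr_ae ?_
  filter_upwards [coeFn_mulL hg hC x, coeFn_mulL hg hC y] with p h1 h2
  rw [h1, h2, map_mul, Complex.conj_ofReal]
  ring

theorem norm_mulL_le {g : α → ℝ} (hg : Measurable g) {C : ℝ} (hC : ∀ᵐ p ∂μ, |g p| ≤ C)
    {ε : ℝ} (hε : 0 ≤ ε) (h : ∀ᵐ p ∂μ, |g p| ≤ ε) : ‖mulL hg hC‖ ≤ ε := by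
  refine ContinuousLinearMap.opNorm_le_bound _ hε fun ψ => ?_
  refine Lp.norm_le_mul_norm_of_ae_le_mul ?_
  filter_upwards [h, coeFn_mulL hg hC ψ] with p hp h
  rw [h, norm_mul, Complex.norm_real, Real.norm_eq_abs]
  gcongr

theorem norm_sq_eq_integral (x : Lp ℂ 2 μ) : ‖x‖ ^ 2 = ∫ p, ‖x p‖ ^ 2 ∂μ := by
  rw [← re_inner_self, inner_eq_integral]
  have h : ∀ p, (starRingEnd ℂ) (x p) * x p = ((‖x p‖ ^ 2 : ℝ) : ℂ) := fun p => by
    rw [Complex.conj_mul']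
    push_cast
    rfl
  simp_rw [h]
  rw [integral_complex_ofReal, Complex.ofReal_re]

theorem re_inner_mulL_ge {g : α → ℝ} (hg : Measurable g) {C : ℝ} (hC : ∀ᵐ p ∂μ, |g p| ≤ C)
    {m : ℝ} (h : ∀ᵐ p ∂μ, m ≤ g p) (x : Lp ℂ 2 μ) :
    m * ‖x‖ ^ 2 ≤ (inner ℂ x (mulL hg hC x)).re := by
  have e : inner ℂ x (mulL hg hC x) = ((∫ p, g p * ‖x p‖ ^ 2 ∂μ : ℝ) : ℂ) := by
    rw [inner_eq_integral, ← integral_complex_ofReal]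
    refine integral_congr_ae ?_
    filter_upwards [coeFn_mulL hg hC x] with p h1
    rw [h1]
    push_cast
    rw [← Complex.conj_mul']
    ring
  have hi : Integrable (fun p => ‖x p‖ ^ 2) μ :=
    (Lp.memLp x).integrable_norm_pow (p := 2) (by norm_num)
  rw [e, Complex.ofReal_re, norm_sq_eq_integral, ← integral_const_mul]
  refine integral_mono_ae (hi.const_mul _) ?_ ?_
  · refine hi.bdd_mul (c := C) hg.aestronglyMeasurable ?_
    simpa using hC
  · filter_upwards [h] with p hp
    gcongr

end Mul

/-! ### The effective operator on the line -/

/-- Writes the bilinear pairing as an inner product with a fixed vector, which makes it continuous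
in `ψ`; closedness of the Sobolev graph follows at once. -/
theorem integral_mul_eq_inner {φ : ℝ → ℂ} (hφ : MemLp φ 2 volume) (ψ : L2Line) :
    ∫ s, φ s * ψ s = inner ℂ (star hφ.toLp) ψ := by
  rw [inner_eq_integral]
  refine integral_congr_ae ?_
  filter_upwards [hφ.coeFn_toLp, Lp.coeFn_star hφ.toLp] with s h1 h2
  rw [h2, Pi.star_apply, h1]
  simp

theorem IsTest.memLp {φ : ℝ → ℂ} (h : IsTest Set.univ φ) : MemLp φ 2 volume :=
  h.1.continuous.memLp_of_hasCompactSupport h.2.1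

theorem IsTest.deriv {φ : ℝ → ℂ} (h : IsTest Set.univ φ) : IsTest Set.univ (deriv φ) :=
  ⟨(contDiff_infty_iff_deriv.1 h.1).2, h.2.1.deriv, Set.subset_univ _⟩

theorem isClosed_sobolevLine : IsClosed (sobolevLine : Set (L2Line × L2Line)) := by
  have : (sobolevLine : Set (L2Line × L2Line)) = ⋂ (φ : ℝ → ℂ) (hφ : IsTest Set.univ φ),
      {x | inner ℂ (star hφ.deriv.memLp.toLp : L2Line) x.1 =
        -inner ℂ (star hφ.memLp.toLp : L2Line) x.2} := by
    ext x
    simp only [Set.mem_iInter, Set.mem_ofPred_eq]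
    refine forall₂_congr fun φ hφ => ?_
    rw [integral_mul_eq_inner hφ.memLp, integral_mul_eq_inner hφ.deriv.memLp]
  rw [this]
  exact isClosed_iInter fun φ => isClosed_iInter fun hφ => isClosed_eq (by fun_prop) (by fun_prop)

/-- The pairs `(φ, φ')` with `φ` a test function. -/
def testLine : Submodule ℂ (L2Line × L2Line) where
  carrier := {x | ∃ φ : ℝ → ℂ, IsTest Set.univ φ ∧ (∀ᵐ s, x.1 s = φ s) ∧
    ∀ᵐ s, x.2 s = deriv φ s}
  zero_mem' := by
    refine ⟨fun _ => 0, IsTest.zero _, coeFn_zero_ae _, ?_⟩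
    filter_upwards [coeFn_zero_ae (volume : Measure ℝ)] with s hs
    exact hs.trans (by simp)
  add_mem' := by
    rintro x y ⟨φ, hφ, h0, h1⟩ ⟨χ, hχ, k0, k1⟩
    refine ⟨_, hφ.add hχ, ?_, ?_⟩
    · filter_upwards [h0, k0, coeFn_add_ae x.1 y.1] with s h k e
      exact e.trans (by rw [h, k])
    · filter_upwards [h1, k1, coeFn_add_ae x.2 y.2] with s h k e
      refine e.trans ?_
      rw [h, k, deriv_fun_add (hφ.1.differentiable (by simp) s)
        (hχ.1.differentiable (by simp) s)]
  smul_mem' := by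
    rintro c x ⟨φ, hφ, h0, h1⟩
    refine ⟨_, hφ.const_mul c, ?_, ?_⟩
    · filter_upwards [h0, Lp.coeFn_smul c x.1] with s h e
      exact e.trans (by rw [Pi.smul_apply, h, smul_eq_mul])
    · filter_upwards [h1, Lp.coeFn_smul c x.2] with s h e
      refine e.trans ?_
      rw [Pi.smul_apply, h, smul_eq_mul, deriv_const_mul _ (hφ.1.differentiable (by simp) s)]

theorem ae_eq_zero_of_test {u : L2Line}
    (h : ∀ φ : ℝ → ℂ, IsTest Set.univ φ → ∫ s, φ s * u s = 0) : u = 0 := by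
  have h1 : ∀ᵐ s : ℝ, u s = 0 := by
    refine ae_eq_zero_of_integral_contDiff_smul_eq_zero
      ((Lp.memLp u).locallyIntegrable (by norm_num)) fun g hg hg' => ?_
    refine Eq.trans ?_ (h (fun s => (g s : ℂ)) ⟨Complex.ofRealCLM.contDiff.comp hg,
      hg'.comp_left Complex.ofReal_zero, Set.subset_univ _⟩)
    simp
  refine Lp.ext ?_
  filter_upwards [h1, coeFn_zero_ae (volume : Measure ℝ)] with s h2 h3
  rw [h2, h3]

/-- A square integrable function with `u' = c u` weakly, `c ≠ 0`, vanishes. -/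
theorem eq_zero_of_weak_exp {u : L2Line} {c : ℝ} (hc : c ≠ 0)
    (h : ∀ φ : ℝ → ℂ, IsTest Set.univ φ → ∫ s, deriv φ s * u s = -(c : ℂ) * ∫ s, φ s * u s) :
    u = 0 := by
  refine ae_eq_zero_of_test fun φ hφ => ?_
  -- The convolution `U = u * g` is smooth, satisfies `U' = c U` classically, and `U 0 = ∫ φ u`
  -- because of the reflection. It is bounded by Cauchy–Schwarz, whereas a nonzero multiple of `exp
  -- (c x)` is not.
  set g : ℝ → ℂ := fun y => φ (-y) with hg
  have hgd : ContDiff ℝ ∞ g := hφ.1.comp contDiff_neg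
  have hgs : HasCompactSupport g := hφ.2.1.comp_homeomorph (Homeomorph.neg ℝ)
  have htest : ∀ x, IsTest Set.univ fun s => g (x - s) := fun x =>
    ⟨hgd.comp (contDiff_const.sub contDiff_id),
      hgs.comp_homeomorph (Homeomorph.subLeft x), Set.subset_univ _⟩
  set U : ℝ → ℂ := fun x => ∫ s, g (x - s) * u s with hU
  have hder : ∀ x, HasDerivAt U ((c : ℂ) * U x) x := by
    intro x
    have h1 := hgs.hasDerivAt_convolution_right (μ := volume) (ContinuousLinearMap.mul ℝ ℂ)
      ((Lp.memLp u).locallyIntegrable (by norm_num)) (hgd.of_le (by simp)) x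
    have h2 : convolution u g (ContinuousLinearMap.mul ℝ ℂ) volume = U := by
      ext y
      simp [convolution, hU, mul_comm]
    rw [h2] at h1
    have h3 := h _ (htest x)
    have h4 : ∀ s, deriv (fun s => g (x - s)) s = -deriv g (x - s) := fun s =>
      deriv_comp_const_sub ..
    simp only [h4, neg_mul, integral_neg, neg_inj] at h3
    have h5 : convolution u (deriv g) (ContinuousLinearMap.mul ℝ ℂ) volume x = c * U x := by
      refine Eq.trans ?_ h3
      simp [convolution, mul_comm]
    rw [h5] at h1
    exact h1
  have hconst : ∀ x, U x = Complex.exp (c * x) * U 0 := by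
    intro x
    have h1 : ∀ y : ℝ, HasDerivAt (fun y : ℝ => Complex.exp (-(c * y)) * U y) 0 y := by
      intro y
      have h2 : HasDerivAt (fun y : ℝ => Complex.exp (-(c * y)))
          (Complex.exp (-(c * y)) * -(c * 1)) y :=
        (((Complex.ofRealCLM.hasDerivAt (x := y)).const_mul (c : ℂ)).neg).cexp
      refine (h2.mul (hder y)).congr_deriv ?_
      ring
    have h3 := is_const_of_deriv_eq_zero (fun y => (h1 y).differentiableAt)
      (fun y => (h1 y).deriv) x 0
    simp only [Complex.ofReal_zero, mul_zero, neg_zero, Complex.exp_zero, one_mul] at h3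
    rw [← h3, ← mul_assoc, ← Complex.exp_add, add_neg_cancel, Complex.exp_zero, one_mul]
  have hbound : ∃ M, ∀ x, ‖U x‖ ≤ M := by
    refine ⟨√(∫ s, ‖g s‖ ^ 2) * ‖u‖, fun x => ?_⟩
    have hx := (htest x).memLp
    have h1 : ‖(star hx.toLp : L2Line)‖ = ‖(hx.toLp : L2Line)‖ := by
      rw [Lp.norm_def, Lp.norm_def]
      refine congrArg ENNReal.toReal (eLpNorm_congr_norm_ae ?_)
      filter_upwards [Lp.coeFn_star (R := ℂ) hx.toLp] with s hs
      rw [hs, Pi.star_apply]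
      exact norm_star _
    have h2 : ‖(hx.toLp : L2Line)‖ ^ 2 = ∫ s, ‖g s‖ ^ 2 := by
      rw [norm_sq_eq_integral]
      refine Eq.trans (integral_congr_ae ?_) (integral_sub_left_eq_self (fun s => ‖g s‖ ^ 2) _ x)
      filter_upwards [hx.coeFn_toLp] with s hs
      rw [hs]
    have : ‖(star hx.toLp : L2Line)‖ = √(∫ s, ‖g s‖ ^ 2) := by
      rw [h1, ← h2, Real.sqrt_sq (norm_nonneg _)]
    rw [← this, hU]
    simp only
    rw [integral_mul_eq_inner hx]
    exact norm_inner_le_norm _ _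
  obtain ⟨M, hM⟩ := hbound
  have h0 : U 0 = 0 := by
    by_contra hne
    have hpos : 0 < ‖U 0‖ := norm_pos_iff.2 hne
    obtain ⟨n, hn⟩ := exists_nat_gt (M / ‖U 0‖)
    rw [div_lt_iff₀ hpos] at hn
    -- At `n / c` the exponent is `n` whatever the sign of `c`.
    have h1 := hM (n / c)
    rw [hconst, norm_mul, Complex.norm_exp] at h1
    have h2 : ((c : ℂ) * ((n / c : ℝ) : ℂ)).re = n := by
      rw [← Complex.ofReal_mul, Complex.ofReal_re]
      field_simp
    rw [h2] at h1
    nlinarith [Real.add_one_le_exp (n : ℝ)]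
  simpa [hU, hg] using h0

theorem testPair_mem {φ : ℝ → ℂ} (hφ : IsTest Set.univ φ) :
    ((hφ.memLp.toLp : L2Line), (hφ.deriv.memLp.toLp : L2Line)) ∈ testLine :=
  ⟨φ, hφ, hφ.memLp.coeFn_toLp, hφ.deriv.memLp.coeFn_toLp⟩

theorem closure_testLine_le : testLine.topologicalClosure ≤ sobolevLine := by
  refine Submodule.topologicalClosure_minimal _ ?_ isClosed_sobolevLine
  rintro y ⟨χ, hχ, h0, h1⟩ φ hφ
  have e1 : ∫ s, deriv φ s * y.1 s = ∫ s, deriv φ s * χ s := by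
    refine integral_congr_ae ?_
    filter_upwards [h0] with s hs
    rw [hs]
  have e2 : ∫ s, φ s * y.2 s = ∫ s, φ s * deriv χ s := by
    refine integral_congr_ae ?_
    filter_upwards [h1] with s hs
    rw [hs]
  rw [e1, e2]
  have := integral_mul_deriv_eq_deriv_mul_of_integrable (u := φ) (v := χ) (u' := deriv φ)
    (v' := deriv χ) (fun s _ => (hφ.1.differentiable (by simp) s).hasDerivAt)
    (fun s _ => (hχ.1.differentiable (by simp) s).hasDerivAt)
    ((hφ.1.continuous.mul hχ.deriv.1.continuous).integrable_of_hasCompactSupport hφ.2.1.mul_right)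
    ((hφ.deriv.1.continuous.mul hχ.1.continuous).integrable_of_hasCompactSupport
      hχ.2.1.mul_left)
    ((hφ.1.continuous.mul hχ.1.continuous).integrable_of_hasCompactSupport hφ.2.1.mul_right)
  rw [this, neg_neg]

/-- Density of test functions in `W^{1,2}(ℝ)` without cutoffs or mollifiers. A pair `(w₁, w₂)` of
the Sobolev graph orthogonal to all test pairs satisfies `w₁' = w₂` and `w₂' = w₁` weakly, so `w₁ +
w₂` and `w₁ - w₂` are square integrable solutions of `u' = u` and `u' = -u`, hence zero. -/
theorem sobolevLine_le_closure : ∀ x ∈ sobolevLine, x ∈ testLine.topologicalClosure := by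
  intro x hx
  let e : WithLp 2 (L2Line × L2Line) ≃L[ℂ] L2Line × L2Line :=
    WithLp.prodContinuousLinearEquiv 2 ℂ L2Line L2Line
  let V : Submodule ℂ (WithLp 2 (L2Line × L2Line)) :=
    testLine.topologicalClosure.comap e.toLinearMap
  have hV : IsClosed (V : Set (WithLp 2 (L2Line × L2Line))) :=
    testLine.isClosed_topologicalClosure.preimage e.continuous
  have : CompleteSpace V := hV.completeSpace_coe
  obtain ⟨y, hy, w, hw, hyw⟩ := V.exists_add_mem_mem_orthogonal (e.symm x)
  have hwS : e w ∈ sobolevLine := by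
    have : e w = x - e y := by rw [← e.apply_symm_apply x, hyw]; simp
    rw [this]
    exact sobolevLine.sub_mem hx (closure_testLine_le hy)
  have horth : ∀ φ : ℝ → ℂ, IsTest Set.univ φ →
      (∫ s, φ s * (e w).1 s) + ∫ s, deriv φ s * (e w).2 s = 0 := by
    intro φ hφ
    have hc : IsTest Set.univ fun s => star (φ s) :=
      ⟨Complex.conjCLE.contDiff.comp hφ.1, hφ.2.1.comp_left (star_zero ℂ), Set.subset_univ _⟩
    have h1 := hw (e.symm (hc.memLp.toLp, hc.deriv.memLp.toLp))
      (by simpa [V] using testLine.le_topologicalClosure (testPair_mem hc))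
    rw [WithLp.prod_inner_apply] at h1
    change inner ℂ (hc.memLp.toLp : L2Line) (e w).1 +
      inner ℂ (hc.deriv.memLp.toLp : L2Line) (e w).2 = 0 at h1
    rw [inner_eq_integral, inner_eq_integral] at h1
    rw [← h1]
    congr 1
    · refine integral_congr_ae ?_
      filter_upwards [hc.memLp.coeFn_toLp] with s hs
      rw [hs]
      simp
    · refine integral_congr_ae ?_
      filter_upwards [hc.deriv.memLp.coeFn_toLp] with s hs
      rw [hs, deriv.star]
      simp
  have hweak : ∀ φ : ℝ → ℂ, IsTest Set.univ φ →
      ∫ s, deriv φ s * (e w).1 s = -∫ s, φ s * (e w).2 s := hwS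
  have hadd : ∀ χ : ℝ → ℂ, IsTest Set.univ χ → ∀ a b : L2Line,
      ∫ s, χ s * (a + b : L2Line) s = (∫ s, χ s * a s) + ∫ s, χ s * b s := by
    intro χ hχ a b
    simp only [integral_mul_eq_inner hχ.memLp, inner_add_right]
  have hsub' : ∀ χ : ℝ → ℂ, IsTest Set.univ χ → ∀ a b : L2Line,
      ∫ s, χ s * (a - b : L2Line) s = (∫ s, χ s * a s) - ∫ s, χ s * b s := by
    intro χ hχ a b
    simp only [integral_mul_eq_inner hχ.memLp, inner_sub_right]
  have hplus : (e w).1 + (e w).2 = 0 := by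
    refine eq_zero_of_weak_exp (c := 1) one_ne_zero fun φ hφ => ?_
    rw [hadd _ hφ.deriv, hadd _ hφ, hweak _ hφ]
    have := horth φ hφ
    push_cast
    linear_combination this
  have hminus : (e w).1 - (e w).2 = 0 := by
    refine eq_zero_of_weak_exp (c := -1) (by norm_num) fun φ hφ => ?_
    rw [hsub' _ hφ.deriv, hsub' _ hφ, hweak _ hφ]
    have := horth φ hφ
    push_cast
    linear_combination -this
  have h1 : (e w).1 = (e w).2 := sub_eq_zero.1 hminus
  have h2 : (e w).2 = 0 := by
    rw [h1, ← two_smul ℂ] at hplus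
    exact (smul_eq_zero.1 hplus).resolve_left two_ne_zero
  have h3 : e w = 0 := Prod.ext (h1.trans h2) h2
  have h4 : w = 0 := by simpa using h3
  rw [h4, add_zero] at hyw
  have : x = e y := by rw [← hyw]; simp
  rw [this]
  exact hy

end QuantumStrip

/-! ### Graph and resolvent of the effective operator -/

namespace QuantumStrip

theorem sobolevLine_dense (w : L2Line) (h : ∀ y ∈ sobolevLine, inner ℂ y.1 w = 0) : w = 0 := by
  refine ae_eq_zero_of_test fun φ hφ => ?_
  have hc : IsTest Set.univ fun s => star (φ s) :=
    ⟨Complex.conjCLE.contDiff.comp hφ.1, hφ.2.1.comp_left (star_zero ℂ), Set.subset_univ _⟩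
  have h1 := h _ (closure_testLine_le (testLine.le_topologicalClosure (testPair_mem hc)))
  rw [inner_eq_integral] at h1
  rw [← h1]
  refine integral_congr_ae ?_
  filter_upwards [hc.memLp.coeFn_toLp] with s hs
  rw [hs]
  simp

theorem mem_graph_mulOperator {V : ℝ → ℝ} (hV : Measurable V) {C : ℝ}
    (hC : ∀ᵐ s : ℝ, |V s| ≤ C) (x : L2Line × L2Line) :
    x ∈ (mulOperator V).graph ↔ x.2 = mulL hV hC x.1 := by
  rw [mulOperator, Submodule.toLinearPMap_graph_eq]
  · change (∀ᵐ s, x.2 s = (V s : ℂ) * x.1 s) ↔ _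
    constructor
    · intro h
      refine Lp.ext ?_
      filter_upwards [h, coeFn_mulL hV hC x.1] with s h1 h2
      rw [h1, h2]
    · intro h
      rw [h]
      exact coeFn_mulL hV hC x.1
  · intro y (hy : ∀ᵐ s, y.2 s = (V s : ℂ) * y.1 s) h0
    refine Lp.ext ?_
    rw [h0] at hy
    filter_upwards [hy, coeFn_zero_ae (volume : Measure ℝ)] with s h1 h2
    rw [h1, h2, mul_zero]

/-- Since `V` is bounded, its multiplication operator is defined everywhere and the sum keeps the
domain of the Laplacian. This is the shape of the graph required by `IsFormResolvent.isResolventAt`.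
-/
theorem mem_graph_lineLaplacian_add {V : ℝ → ℝ} (hV : Measurable V) {C : ℝ}
    (hC : ∀ᵐ s : ℝ, |V s| ≤ C) (x : L2Line × L2Line) :
    x ∈ (lineLaplacian + mulOperator V).graph ↔
      (x.1, x.2 - mulL hV hC x.1) ∈ energyGraph sobolevLine := by
  rw [← mem_graph_energyOperator sobolevLine_dense]
  constructor
  · intro hx
    obtain ⟨⟨y, hy1, hy2⟩, h1, h2⟩ := (LinearPMap.mem_graph_iff _).1 hx
    have e1 := (mem_graph_mulOperator hV hC _).1 ((mulOperator V).mem_graph ⟨y, hy2⟩)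
    have e2 := lineLaplacian.mem_graph ⟨y, hy1⟩
    rw [LinearPMap.add_apply] at h2
    simp only at h1 e1
    rw [← h1, ← h2, e1, add_sub_cancel_right]
    exact e2
  · intro hx
    obtain ⟨y, h1, h2⟩ := (LinearPMap.mem_graph_iff _).1 hx
    obtain ⟨y', h1', h2'⟩ := (LinearPMap.mem_graph_iff _).1
      ((mem_graph_mulOperator hV hC (x.1, mulL hV hC x.1)).2 rfl)
    refine (LinearPMap.mem_graph_iff _).2 ⟨⟨x.1, ?_, ?_⟩, rfl, ?_⟩
    · simp only at h1
      rw [← h1]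
      exact y.2
    · simp only at h1'
      rw [← h1']
      exact y'.2
    · rw [LinearPMap.add_apply]
      simp only at h1 h2 h1' h2'
      have e1 : ∀ h : x.1 ∈ lineLaplacian.domain, lineLaplacian ⟨x.1, h⟩ = lineLaplacian y :=
        fun h => congrArg _ (Subtype.ext h1.symm)
      have e2 : ∀ h : x.1 ∈ (mulOperator V).domain,
          mulOperator V ⟨x.1, h⟩ = mulOperator V y' := fun h => congrArg _ (Subtype.ext h1'.symm)
      rw [e1, e2, h2']
      change energyOperator sobolevLine y + _ = _
      rw [h2]
      simp

theorem exists_line_resolvent {V : ℝ → ℝ} (hV : Measurable V) {C : ℝ}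
    (hC : ∀ᵐ s : ℝ, |V s| ≤ C) {z c : ℝ} (hc : 0 < c) (h : ∀ s, z + c ≤ V s) :
    (∀ x, c * ‖x‖ ^ 2 ≤
      (inner ℂ x ((mulL hV hC - (z : ℂ) • ContinuousLinearMap.id ℂ L2Line) x)).re) ∧
    ∃ R, IsFormResolvent sobolevLine (mulL hV hC - (z : ℂ) • ContinuousLinearMap.id ℂ L2Line) R ∧
      IsResolventAt (lineLaplacian + mulOperator V) z R := by
  have hlow : ∀ x, c * ‖x‖ ^ 2 ≤
      (inner ℂ x ((mulL hV hC - (z : ℂ) • ContinuousLinearMap.id ℂ L2Line) x)).re := by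
    intro x
    have h1 := re_inner_mulL_ge hV hC (m := z + c) (Filter.Eventually.of_forall h) x
    simp only [sub_apply, smul_apply, ContinuousLinearMap.id_apply, inner_sub_right,
      inner_smul_right, Complex.sub_re, Complex.re_ofReal_mul, re_inner_self]
    linarith
  have hco : ∀ x ∈ sobolevLine, c * ‖x.1‖ ^ 2 ≤ ‖x.2‖ ^ 2 +
      (inner ℂ x.1 ((mulL hV hC - (z : ℂ) • ContinuousLinearMap.id ℂ L2Line) x.1)).re :=
    fun x _ => (hlow x.1).trans (le_add_of_nonneg_left (sq_nonneg _))
  obtain ⟨R, hR⟩ := exists_isFormResolvent _ isClosed_sobolevLine _ hc hco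
  exact ⟨hlow, R, hR, hR.isResolventAt hc hco (mem_graph_lineLaplacian_add hV hC)⟩

end QuantumStrip

namespace QuantumStrip

open Filter Topology Metric

/-! ### Mollification of Lipschitz functions -/

theorem integrable_bump_smul (φ : ContDiffBump (0 : ℝ × ℝ)) {X : Type*} [NormedAddCommGroup X]
    [NormedSpace ℝ X] {g : ℝ × ℝ → X} (hg : AEStronglyMeasurable g volume) {M : ℝ}
    (hM : ∀ p, ‖g p‖ ≤ M) : Integrable fun p => φ.normed volume p • g p := by
  refine (φ.integrable_normed (μ := volume)).smul_bdd M hg (Eventually.of_forall hM)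

/-- The derivative may be put on the Lipschitz factor: `y ↦ φ(t) u(y - t)` is Lipschitz with
constant `φ(t) C`, which is integrable in `t`, so one differentiates under the integral. -/
theorem hasFDerivAt_mollify {u : ℝ × ℝ → ℂ} {C : NNReal} (hu : LipschitzWith C u)
    {M : ℝ} (hM : ∀ p, ‖u p‖ ≤ M) (φ : ContDiffBump (0 : ℝ × ℝ)) (x : ℝ × ℝ) :
    HasFDerivAt (convolution (φ.normed volume) u (ContinuousLinearMap.lsmul ℝ ℝ) volume)
      (convolution (φ.normed volume) (fderiv ℝ u) (ContinuousLinearMap.lsmul ℝ ℝ) volume x) x := by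
  have hmeas : Measurable (fderiv ℝ u) := measurable_fderiv ℝ u
  have hsub : ∀ y : ℝ × ℝ, Measurable fun t : ℝ × ℝ => y - t := fun y => by fun_prop
  have key := hasFDerivAt_integral_of_dominated_loc_of_lip (μ := (volume : Measure (ℝ × ℝ)))
    (F := fun y t => φ.normed volume t • u (y - t))
    (F' := fun t => φ.normed volume t • fderiv ℝ u (x - t)) (x₀ := x)
    (bound := fun t => φ.normed volume t * C) (s := Set.univ) Filter.univ_mem
    (Eventually.of_forall fun y => (φ.continuous_normed.smul
      (hu.continuous.comp (continuous_const.sub continuous_id))).aestronglyMeasurable)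
    (integrable_bump_smul φ
      (hu.continuous.comp (continuous_const.sub continuous_id)).aestronglyMeasurable
      fun p => hM _)
    (φ.continuous_normed.aestronglyMeasurable.smul
      (hmeas.comp (hsub x)).aestronglyMeasurable)
    (Eventually.of_forall fun t => by
      refine LipschitzWith.lipschitzOnWith (LipschitzWith.of_dist_le_mul fun y y' => ?_)
      rw [dist_eq_norm, ← smul_sub, norm_smul, Real.norm_eq_abs,
        abs_of_nonneg (φ.nonneg_normed t)]
      have h1 := hu.dist_le_mul (y - t) (y' - t)
      rw [dist_sub_right, dist_eq_norm] at h1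
      have h2 : ((Real.nnabs (φ.normed volume t * C) : NNReal) : ℝ) =
          φ.normed volume t * C := by
        rw [Real.coe_nnabs]
        exact abs_of_nonneg (mul_nonneg (φ.nonneg_normed t) C.2)
      rw [h2, mul_assoc]
      exact mul_le_mul_of_nonneg_left h1 (φ.nonneg_normed t))
    ((φ.integrable_normed (μ := volume)).mul_const _)
    (by
      -- Rademacher's theorem for `u`, carried over by the measure preserving map `t ↦ x - t`.
      have hd := (Measure.measurePreserving_sub_left (volume : Measure (ℝ × ℝ)) x).quasiMeasurePreserving.ae
        hu.ae_differentiableAt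
      filter_upwards [hd] with t ht
      have h1 := ht.hasFDerivAt.comp x ((hasFDerivAt_id x).sub_const t)
      exact h1.const_smul (φ.normed volume t))
  exact key.2

/-- Collects everything dominated convergence will need: a common compact set, a common bound for
functions and gradients, and pointwise limits. Convergence of the gradients is Lebesgue
differentiation applied to the bounded function `fderiv ℝ u`. -/
theorem exists_mollification {u : ℝ × ℝ → ℂ} {C : NNReal} (hu : LipschitzWith C u)
    (hs : HasCompactSupport u) {X : Set (ℝ × ℝ)} (hX : IsOpen X) (hsub : tsupport u ⊆ X) :
    ∃ v : ℕ → ℝ × ℝ → ℂ, (∀ m, IsTest X (v m)) ∧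
      (∃ K, IsCompact K ∧ ∀ m, ∀ p ∉ K, v m p = 0 ∧ fderiv ℝ (v m) p = 0) ∧
      (∃ L, ∀ m p, ‖v m p‖ ≤ L ∧ ‖fderiv ℝ (v m) p‖ ≤ L) ∧
      (∀ p, Tendsto (fun m => v m p) atTop (𝓝 (u p))) ∧
      ∀ᵐ p, Tendsto (fun m => fderiv ℝ (v m) p) atTop (𝓝 (fderiv ℝ u p)) := by
  obtain ⟨M, hM⟩ := hu.continuous.bounded_above_of_compact_support hs
  obtain ⟨δ, hδ, hδX⟩ := hs.isCompact.exists_cthickening_subset_open hX hsub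
  -- Outer radii at most `δ` keep the supports inside a compact thickening contained in `X`; the
  -- fixed ratio 2 of the radii is what the almost everywhere convergence theorem for convolutions
  -- asks for.
  let φ : ℕ → ContDiffBump (0 : ℝ × ℝ) := fun m =>
    { rIn := δ / (m + 1) / 2
      rOut := δ / (m + 1)
      rIn_pos := by positivity
      rIn_lt_rOut := half_lt_self (by positivity) }
  have hφ : ∀ m, (φ m).rOut ≤ δ := fun m => by
    change δ / (m + 1) ≤ δ
    exact div_le_self hδ.le (by linarith [(Nat.cast_nonneg m : (0 : ℝ) ≤ m)])
  have hφ0 : Tendsto (fun m => (φ m).rOut) atTop (𝓝 0) :=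
    tendsto_const_nhds.div_atTop (tendsto_natCast_atTop_atTop.atTop_add tendsto_const_nhds)
  let v : ℕ → ℝ × ℝ → ℂ := fun m =>
    convolution ((φ m).normed volume) u (ContinuousLinearMap.lsmul ℝ ℝ) volume
  have hclose : ∀ m p, dist (v m p) (u p) ≤ C * (φ m).rOut := by
    intro m p
    refine (φ m).dist_normed_convolution_le hu.continuous.aestronglyMeasurable fun q hq => ?_
    refine (hu.dist_le_mul q p).trans ?_
    gcongr
    exact (mem_ball.1 hq).le
  have hsupp : ∀ m, tsupport (v m) ⊆ cthickening δ (tsupport u) := by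
    intro m
    refine closure_minimal ?_ isClosed_cthickening
    intro p hp
    have h1 := support_convolution_subset (ContinuousLinearMap.lsmul ℝ ℝ) hp
    obtain ⟨x, hx, y, hy, rfl⟩ := h1
    rw [ContDiffBump.support_normed_eq] at hx
    refine mem_cthickening_of_dist_le _ y _ _ (subset_tsupport _ hy) ?_
    rw [mem_ball_zero_iff] at hx
    simpa [dist_eq_norm] using hx.le.trans (hφ m)
  have hK : IsCompact (cthickening δ (tsupport u)) := hs.isCompact.cthickening
  have hsmooth : ∀ m, ContDiff ℝ ∞ (v m) := fun m =>
    (φ m).hasCompactSupport_normed.contDiff_convolution_left _ (φ m).contDiff_normed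
      hu.continuous.locallyIntegrable
  have hfd : ∀ m p, fderiv ℝ (v m) p = convolution ((φ m).normed volume) (fderiv ℝ u)
      (ContinuousLinearMap.lsmul ℝ ℝ) volume p := fun m p =>
    (hasFDerivAt_mollify hu hM (φ m) p).fderiv
  have hfu : ∀ p, ‖fderiv ℝ u p‖ ≤ C := fun p => norm_fderiv_le_of_lipschitz ℝ hu
  refine ⟨v, fun m => ⟨hsmooth m, hK.of_isClosed_subset (isClosed_tsupport _) (hsupp m),
    (hsupp m).trans hδX⟩, ⟨_, hK, fun m p hp => ?_⟩, ⟨max (M + C * δ) C, fun m p => ⟨?_, ?_⟩⟩,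
    fun p => ?_, ?_⟩
  · have h1 : p ∉ tsupport (v m) := fun h => hp (hsupp m h)
    exact ⟨image_eq_zero_of_notMem_tsupport h1, fderiv_of_notMem_tsupport ℝ h1⟩
  · refine le_trans ?_ (le_max_left _ _)
    have h1 := hclose m p
    rw [dist_eq_norm] at h1
    have h2 : (C : ℝ) * (φ m).rOut ≤ C * δ := by gcongr; exact hφ m
    calc ‖v m p‖ = ‖u p + (v m p - u p)‖ := by rw [add_sub_cancel]
      _ ≤ _ := (norm_add_le _ _).trans (add_le_add (hM p) (h1.trans h2))
  · refine le_trans ?_ (le_max_right _ _)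
    rw [hfd, convolution]
    refine (norm_integral_le_of_norm_le
      ((φ m).integrable_normed (μ := volume) |>.mul_const (C : ℝ))
      (Eventually.of_forall fun t => ?_)).trans_eq ?_
    · rw [ContinuousLinearMap.lsmul_apply, norm_smul, Real.norm_eq_abs,
        abs_of_nonneg ((φ m).nonneg_normed t)]
      exact mul_le_mul_of_nonneg_left (hfu _) ((φ m).nonneg_normed t)
    · rw [integral_mul_const, (φ m).integral_normed, one_mul]
  · rw [tendsto_iff_dist_tendsto_zero]
    refine squeeze_zero (fun _ => dist_nonneg) (fun m => hclose m p) ?_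
    simpa using hφ0.const_mul (C : ℝ)
  · have hloc : LocallyIntegrable (fderiv ℝ u) volume := by
      refine (locallyIntegrable_const (C : ℝ)).mono
        (measurable_fderiv ℝ u).aestronglyMeasurable (Eventually.of_forall fun p => ?_)
      simpa using hfu p
    have h1 := ContDiffBump.ae_convolution_tendsto_right_of_locallyIntegrable (K := 2) hφ0
      (Eventually.of_forall fun m => by
        change δ / (m + 1) ≤ 2 * (δ / (m + 1) / 2)
        linarith) hloc
    filter_upwards [h1] with p hp
    simpa only [hfd] using hp

/-! ### Vanishing integrals of derivatives -/

/-- Integration by parts against the constant 1. Only the derivative along `v` is required, which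
suits transverse identities whose coefficients need not be differentiable in `s`. -/
theorem integral_lineDeriv_eq_zero {Φ Φ' : ℝ × ℝ → ℂ} {v : ℝ × ℝ} (h0 : Integrable Φ)
    (h1 : Integrable Φ') (h : ∀ p, HasLineDerivAt ℝ Φ (Φ' p) p v) : ∫ p, Φ' p = 0 := by
  have := integral_bilinear_hasLineDerivAt_right_eq_neg_left_of_integrable
    (μ := (volume : Measure (ℝ × ℝ))) (f := fun _ => (1 : ℂ)) (f' := fun _ => 0) (g := Φ)
    (g' := Φ') (v := v) (B := ContinuousLinearMap.mul ℝ ℂ) (by simp) (by simpa using h1)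
    (by simpa using h0) (fun x _ => by
      have := hasDerivAt_const (0 : ℝ) (1 : ℂ)
      exact this) (fun x _ => h x)
  simpa using this

/-- The case of smooth functions survives the limit of mollifications; the Lipschitz version is
needed in the longitudinal direction, where `κ` and `σ` are merely Lipschitz. -/
theorem integral_fderiv_eq_zero {Φ : ℝ × ℝ → ℂ} {C : NNReal} (hΦ : LipschitzWith C Φ)
    (hs : HasCompactSupport Φ) (w : ℝ × ℝ) : ∫ p, fderiv ℝ Φ p w = 0 := by
  obtain ⟨v, hv, ⟨K, hK, hvK⟩, ⟨L, hL⟩, -, hlim⟩ :=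
    exists_mollification hΦ hs isOpen_univ (Set.subset_univ _)
  have h0 : ∀ m, ∫ p, fderiv ℝ (v m) p w = 0 := fun m => by
    have hd : Continuous fun p => fderiv ℝ (v m) p w :=
      ((hv m).1.continuous_fderiv (by simp)).clm_apply continuous_const
    refine integral_lineDeriv_eq_zero (v := w)
      ((hv m).1.continuous.integrable_of_hasCompactSupport (hv m).2.1)
      (hd.integrable_of_hasCompactSupport ((hv m).2.1.fderiv_apply ℝ w)) fun p => ?_
    exact ((hv m).1.differentiable (by simp) p).hasFDerivAt.hasLineDerivAt w
  have hb : Integrable (K.indicator fun _ => L * ‖w‖) (volume : Measure (ℝ × ℝ)) :=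
    (integrable_indicator_iff hK.measurableSet).2
      (integrableOn_const hK.measure_lt_top.ne)
  have := tendsto_integral_of_dominated_convergence (μ := (volume : Measure (ℝ × ℝ)))
    (F := fun m p => fderiv ℝ (v m) p w) (f := fun p => fderiv ℝ Φ p w)
    (K.indicator fun _ => L * ‖w‖)
    (fun m => (((hv m).1.continuous_fderiv (by simp)).clm_apply
      continuous_const).aestronglyMeasurable) hb
    (fun m => Eventually.of_forall fun p => by
      by_cases hp : p ∈ K
      · rw [Set.indicator_of_mem hp]
        exact (ContinuousLinearMap.le_opNorm _ _).trans
          (mul_le_mul_of_nonneg_right (hL m p).2 (norm_nonneg _))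
      · rw [Set.indicator_of_notMem hp, (hvK m p hp).2]
        simp)
    (by
      filter_upwards [hlim] with p hp
      exact ((ContinuousLinearMap.apply ℝ ℂ w).continuous.tendsto _).comp hp)
  simp only [h0] at this
  exact tendsto_nhds_unique this tendsto_const_nhds

/-! ### Closure of the space of test functions -/

theorem memLp_of_le_indicator {α : Type*} [MeasurableSpace α] {μ : Measure α} {K : Set α}
    (hK : MeasurableSet K) (hμ : μ K ≠ ⊤) {g : α → ℂ} {L : ℝ} (hg : AEStronglyMeasurable g μ)
    (hb : ∀ᵐ p ∂μ, ‖g p‖ ≤ K.indicator (fun _ => L) p) : MemLp g 2 μ :=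
  (memLp_indicator_const 2 hK L (Or.inr hμ)).mono hg (by
    filter_upwards [hb] with p hp
    exact hp.trans (le_abs_self _))

/-- Dominated convergence in `L²`: the squared differences are dominated by the square of `2L` on
the common set `K` of finite measure. -/
theorem exists_tendsto_toLp {α : Type*} [MeasurableSpace α] {μ : Measure α} {K : Set α}
    (hK : MeasurableSet K) (hμ : μ K ≠ ⊤) {x : ℕ → Lp ℂ 2 μ} {g : ℕ → α → ℂ} {g' : α → ℂ} {L : ℝ}
    (hx : ∀ m, ∀ᵐ p ∂μ, x m p = g m p)
    (hb : ∀ m, ∀ᵐ p ∂μ, ‖g m p‖ ≤ K.indicator (fun _ => L) p)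
    (hlim : ∀ᵐ p ∂μ, Tendsto (fun m => g m p) atTop (𝓝 (g' p))) :
    ∃ y : Lp ℂ 2 μ, (∀ᵐ p ∂μ, y p = g' p) ∧ Tendsto x atTop (𝓝 y) := by
  have hmeas : AEStronglyMeasurable g' μ :=
    aestronglyMeasurable_of_tendsto_ae atTop
      (fun m => (Lp.aestronglyMeasurable (x m)).congr (hx m)) hlim
  have hb' : ∀ᵐ p ∂μ, ‖g' p‖ ≤ K.indicator (fun _ => L) p := by
    filter_upwards [ae_all_iff.2 hb, hlim] with p h1 h2
    exact le_of_tendsto h2.norm (Eventually.of_forall h1)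
  have hind : MemLp (K.indicator fun _ => L) 2 μ := memLp_indicator_const 2 hK L (Or.inr hμ)
  have hg' : MemLp g' 2 μ := memLp_of_le_indicator hK hμ hmeas hb'
  refine ⟨hg'.toLp, hg'.coeFn_toLp, ?_⟩
  rw [tendsto_iff_norm_sub_tendsto_zero]
  have hsq : Tendsto (fun m => ‖x m - hg'.toLp‖ ^ 2) atTop (𝓝 0) := by
    simp only [norm_sq_eq_integral]
    rw [← integral_zero α ℝ (μ := μ)]
    refine tendsto_integral_of_dominated_convergence
      (fun p => (2 * K.indicator (fun _ => L) p) ^ 2) (fun m => ?_) ?_ (fun m => ?_) ?_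
    · exact ((Lp.aestronglyMeasurable _).norm.pow 2)
    · exact (hind.const_mul 2).integrable_sq
    · filter_upwards [hx m, hb m, hb', hg'.coeFn_toLp, Lp.coeFn_sub (x m) hg'.toLp]
        with p h1 h2 h3 h4 h5
      rw [h5, Pi.sub_apply, h1, h4, Real.norm_eq_abs, abs_of_nonneg (sq_nonneg _)]
      gcongr
      exact (norm_sub_le _ _).trans (by linarith)
    · filter_upwards [hlim, hg'.coeFn_toLp, ae_all_iff.2 hx,
        ae_all_iff.2 fun m => Lp.coeFn_sub (x m) hg'.toLp] with p h1 h2 h3 h4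
      have h5 : ∀ m, (x m - hg'.toLp : Lp ℂ 2 μ) p = g m p - g' p := fun m => by
        rw [h4, Pi.sub_apply, h3, h2]
      simp only [h5]
      have h6 := ((h1.sub_const (g' p)).norm).pow 2
      simpa using h6
  have := (Real.continuous_sqrt.tendsto _).comp hsq
  simpa [Function.comp_def, Real.sqrt_sq (norm_nonneg _)] using this

/-- `u` belongs to the form domain, with its almost everywhere derivatives as gradient. -/
def HasGradient (f : ℝ × ℝ → ℝ) (a : ℝ) (u : ℝ × ℝ → ℂ) : Prop :=
  ∃ x ∈ (testGradient f a).topologicalClosure,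
    (∀ᵐ p ∂(weighted f a), x.1 p = u p) ∧
    (∀ᵐ p ∂(weighted f a), x.2.fst p = ((f p)⁻¹ : ℝ) * fderiv ℝ u p (1, 0)) ∧
    (∀ᵐ p ∂(weighted f a), x.2.snd p = fderiv ℝ u p (0, 1))

theorem isOpen_strip (a : ℝ) : IsOpen (Ω₀ a) := isOpen_univ.prod isOpen_Ioo

theorem ae_weighted_of_ae {f : ℝ × ℝ → ℝ} {a : ℝ} {Q : ℝ × ℝ → Prop}
    (h : ∀ᵐ p, p ∈ Ω₀ a → Q p) : ∀ᵐ p ∂(weighted f a), Q p :=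
  (withDensity_absolutelyContinuous _ _).ae_le
    ((ae_restrict_iff' (isOpen_strip a).measurableSet).2 h)

theorem weighted_lt_top {f : ℝ × ℝ → ℝ} {a b : ℝ} (hb : ∀ p ∈ Ω₀ a, f p ≤ b) {K : Set (ℝ × ℝ)}
    (hK : IsCompact K) : weighted f a K ≠ ⊤ := by
  rw [weighted, withDensity_apply _ hK.measurableSet]
  have hΩ := (isOpen_strip a).measurableSet
  refine ne_top_of_le_ne_top (b := ∫⁻ _ in K, ENNReal.ofReal b ∂(volume.restrict (Ω₀ a))) ?_ ?_
  · rw [setLIntegral_const]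
    refine ENNReal.mul_ne_top ENNReal.ofReal_ne_top (ne_top_of_le_ne_top
      (hK.measure_lt_top (μ := (volume : Measure (ℝ × ℝ)))).ne ?_)
    exact Measure.restrict_apply_le _ _
  · refine lintegral_mono_ae ?_
    refine ae_restrict_of_ae ((ae_restrict_iff' hΩ).2 (Eventually.of_forall fun p hp => ?_))
    exact ENNReal.ofReal_le_ofReal (hb p hp)

/-- `HasGradient` is stable under bounded almost everywhere convergence with compact support. -/
theorem HasGradient.of_tendsto {f : ℝ × ℝ → ℝ} {a b c : ℝ} (hc : 0 < c)
    (hf : ∀ p ∈ Ω₀ a, c ≤ f p ∧ f p ≤ b) {v : ℕ → ℝ × ℝ → ℂ} {u : ℝ × ℝ → ℂ}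
    (hv : ∀ m, HasGradient f a (v m)) {K : Set (ℝ × ℝ)} (hK : IsCompact K)
    (hvK : ∀ m, ∀ p ∈ Ω₀ a, p ∉ K → v m p = 0 ∧ fderiv ℝ (v m) p = 0) {L : ℝ}
    (hL : ∀ m, ∀ p ∈ Ω₀ a, ‖v m p‖ ≤ L ∧ ‖fderiv ℝ (v m) p‖ ≤ L)
    (h0 : ∀ᵐ p, p ∈ Ω₀ a → Tendsto (fun m => v m p) atTop (𝓝 (u p)))
    (h1 : ∀ᵐ p, p ∈ Ω₀ a → Tendsto (fun m => fderiv ℝ (v m) p) atTop (𝓝 (fderiv ℝ u p))) :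
    HasGradient f a u := by
  choose x hx hx0 hx1 hx2 using hv
  have hμ := weighted_lt_top (f := f) (fun p hp => (hf p hp).2) hK
  have hΩ : ∀ Q : ℝ × ℝ → Prop, (∀ p ∈ Ω₀ a, Q p) → ∀ᵐ p ∂(weighted f a), Q p := fun Q hQ =>
    ae_weighted_of_ae (Eventually.of_forall hQ)
  have hn10 : ‖((1, 0) : ℝ × ℝ)‖ = 1 := by simp [Prod.norm_def]
  have hn01 : ‖((0, 1) : ℝ × ℝ)‖ = 1 := by simp [Prod.norm_def]
  have hder : ∀ w : ℝ × ℝ, ‖w‖ = 1 → ∀ m, ∀ p ∈ Ω₀ a, ‖fderiv ℝ (v m) p w‖ ≤ L :=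
    fun w hw m p hp => by
      simpa [hw] using (ContinuousLinearMap.le_of_opNorm_le _ (hL m p hp).2 w)
  obtain ⟨y0, hy0, hty0⟩ := exists_tendsto_toLp hK.measurableSet hμ hx0 (L := L)
    (fun m => hΩ _ fun p hp => by
      by_cases hpK : p ∈ K
      · rw [Set.indicator_of_mem hpK]
        exact (hL m p hp).1
      · rw [Set.indicator_of_notMem hpK, (hvK m p hp hpK).1, norm_zero])
    (ae_weighted_of_ae h0)
  obtain ⟨y1, hy1, hty1⟩ := exists_tendsto_toLp hK.measurableSet hμ hx1 (L := c⁻¹ * L)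
    (g' := fun p => ((f p)⁻¹ : ℝ) * fderiv ℝ u p (1, 0))
    (fun m => hΩ _ fun p hp => by
      by_cases hpK : p ∈ K
      · rw [Set.indicator_of_mem hpK, norm_mul, Complex.norm_real, Real.norm_eq_abs,
          abs_of_pos (inv_pos.2 (hc.trans_le (hf p hp).1))]
        gcongr
        · exact (hf p hp).1
        · exact hder _ hn10 m p hp
      · rw [Set.indicator_of_notMem hpK, (hvK m p hp hpK).2]
        simp)
    (ae_weighted_of_ae (by
      filter_upwards [h1] with p hp hpΩ
      exact (((ContinuousLinearMap.apply ℝ ℂ ((1, 0) : ℝ × ℝ)).continuous.tendsto _).comp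
        (hp hpΩ)).const_mul _))
  obtain ⟨y2, hy2, hty2⟩ := exists_tendsto_toLp hK.measurableSet hμ hx2 (L := L)
    (g' := fun p => fderiv ℝ u p (0, 1))
    (fun m => hΩ _ fun p hp => by
      by_cases hpK : p ∈ K
      · rw [Set.indicator_of_mem hpK]
        exact hder _ hn01 m p hp
      · rw [Set.indicator_of_notMem hpK, (hvK m p hp hpK).2]
        simp)
    (ae_weighted_of_ae (by
      filter_upwards [h1] with p hp hpΩ
      exact ((ContinuousLinearMap.apply ℝ ℂ ((0, 1) : ℝ × ℝ)).continuous.tendsto _).comp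
        (hp hpΩ)))
  refine ⟨(y0, WithLp.toLp 2 (y1, y2)), ?_, hy0, hy1, hy2⟩
  refine (testGradient f a).isClosed_topologicalClosure.mem_of_tendsto (b := atTop) (f := x) ?_
    (Eventually.of_forall hx)
  have hc2 := WithLp.prod_continuous_toLp 2 (Lp ℂ 2 (weighted f a)) (Lp ℂ 2 (weighted f a))
  have := hty0.prodMk_nhds ((hc2.tendsto (y1, y2)).comp (hty1.prodMk_nhds hty2))
  exact this

theorem IsTest.hasGradient {f : ℝ × ℝ → ℝ} (hfm : Measurable f) {a b c : ℝ} (hc : 0 < c)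
    (hf : ∀ p ∈ Ω₀ a, c ≤ f p ∧ f p ≤ b) {u : ℝ × ℝ → ℂ} (hu : IsTest (Ω₀ a) u) :
    HasGradient f a u := by
  have hK : IsCompact (tsupport u) := hu.2.1
  have hμ := weighted_lt_top (f := f) (fun p hp => (hf p hp).2) hK
  obtain ⟨M, hM⟩ := hu.1.continuous.bounded_above_of_compact_support hu.2.1
  have hd := hu.1.continuous_fderiv (by simp)
  obtain ⟨L, hL⟩ := hd.bounded_above_of_compact_support (hu.2.1.fderiv ℝ)
  have hdw : ∀ w : ℝ × ℝ, Continuous fun p => fderiv ℝ u p w := fun w =>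
    hd.clm_apply continuous_const
  have hΩ : ∀ Q : ℝ × ℝ → Prop, (∀ p ∈ Ω₀ a, Q p) → ∀ᵐ p ∂(weighted f a), Q p := fun Q hQ =>
    ae_weighted_of_ae (Eventually.of_forall hQ)
  have hw : ∀ (w p : ℝ × ℝ), ‖fderiv ℝ u p w‖ ≤ L * ‖w‖ := fun w p =>
    ContinuousLinearMap.le_of_opNorm_le _ (hL p) w
  have h0 : MemLp u 2 (weighted f a) := memLp_of_le_indicator hK.measurableSet hμ
    hu.1.continuous.aestronglyMeasurable (L := M) (Eventually.of_forall fun p => by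
      by_cases hp : p ∈ tsupport u
      · rw [Set.indicator_of_mem hp]
        exact hM p
      · rw [Set.indicator_of_notMem hp, image_eq_zero_of_notMem_tsupport hp, norm_zero])
  have h2 : ∀ w, MemLp (fun p => fderiv ℝ u p w) 2 (weighted f a) := fun w =>
    memLp_of_le_indicator hK.measurableSet hμ (hdw w).aestronglyMeasurable (L := L * ‖w‖)
      (Eventually.of_forall fun p => by
        by_cases hp : p ∈ tsupport u
        · rw [Set.indicator_of_mem hp]
          exact hw w p
        · rw [Set.indicator_of_notMem hp, fderiv_of_notMem_tsupport ℝ hp]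
          simp)
  have h1 : MemLp (fun p => ((f p)⁻¹ : ℝ) * fderiv ℝ u p (1, 0)) 2 (weighted f a) :=
    memLp_bounded_mul hfm.inv (C := c⁻¹) (hΩ _ fun p hp => by
      rw [Pi.inv_apply, abs_of_pos (inv_pos.2 (hc.trans_le (hf p hp).1))]
      exact inv_anti₀ hc (hf p hp).1) (h2 _)
  exact ⟨(h0.toLp, WithLp.toLp 2 (h1.toLp, (h2 (0, 1)).toLp)),
    (testGradient f a).le_topologicalClosure
      ⟨u, hu, h0.coeFn_toLp, h1.coeFn_toLp, (h2 (0, 1)).coeFn_toLp⟩,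
    h0.coeFn_toLp, h1.coeFn_toLp, (h2 (0, 1)).coeFn_toLp⟩

/-- The mollifications are test functions in the strip and converge, with their gradients, boundedly
and almost everywhere. -/
theorem LipschitzWith.hasGradient {f : ℝ × ℝ → ℝ} (hfm : Measurable f) {a b c : ℝ} (hc : 0 < c)
    (hf : ∀ p ∈ Ω₀ a, c ≤ f p ∧ f p ≤ b) {u : ℝ × ℝ → ℂ} {C : NNReal} (hu : LipschitzWith C u)
    (hs : HasCompactSupport u) (hsub : tsupport u ⊆ Ω₀ a) : HasGradient f a u := by
  obtain ⟨v, hv, ⟨K, hK, hvK⟩, ⟨L, hL⟩, h0, h1⟩ :=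
    exists_mollification hu hs (isOpen_strip a) hsub
  refine HasGradient.of_tendsto hc hf (fun m => (hv m).hasGradient hfm hc hf) hK
    (fun m p _ => hvK m p) (fun m p _ => hL m p) (Eventually.of_forall fun p _ => h0 p) ?_
  filter_upwards [h1] with p hp _
  exact hp

end QuantumStrip

namespace QuantumStrip

/-! ### The metric of a thin strip -/

/-- The bounded Lipschitz functions `κ = k · Θ` and `σ = |Θ'|²` determining the metric. -/
structure Profile where
  /-- the curvature `k · Θ` -/
  κ : ℝ → ℝ
  /-- the squared twist `|Θ'|²` -/
  σ : ℝ → ℝ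
  /-- a common bound -/
  B : NNReal
  one_le : 1 ≤ B
  lipschitz_κ : LipschitzWith B κ
  lipschitz_σ : LipschitzWith B σ
  abs_κ_le : ∀ s, |κ s| ≤ B
  σ_nonneg : ∀ s, 0 ≤ σ s
  σ_le : ∀ s, σ s ≤ B

namespace Profile

variable (P : Profile)

/-- The square of the Jacobian. -/
def F (p : ℝ × ℝ) : ℝ := (1 - p.2 * P.κ p.1) ^ 2 + p.2 ^ 2 * P.σ p.1

/-- The Jacobian. -/
def f (p : ℝ × ℝ) : ℝ := √(P.F p)

/-- The derivative `∂₂F`. -/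
def Ft (p : ℝ × ℝ) : ℝ := -2 * P.κ p.1 * (1 - p.2 * P.κ p.1) + 2 * p.2 * P.σ p.1

/-- The logarithmic derivative `∂₁f / (2f)`. -/
def m (p : ℝ × ℝ) : ℝ :=
  (-2 * p.2 * deriv P.κ p.1 * (1 - p.2 * P.κ p.1) + p.2 ^ 2 * deriv P.σ p.1) / (4 * P.F p)

/-- The potential arising from the transverse derivative. -/
def V (p : ℝ × ℝ) : ℝ :=
  (P.κ p.1 ^ 2 + P.σ p.1) / (2 * P.F p) - 3 / 16 * (P.Ft p / P.F p) ^ 2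

/-- The effective potential. -/
def Veff (s : ℝ) : ℝ := -(1 / 4) * P.κ s ^ 2 + 1 / 2 * P.σ s

/-- The transverse ground state in `L²(Ω₀, f ds dt)`. -/
def mode (a : ℝ) (p : ℝ × ℝ) : ℝ := χ₁ (p.2 / a) / √(a * P.f p)

/-- The logarithmic derivative `∂₂ mode / mode`. -/
def β (a : ℝ) (p : ℝ × ℝ) : ℝ :=
  -(Real.pi / (2 * a)) * Real.tan (Real.pi / 2 * (p.2 / a)) - P.Ft p / (4 * P.F p)

theorem continuous_κ : Continuous P.κ := P.lipschitz_κ.continuous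
theorem continuous_σ : Continuous P.σ := P.lipschitz_σ.continuous

theorem continuous_F : Continuous P.F := by
  have h1 := P.continuous_κ
  have h2 := P.continuous_σ
  unfold F
  fun_prop

theorem continuous_Ft : Continuous P.Ft := by
  have h1 := P.continuous_κ
  have h2 := P.continuous_σ
  unfold Ft
  fun_prop

theorem continuous_f : Continuous P.f := P.continuous_F.sqrt

theorem measurable_f : Measurable P.f := P.continuous_f.measurable

theorem measurable_m : Measurable P.m := by
  have h1 := P.continuous_κ.measurable
  have h2 := P.continuous_F.measurable
  have h3 : Measurable (deriv P.κ) := measurable_deriv _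
  have h4 : Measurable (deriv P.σ) := measurable_deriv _
  unfold m
  fun_prop

theorem measurable_V : Measurable P.V := by
  have h1 := P.continuous_κ.measurable
  have h2 := P.continuous_F.measurable
  have h3 := P.continuous_Ft.measurable
  have h4 := P.continuous_σ.measurable
  unfold V
  fun_prop

theorem continuous_Veff : Continuous P.Veff := by
  have h1 := P.continuous_κ
  have h2 := P.continuous_σ
  unfold Veff
  fun_prop

theorem abs_deriv_κ_le (s : ℝ) : |deriv P.κ s| ≤ P.B := norm_deriv_le_of_lipschitz P.lipschitz_κ

theorem abs_deriv_σ_le (s : ℝ) : |deriv P.σ s| ≤ P.B := norm_deriv_le_of_lipschitz P.lipschitz_σ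

theorem abs_Veff_le (s : ℝ) : |P.Veff s| ≤ P.B ^ 2 := by
  have hκ := P.abs_κ_le s
  have hσ := P.σ_le s
  have hσ0 := P.σ_nonneg s
  have h1 : (1 : ℝ) ≤ P.B := P.one_le
  have hκ2 : P.κ s ^ 2 ≤ P.B ^ 2 := by
    rw [← sq_abs]
    gcongr
  have hk0 := sq_nonneg (P.κ s)
  rw [Veff, abs_le]
  constructor <;> nlinarith

section Thin

variable {P} {a : ℝ} (ha : 0 < a) (hB : a * P.B ≤ 1 / 4)
include ha hB

/-- With `x = tκ`, one has `F - 1 = -2x + x² + t²σ`. As `B ≥ 1`, the hypothesis gives `a ≤ 1/4` as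
well as `aB ≤ 1/4`, so the three terms contribute `2 + 1/4 + 1/4` times `aB`. -/
theorem abs_F_sub_one_le {p : ℝ × ℝ} (ht : |p.2| ≤ a) : |P.F p - 1| ≤ 5 / 2 * (a * P.B) := by
  have hκ := P.abs_κ_le p.1
  have hσ := P.σ_le p.1
  have hσ0 := P.σ_nonneg p.1
  have h1 : (1 : ℝ) ≤ P.B := P.one_le
  have ha4 : a ≤ 1 / 4 := by nlinarith
  have hx : |p.2 * P.κ p.1| ≤ a * P.B := by
    rw [abs_mul]
    gcongr
  have hy : p.2 ^ 2 * P.σ p.1 ≤ 1 / 4 * (a * P.B) := by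
    calc p.2 ^ 2 * P.σ p.1 = |p.2| ^ 2 * P.σ p.1 := by rw [sq_abs]
      _ ≤ a ^ 2 * P.B := by gcongr
      _ = a * (a * P.B) := by ring
      _ ≤ _ := by gcongr
  have hy0 : 0 ≤ p.2 ^ 2 * P.σ p.1 := by positivity
  have hz : (p.2 * P.κ p.1) ^ 2 ≤ 1 / 4 * (a * P.B) := by
    rw [← sq_abs]
    nlinarith [abs_nonneg (p.2 * P.κ p.1)]
  have e : P.F p - 1 = -2 * (p.2 * P.κ p.1) + (p.2 * P.κ p.1) ^ 2 + p.2 ^ 2 * P.σ p.1 := by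
    unfold F
    ring
  rw [e]
  rw [abs_le] at hx ⊢
  constructor <;> nlinarith [sq_nonneg (p.2 * P.κ p.1)]

theorem F_bounds {p : ℝ × ℝ} (ht : |p.2| ≤ a) : 3 / 8 ≤ P.F p ∧ P.F p ≤ 13 / 8 := by
  have h := abs_le.1 (abs_F_sub_one_le ha hB ht)
  constructor <;> linarith [h.1, h.2]

theorem f_bounds {p : ℝ × ℝ} (ht : |p.2| ≤ a) : 1 / 2 ≤ P.f p ∧ P.f p ≤ 3 / 2 := by
  have h := F_bounds ha hB ht
  constructor
  · exact Real.le_sqrt_of_sq_le (by norm_num; linarith [h.1])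
  · exact Real.sqrt_le_iff.2 ⟨by norm_num, by norm_num; linarith [h.2]⟩

theorem sq_f {p : ℝ × ℝ} (ht : |p.2| ≤ a) : P.f p ^ 2 = P.F p :=
  Real.sq_sqrt (by linarith [(F_bounds ha hB ht).1])

theorem abs_inv_f_sub_f_le {p : ℝ × ℝ} (ht : |p.2| ≤ a) : |(P.f p)⁻¹ - P.f p| ≤ 5 * (a * P.B) := by
  have h := (f_bounds ha hB ht).1
  have h0 : 0 < P.f p := by linarith
  have e : (P.f p)⁻¹ - P.f p = (1 - P.F p) / P.f p := by
    rw [← sq_f ha hB ht]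
    field_simp
  rw [e, abs_div, abs_of_pos h0, div_le_iff₀ h0, abs_sub_comm]
  have := abs_F_sub_one_le ha hB ht
  have h2 : 0 ≤ a * P.B := by positivity
  nlinarith

theorem abs_m_le {p : ℝ × ℝ} (ht : |p.2| ≤ a) : |P.m p| ≤ 2 * (a * P.B) := by
  have hF := (F_bounds ha hB ht).1
  have hκ := P.abs_κ_le p.1
  have h1 : (1 : ℝ) ≤ P.B := P.one_le
  have ha4 : a ≤ 1 / 4 := by nlinarith
  have hx : |p.2 * P.κ p.1| ≤ 1 / 4 := by
    rw [abs_mul]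
    exact (mul_le_mul ht hκ (abs_nonneg _) ha.le).trans hB
  have hx1 : |1 - p.2 * P.κ p.1| ≤ 5 / 4 := by
    rw [abs_le] at hx ⊢
    constructor <;> linarith [hx.1, hx.2]
  rw [m, abs_div, abs_of_pos (by linarith : 0 < 4 * P.F p), div_le_iff₀ (by linarith)]
  have h2 : |p.2 * deriv P.κ p.1| ≤ a * P.B := by
    rw [abs_mul]
    have := P.abs_deriv_κ_le p.1
    gcongr
  have h3 : |p.2 ^ 2 * deriv P.σ p.1| ≤ 1 / 4 * (a * P.B) := by
    rw [abs_mul, abs_pow]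
    have := P.abs_deriv_σ_le p.1
    calc |p.2| ^ 2 * |deriv P.σ p.1| ≤ a ^ 2 * P.B := by gcongr
      _ = a * (a * P.B) := by ring
      _ ≤ _ := by gcongr
  have h4 : |p.2 * deriv P.κ p.1 * (1 - p.2 * P.κ p.1)| ≤ a * P.B * (5 / 4) := by
    rw [abs_mul]
    gcongr
  have h5 : 0 ≤ a * P.B := by positivity
  calc _ = |-2 * (p.2 * deriv P.κ p.1 * (1 - p.2 * P.κ p.1)) + p.2 ^ 2 * deriv P.σ p.1| := by
        ring_nf
    _ ≤ 2 * |p.2 * deriv P.κ p.1 * (1 - p.2 * P.κ p.1)| + |p.2 ^ 2 * deriv P.σ p.1| := by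
        refine (abs_add_le _ _).trans ?_
        rw [abs_mul]
        norm_num
    _ ≤ _ := by nlinarith

/-- For fixed `s`, `F` is a quadratic polynomial in `t` with `F = 1` and `∂₂F = -2κ` at `t = 0`, so
`(∂₂F)²` is an affine function of `F`. Thus `V` is rational in `F`, takes the value `Veff` at `F =
1`, and the factor `1 - F` splits off. -/
theorem V_sub_Veff {p : ℝ × ℝ} (ht : |p.2| ≤ a) : P.V p - P.Veff p.1 =
    (1 - P.F p) * ((2 * P.σ p.1 - P.κ p.1 ^ 2) * (1 + P.F p) + (P.κ p.1 ^ 2 + P.σ p.1)) /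
      (4 * P.F p ^ 2) := by
  have hF := (F_bounds ha hB ht).1
  have hF0 : P.F p ≠ 0 := by linarith
  have e : P.Ft p ^ 2 = 4 * ((P.κ p.1 ^ 2 + P.σ p.1) * (P.F p - 1) + P.κ p.1 ^ 2) := by
    unfold Ft F
    ring
  have e2 : P.V p = (8 * (P.κ p.1 ^ 2 + P.σ p.1) * P.F p - 3 * P.Ft p ^ 2) / (16 * P.F p ^ 2) := by
    unfold V
    field_simp
    ring
  rw [e2, e, Veff]
  field_simp
  ring

theorem abs_V_sub_Veff_le {p : ℝ × ℝ} (ht : |p.2| ≤ a) :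
    |P.V p - P.Veff p.1| ≤ 50 * (a * P.B ^ 3) := by
  have hF := F_bounds ha hB ht
  have hκ := P.abs_κ_le p.1
  have hσ := P.σ_le p.1
  have hσ0 := P.σ_nonneg p.1
  have h1 : (1 : ℝ) ≤ P.B := P.one_le
  have hκ2 : P.κ p.1 ^ 2 ≤ P.B ^ 2 := by
    rw [← sq_abs]
    gcongr
  have hBB : (P.B : ℝ) ≤ P.B ^ 2 := by nlinarith
  rw [V_sub_Veff ha hB ht, abs_div, abs_mul, abs_sub_comm,
    abs_of_pos (by nlinarith : 0 < 4 * P.F p ^ 2), div_le_iff₀ (by nlinarith)]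
  have hX : |(2 * P.σ p.1 - P.κ p.1 ^ 2) * (1 + P.F p) + (P.κ p.1 ^ 2 + P.σ p.1)| ≤
      10 * (P.B : ℝ) ^ 2 := by
    have hk0 := sq_nonneg (P.κ p.1)
    rw [abs_le]
    constructor
    · nlinarith
    · nlinarith
  -- From `F ≥ 3/8`. The numerator is at most `25 a B³`, and `50 · 9/16` exceeds 25.
  have hG : 9 / 16 ≤ 4 * P.F p ^ 2 := by nlinarith
  calc |P.F p - 1| * |(2 * P.σ p.1 - P.κ p.1 ^ 2) * (1 + P.F p) + (P.κ p.1 ^ 2 + P.σ p.1)| ≤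
      (5 / 2 * (a * P.B)) * (10 * P.B ^ 2) := by
        gcongr
        exact abs_F_sub_one_le ha hB ht
    _ = 25 * (a * P.B ^ 3) := by ring
    _ ≤ 50 * (a * P.B ^ 3) * (9 / 16) := by
        have : 0 ≤ a * (P.B : ℝ) ^ 3 := by positivity
        linarith
    _ ≤ _ := by gcongr

/-! Derivatives in the transverse direction -/

theorem hasDerivAt_f_snd {s t : ℝ} (ht : |t| ≤ a) :
    HasDerivAt (fun t => P.f (s, t)) (P.f (s, t) * (P.Ft (s, t) / (2 * P.F (s, t)))) t := by
  have hF := (F_bounds (p := (s, t)) ha hB ht).1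
  have hf := (f_bounds (p := (s, t)) ha hB ht).1
  have h1 : HasDerivAt (fun t => P.F (s, t)) (P.Ft (s, t)) t := by
    have h2 := ((((hasDerivAt_id t).mul_const (P.κ s)).const_sub 1).pow 2).add
      (((hasDerivAt_id t).pow 2).mul_const (P.σ s))
    refine h2.congr_deriv ?_
    simp only [Ft, id]
    push_cast
    ring
  refine (h1.sqrt (by linarith)).congr_deriv ?_
  change P.Ft (s, t) / (2 * P.f (s, t)) = _
  rw [← sq_f (p := (s, t)) ha hB ht]
  field_simp

omit hB in
theorem cos_pos {t : ℝ} (ht : |t| < a) : 0 < Real.cos (Real.pi / 2 * (t / a)) := by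
  rw [abs_lt] at ht
  have hpi := Real.pi_pos
  have h1 : t / a < 1 := by rw [div_lt_one ha]; exact ht.2
  have h2 : -1 < t / a := by rw [lt_div_iff₀ ha]; linarith [ht.1]
  refine Real.cos_pos_of_mem_Ioo ⟨?_, ?_⟩ <;> nlinarith

/-- The Riccati equation for the logarithmic derivative of the transverse ground state. -/
theorem hasDerivAt_f_mul_β {s t : ℝ} (ht : |t| < a) :
    HasDerivAt (fun t => P.f (s, t) * P.β a (s, t))
      (-(E₁ a + P.V (s, t)) * P.f (s, t) - P.f (s, t) * P.β a (s, t) ^ 2) t := by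
  have hF := (F_bounds (p := (s, t)) ha hB ht.le).1
  have hF0 : P.F (s, t) ≠ 0 := by linarith
  have hc := cos_pos ha ht
  have h1 : HasDerivAt (fun t => P.F (s, t)) (P.Ft (s, t)) t := by
    have h2 := ((((hasDerivAt_id t).mul_const (P.κ s)).const_sub 1).pow 2).add
      (((hasDerivAt_id t).pow 2).mul_const (P.σ s))
    refine h2.congr_deriv ?_
    simp only [Ft, id]
    push_cast
    ring
  have h2 : HasDerivAt (fun t => P.Ft (s, t)) (2 * (P.κ s ^ 2 + P.σ s)) t := by
    have h3 := ((((hasDerivAt_id t).mul_const (P.κ s)).const_sub 1).const_mul (-2 * P.κ s)).add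
      (((hasDerivAt_id t).const_mul 2).mul_const (P.σ s))
    refine h3.congr_deriv ?_
    ring
  have h3 : HasDerivAt (fun t => Real.tan (Real.pi / 2 * (t / a)))
      (1 / Real.cos (Real.pi / 2 * (t / a)) ^ 2 * (Real.pi / 2 * (1 / a))) t := by
    have hin : HasDerivAt (fun t => Real.pi / 2 * (t / a)) (Real.pi / 2 * (1 / a)) t :=
      ((hasDerivAt_id t).div_const a).const_mul (Real.pi / 2)
    exact HasDerivAt.comp t (Real.hasDerivAt_tan hc.ne') hin
  have h4 : HasDerivAt (fun t => P.β a (s, t)) _ t :=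
    (h3.const_mul (-(Real.pi / (2 * a)))).sub (h2.div (h1.const_mul 4) (by positivity))
  refine ((hasDerivAt_f_snd (s := s) ha hB ht.le).mul h4).congr_deriv ?_
  -- Replacing the squared secant by `1 + tan²` closes the equation: the 1 produces `E₁`, and `tan²`
  -- is absorbed by `β²`. The coefficient of `(∂₂F / F)²` is `1/4 - 1/8 + 1/16 = 3/16`, as in `V`.
  have hsec : 1 / Real.cos (Real.pi / 2 * (t / a)) ^ 2 =
      1 + Real.tan (Real.pi / 2 * (t / a)) ^ 2 := by
    rw [Real.tan_eq_sin_div_cos, div_pow, div_eq_iff (pow_pos hc 2).ne', add_mul, one_mul,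
      div_mul_cancel₀ _ (pow_pos hc 2).ne', add_comm]
    exact (Real.sin_sq_add_cos_sq _).symm
  rw [hsec]
  simp only [β, V, E₁]
  set T := Real.tan (Real.pi / 2 * (t / a))
  set X := P.Ft (s, t)
  set Y := P.F (s, t)
  field_simp
  ring

theorem hasDerivAt_mode_snd {s t : ℝ} (ht : |t| < a) :
    HasDerivAt (fun t => P.mode a (s, t)) (P.β a (s, t) * P.mode a (s, t)) t := by
  have hF := (F_bounds (p := (s, t)) ha hB ht.le).1
  have hf := (f_bounds (p := (s, t)) ha hB ht.le).1
  have hc := cos_pos ha ht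
  have h1 : HasDerivAt (fun t => χ₁ (t / a))
      (-Real.sin (Real.pi / 2 * (t / a)) * (Real.pi / 2 * (1 / a))) t :=
    (Real.hasDerivAt_cos _).comp t (((hasDerivAt_id t).div_const a).const_mul (Real.pi / 2))
  have hpos : 0 < a * P.f (s, t) := mul_pos ha (by linarith)
  have h2 := ((hasDerivAt_f_snd (s := s) ha hB ht.le).const_mul a).sqrt hpos.ne'
  refine (h1.div h2 (Real.sqrt_pos.2 hpos).ne').congr_deriv ?_
  simp only [β, mode, χ₁]
  rw [Real.tan_eq_sin_div_cos]
  have hs := Real.sq_sqrt hpos.le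
  have hs0 := Real.sqrt_pos.2 hpos
  set R := √(a * P.f (s, t))
  have hF0 : P.F (s, t) ≠ 0 := by linarith
  have e : a * (P.f (s, t) * (P.Ft (s, t) / (2 * P.F (s, t)))) =
      R ^ 2 * (P.Ft (s, t) / (2 * P.F (s, t))) := by rw [hs]; ring
  rw [e]
  set C := Real.cos (Real.pi / 2 * (t / a))
  set S := Real.sin (Real.pi / 2 * (t / a))
  field_simp
  ring

end Thin

end Profile

end QuantumStrip

namespace QuantumStrip

open Filter Topology

/-! ### The weighted space and the unitary transform -/

theorem mem_strip {a : ℝ} {p : ℝ × ℝ} : p ∈ Ω₀ a ↔ |p.2| < a := by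
  simp [Ω₀, abs_lt]

theorem integral_weighted {f : ℝ × ℝ → ℝ} (hf : Measurable f) (hf0 : ∀ p, 0 ≤ f p) (a : ℝ)
    {X : Type*} [NormedAddCommGroup X] [NormedSpace ℝ X] (g : ℝ × ℝ → X) :
    ∫ p, g p ∂(weighted f a) = ∫ p in Ω₀ a, f p • g p := by
  rw [weighted, integral_withDensity_eq_integral_toReal_smul hf.ennreal_ofReal
    (Eventually.of_forall fun _ => ENNReal.ofReal_lt_top)]
  simp only [ENNReal.toReal_ofReal (hf0 _)]

theorem setIntegral_strip_eq {a : ℝ} {X : Type*} [NormedAddCommGroup X] [NormedSpace ℝ X]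
    {g : ℝ × ℝ → X} (hg : ∀ p ∉ Ω₀ a, g p = 0) : ∫ p in Ω₀ a, g p = ∫ p, g p :=
  setIntegral_eq_integral_of_forall_compl_eq_zero hg

theorem testGradient_dense {f : ℝ × ℝ → ℝ} (hfm : Measurable f) {a b c : ℝ} (hc : 0 < c)
    (hf : ∀ p ∈ Ω₀ a, c ≤ f p ∧ f p ≤ b) (w : Lp ℂ 2 (weighted f a))
    (h : ∀ y ∈ (testGradient f a).topologicalClosure, inner ℂ y.1 w = 0) : w = 0 := by
  have hfin : IsFiniteMeasureOnCompacts (weighted f a) :=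
    ⟨fun K hK => (weighted_lt_top (fun p hp => (hf p hp).2) hK).lt_top⟩
  have h1 : ∀ᵐ p ∂(weighted f a), p ∈ Ω₀ a → w p = 0 := by
    refine (isOpen_strip a).ae_eq_zero_of_integral_contDiff_smul_eq_zero
      (((Lp.memLp w).locallyIntegrable (by norm_num)).locallyIntegrableOn _)
      fun g hg hg' hsub => ?_
    have ht : IsTest (Ω₀ a) fun p => (g p : ℂ) :=
      ⟨Complex.ofRealCLM.contDiff.comp hg, hg'.comp_left Complex.ofReal_zero,
        (tsupport_comp_subset Complex.ofReal_zero g).trans hsub⟩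
    obtain ⟨x, hx, hx0, -, -⟩ := ht.hasGradient hfm hc hf
    have := h x hx
    rw [inner_eq_integral] at this
    rw [← this]
    refine integral_congr_ae ?_
    filter_upwards [hx0] with p hp
    rw [hp]
    simp
  refine Lp.ext ?_
  filter_upwards [h1, coeFn_zero_ae (weighted f a),
    ae_weighted_of_ae (f := f) (a := a) (Q := fun p => p ∈ Ω₀ a)
      (Eventually.of_forall fun _ h => h)] with p h2 h3 h4
  rw [h2 h4, h3]

/-- The explicit inverse of the transform. Besides surjectivity it yields the pointwise formula for
`J`. -/
theorem exists_preimage {f : ℝ × ℝ → ℝ} (hfm : Measurable f) {a : ℝ} (ha : 0 < a)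
    (hf : ∀ p ∈ Ω₀ a, 0 < f p) {g : ℝ × ℝ → ℂ} (hg : Measurable g)
    (hg2 : MemLp g 2 ((volume : Measure (ℝ × ℝ)).restrict (Ω₀ 1))) :
    ∃ ψ : Lp ℂ 2 (weighted f a), unitaryTransform hfm ha ψ = hg2.toLp g ∧
      ∀ᵐ p ∂(weighted f a), ψ p = g (p.1, p.2 / a) / (√(a * f p) : ℝ) := by
  set ψ₀ : ℝ × ℝ → ℂ := fun p => g (p.1, p.2 / a) / (√(a * f p) : ℝ) with hψ₀
  have hm : Measurable ψ₀ := by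
    have h1 : Measurable fun p : ℝ × ℝ => g (p.1, p.2 / a) := hg.comp (by fun_prop)
    exact h1.div (by fun_prop)
  have htr : transformFun f a ψ₀ =ᵐ[(volume : Measure (ℝ × ℝ)).restrict (Ω₀ 1)] g := by
    refine (ae_restrict_iff' (isOpen_strip 1).measurableSet).2 (Eventually.of_forall fun p hp => ?_)
    have hs : scale a p ∈ Ω₀ a := by
      rw [mem_strip] at hp ⊢
      rw [scale, abs_mul, abs_of_pos ha]
      nlinarith
    have h0 : ((√(a * f (scale a p)) : ℝ) : ℂ) ≠ 0 :=
      Complex.ofReal_ne_zero.2 (Real.sqrt_pos.2 (mul_pos ha (hf _ hs))).ne'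
    rw [transformFun, hψ₀]
    simp only
    rw [mul_div_cancel₀ _ h0]
    simp [scale, mul_div_cancel_left₀ _ ha.ne']
  have hL : MemLp ψ₀ 2 (weighted f a) := by
    refine ⟨hm.aestronglyMeasurable, ?_⟩
    rw [← eLpNorm_transformFun hfm ha hm, eLpNorm_congr_ae htr]
    exact hg2.2
  refine ⟨hL.toLp, ?_, hL.coeFn_toLp⟩
  exact MemLp.toLp_congr (memLp_transformFun hfm ha (hL.toLp : Lp ℂ 2 (weighted f a))) hg2
    ((transformFun_congr hfm ha hL.coeFn_toLp).trans htr)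

theorem unitaryTransform_surjective {f : ℝ × ℝ → ℝ} (hfm : Measurable f) {a : ℝ} (ha : 0 < a)
    (hf : ∀ p ∈ Ω₀ a, 0 < f p) : Function.Surjective (unitaryTransform hfm ha) := by
  intro G
  obtain ⟨ψ, hψ, -⟩ := exists_preimage hfm ha hf (Lp.stronglyMeasurable G).measurable (Lp.memLp G)
  exact ⟨ψ, hψ.trans (Lp.toLp_coeFn _ _)⟩

namespace Profile

variable (P : Profile) {a : ℝ}

theorem f_nonneg (p : ℝ × ℝ) : 0 ≤ P.f p := Real.sqrt_nonneg _

theorem f_pos (ha : 0 < a) (hB : a * P.B ≤ 1 / 4) : ∀ p ∈ Ω₀ a, 0 < P.f p := fun p hp => by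
  linarith [(f_bounds ha hB (mem_strip.1 hp).le).1]

theorem f_bounds_strip (ha : 0 < a) (hB : a * P.B ≤ 1 / 4) :
    ∀ p ∈ Ω₀ a, 1 / 2 ≤ P.f p ∧ P.f p ≤ 3 / 2 := fun _ hp =>
  f_bounds ha hB (mem_strip.1 hp).le

/-- The embedding of the first transverse mode in `L²(Ω₀, f ds dt)`. -/
def J (ha : 0 < a) (hB : a * P.B ≤ 1 / 4) : L2Line →ₗᵢ[ℂ] Lp ℂ 2 (weighted P.f a) :=
  (LinearIsometryEquiv.ofSurjective (unitaryTransform P.measurable_f ha)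
    (unitaryTransform_surjective P.measurable_f ha (P.f_pos ha hB))).symm.toLinearIsometry.comp
      modeEmbedding

variable (ha : 0 < a) (hB : a * P.B ≤ 1 / 4)

theorem unitaryTransform_J (φ : L2Line) :
    unitaryTransform P.measurable_f ha (P.J ha hB φ) = modeEmbedding φ :=
  (LinearIsometryEquiv.ofSurjective (unitaryTransform P.measurable_f ha)
    (unitaryTransform_surjective P.measurable_f ha (P.f_pos ha hB))).apply_symm_apply _

/-- `mode` is defined so as to be the preimage under `U` of the eigenfunction: the factor `√(a f)`
of `U` cancels its denominator. -/
theorem coeFn_J (φ : L2Line) :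
    ∀ᵐ p ∂(weighted P.f a), P.J ha hB φ p = φ p.1 * (P.mode a p : ℝ) := by
  obtain ⟨ψ, hψ, hψ'⟩ := exists_preimage P.measurable_f ha (P.f_pos ha hB)
    (measurable_modeFun (Lp.stronglyMeasurable φ).measurable) (memLp_modeFun φ)
  have : P.J ha hB φ = ψ :=
    (unitaryTransform P.measurable_f ha).injective
      ((P.unitaryTransform_J ha hB φ).trans hψ.symm)
  rw [this]
  filter_upwards [hψ'] with p hp
  rw [hp, modeFun, mode]
  push_cast
  rw [mul_div_assoc]

theorem ae_weighted_fst {Q : ℝ → Prop} (h : ∀ᵐ s, Q s) : ∀ᵐ p ∂(weighted P.f a), Q p.1 :=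
  ae_weighted_of_ae (by
    filter_upwards [Measure.quasiMeasurePreserving_fst.ae h] with p hp _
    exact hp)

theorem coeFn_J_of_eq {φ : L2Line} {φ' : ℝ → ℂ} (h : ∀ᵐ s, φ s = φ' s) :
    ∀ᵐ p ∂(weighted P.f a), P.J ha hB φ p = φ' p.1 * (P.mode a p : ℝ) := by
  filter_upwards [P.coeFn_J ha hB φ, P.ae_weighted_fst (a := a) h] with p h1 h2
  rw [h1, h2]

end Profile

/-- The point of the range of an isometry closest to `x` is its orthogonal projection. -/
theorem norm_sub_proj_le {E K : Type*} [NormedAddCommGroup E] [InnerProductSpace ℂ E]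
    [CompleteSpace E] [NormedAddCommGroup K] [InnerProductSpace ℂ K] [CompleteSpace K]
    (J : K →ₗᵢ[ℂ] E) (x : E) (y : K) :
    ‖x - J (ContinuousLinearMap.adjoint J.toContinuousLinearMap x)‖ ^ 2 ≤ ‖x - J y‖ ^ 2 := by
  set J' := ContinuousLinearMap.adjoint J.toContinuousLinearMap
  have hJ : ∀ u v, inner ℂ (J u) v = inner ℂ u (J' v) := fun u v =>
    (ContinuousLinearMap.adjoint_inner_right J.toContinuousLinearMap u v).symm
  have h0 : inner ℂ (J (J' x - y)) (x - J (J' x)) = 0 := by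
    rw [inner_sub_right, J.inner_map_map, hJ, sub_self]
  have e : x - J y = J (J' x - y) + (x - J (J' x)) := by rw [map_sub]; abel
  rw [e, sq, sq, norm_add_sq_eq_norm_sq_add_norm_sq_of_inner_eq_zero _ _ h0]
  exact le_add_of_nonneg_left (mul_self_nonneg _)

end QuantumStrip

/-! ### Transverse integration by parts with the singular weight `β` -/

namespace QuantumStrip

open Filter Topology

/-- `β` blows up at the boundary of the strip, so expressions containing it are only continuous
inside. A factor supported in a compact subset of the strip restores global continuity and
integrability. -/
theorem continuous_of_strip {X : Type*} [NormedAddCommGroup X] {a : ℝ} {g : ℝ × ℝ → X}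
    (hg : ContinuousOn g (Ω₀ a)) {K : Set (ℝ × ℝ)} (hK : IsCompact K) (hKΩ : K ⊆ Ω₀ a)
    (h0 : ∀ p ∉ K, g p = 0) : Continuous g ∧ HasCompactSupport g := by
  have hs : tsupport g ⊆ K := closure_minimal (fun p hp => by
    by_contra h
    exact hp (h0 p h)) hK.isClosed
  exact ⟨hg.continuous_of_tsupport_subset (isOpen_strip a) (hs.trans hKΩ),
    hK.of_isClosed_subset (isClosed_tsupport g) hs⟩

theorem restrict_strip' (a : ℝ) : (volume : Measure (ℝ × ℝ)).restrict (Ω₀ a) =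
    (volume : Measure ℝ).prod ((volume : Measure ℝ).restrict (Set.Ioo (-a) a)) := by
  rw [Ω₀, Measure.volume_eq_prod, ← Measure.prod_restrict, Measure.restrict_univ]

theorem hasDerivAt_slice_snd {ψ : ℝ × ℝ → ℂ} (hψ : ContDiff ℝ ∞ ψ) (s t : ℝ) :
    HasDerivAt (fun t => ψ (s, t)) (fderiv ℝ ψ (s, t) (0, 1)) t := by
  have h1 := (hψ.differentiable (by simp) (s, t)).hasFDerivAt
  have h2 : HasDerivAt (fun t : ℝ => (s, t)) ((0 : ℝ), (1 : ℝ)) t :=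
    (hasDerivAt_const t s).prodMk (hasDerivAt_id t)
  exact h1.comp_hasDerivAt t h2

theorem IsTest.continuous_fderiv_apply {X : Set (ℝ × ℝ)} {ψ : ℝ × ℝ → ℂ} (hψ : IsTest X ψ)
    (w : ℝ × ℝ) : Continuous fun p => fderiv ℝ ψ p w :=
  (hψ.1.continuous_fderiv (by simp)).clm_apply continuous_const

namespace Profile

variable (P : Profile) {a : ℝ} (ha : 0 < a) (hB : a * P.B ≤ 1 / 4)
include ha hB

theorem continuousOn_β : ContinuousOn (P.β a) (Ω₀ a) := by
  intro p hp
  have hF := (F_bounds ha hB (mem_strip.1 hp).le).1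
  have hc := cos_pos ha (mem_strip.1 hp)
  have h1 := P.continuous_F.continuousAt (x := p)
  have h2 := P.continuous_Ft.continuousAt (x := p)
  have h3 : ContinuousAt (fun p : ℝ × ℝ => Real.tan (Real.pi / 2 * (p.2 / a))) p :=
    ContinuousAt.comp (g := Real.tan) (f := fun p : ℝ × ℝ => Real.pi / 2 * (p.2 / a))
      (Real.continuousAt_tan.2 hc.ne') (by fun_prop)
  exact ((continuousAt_const.mul h3).sub
    (h2.div (continuousAt_const.mul h1) (mul_pos four_pos (by linarith)).ne')).continuousWithinAt

theorem continuousOn_V : ContinuousOn P.V (Ω₀ a) := by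
  intro p hp
  have hF := (F_bounds ha hB (mem_strip.1 hp).le).1
  have h1 := P.continuous_F.continuousAt (x := p)
  have h2 := P.continuous_Ft.continuousAt (x := p)
  have h3 : ContinuousAt (fun p : ℝ × ℝ => P.κ p.1 ^ 2 + P.σ p.1) p := by
    have := P.continuous_κ
    have := P.continuous_σ
    fun_prop
  exact ((h3.div (continuousAt_const.mul h1) (mul_pos two_pos (by linarith)).ne').sub
    (continuousAt_const.mul ((h2.div h1 (by linarith)).pow 2))).continuousWithinAt

theorem mode_pos {p : ℝ × ℝ} (hp : |p.2| < a) : 0 < P.mode a p := by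
  have hf := (f_bounds (P := P) ha hB hp.le).1
  exact div_pos (cos_pos ha hp) (Real.sqrt_pos.2 (mul_pos ha (by linarith)))

/-- Integration by parts in the transverse direction. -/
theorem integral_green {ψ w w' : ℝ × ℝ → ℂ} (hψ : IsTest (Ω₀ a) ψ) (hw : ContinuousOn w (Ω₀ a))
    (hw' : ContinuousOn w' (Ω₀ a))
    (hd : ∀ s t, |t| < a → HasDerivAt (fun t => w (s, t)) (w' (s, t)) t) :
    ∫ p, ((P.f p * P.β a p : ℝ) : ℂ) * (star (fderiv ℝ ψ p (0, 1)) * w p + star (ψ p) * w' p) +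
      ((-(E₁ a + P.V p) * P.f p - P.f p * P.β a p ^ 2 : ℝ) : ℂ) * (star (ψ p) * w p) = 0 := by
  have hβ := P.continuousOn_β ha hB
  have hV := P.continuousOn_V ha hB
  have hf := P.continuous_f.continuousOn (s := Ω₀ a)
  have hψc := hψ.1.continuous.continuousOn (s := Ω₀ a)
  have hψd := (hψ.continuous_fderiv_apply (0, 1)).continuousOn (s := Ω₀ a)
  have c1 : ContinuousOn (fun p => ((P.f p * P.β a p : ℝ) : ℂ)) (Ω₀ a) :=
    Complex.continuous_ofReal.comp_continuousOn (hf.mul hβ)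
  have c2 : ContinuousOn (fun p => ((-(E₁ a + P.V p) * P.f p - P.f p * P.β a p ^ 2 : ℝ) : ℂ))
      (Ω₀ a) := Complex.continuous_ofReal.comp_continuousOn
    (((continuousOn_const.add hV).neg.mul hf).sub (hf.mul (hβ.pow 2)))
  have hK : ∀ p ∉ tsupport ψ, ψ p = 0 := fun p hp => image_eq_zero_of_notMem_tsupport hp
  have hK' : ∀ p ∉ tsupport ψ, fderiv ℝ ψ p = 0 := fun p hp => fderiv_of_notMem_tsupport ℝ hp
  have i0 := continuous_of_strip (g := fun p => ((P.f p * P.β a p : ℝ) : ℂ) * (star (ψ p) * w p))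
    (c1.mul (hψc.star.mul hw)) hψ.2.1 hψ.2.2 (fun p hp => by simp [hK p hp])
  have i1 := continuous_of_strip (g := fun p => ((P.f p * P.β a p : ℝ) : ℂ) *
      (star (fderiv ℝ ψ p (0, 1)) * w p + star (ψ p) * w' p) +
      ((-(E₁ a + P.V p) * P.f p - P.f p * P.β a p ^ 2 : ℝ) : ℂ) * (star (ψ p) * w p))
    ((c1.mul ((hψd.star.mul hw).add (hψc.star.mul hw'))).add (c2.mul (hψc.star.mul hw)))
    hψ.2.1 hψ.2.2 (fun p hp => by simp [hK p hp, hK' p hp])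
  refine integral_lineDeriv_eq_zero (v := (0, 1)) (i0.1.integrable_of_hasCompactSupport i0.2)
    (i1.1.integrable_of_hasCompactSupport i1.2) fun p => ?_
  have hline : ∀ {g : ℝ × ℝ → ℂ} {g' : ℂ}, HasDerivAt (fun t => g (p.1, t)) g' p.2 →
      HasLineDerivAt ℝ g g' p (0, 1) := by
    intro g g' h
    have h1 : HasDerivAt (fun t : ℝ => p.2 + t) 1 0 := (hasDerivAt_id (0 : ℝ)).const_add p.2
    have h2 : HasDerivAt (fun t => g (p.1, t)) g' (p.2 + 0) := by rwa [add_zero]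
    have h3 := h2.scomp (0 : ℝ) h1
    rw [one_smul] at h3
    refine h3.congr_of_eventuallyEq (Eventually.of_forall fun t => ?_)
    simp only [Function.comp]
    congr 1
    ext <;> simp
  by_cases hp : p ∈ tsupport ψ
  · have hpa := mem_strip.1 (hψ.2.2 hp)
    refine hline ?_
    -- The integrand is the `t`-derivative of `fβ · ψ̄ · w`; the Riccati equation has been
    -- substituted for the derivative of `fβ`.
    have e1 := (hasDerivAt_f_mul_β (s := p.1) ha hB hpa).ofReal_comp
    have e2 := ((hasDerivAt_slice_snd hψ.1 p.1 p.2).star.mul (hd p.1 p.2 hpa))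
    refine (e1.mul e2).congr_deriv ?_
    simp only [Prod.mk.eta, Pi.mul_apply]
    ring
  · have hz : (fun p => ((P.f p * P.β a p : ℝ) : ℂ) * (star (ψ p) * w p)) =ᶠ[𝓝 p] fun _ => 0 := by
      filter_upwards [(isClosed_tsupport ψ).isOpen_compl.mem_nhds hp] with q hq
      simp [hK q hq]
    have h1 : HasFDerivAt (fun p => ((P.f p * P.β a p : ℝ) : ℂ) * (star (ψ p) * w p))
        (0 : ℝ × ℝ →L[ℝ] ℂ) p := (hasFDerivAt_const 0 p).congr_of_eventuallyEq hz
    refine (h1.hasLineDerivAt (0, 1)).congr_deriv ?_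
    simp [hK p hp, hK' p hp]

end Profile

end QuantumStrip

/-! ### Ground state representation and the pointwise gap estimate -/

namespace QuantumStrip

open Filter Topology

namespace Profile

variable (P : Profile) {a : ℝ}

theorem inner_eq_of_ae {x y : Lp ℂ 2 (weighted P.f a)} {u v : ℝ × ℝ → ℂ}
    (hx : ∀ᵐ p ∂(weighted P.f a), x p = u p) (hy : ∀ᵐ p ∂(weighted P.f a), y p = v p)
    (h0 : ∀ p ∉ Ω₀ a, u p = 0) :
    inner ℂ x y = ∫ p, (P.f p : ℂ) * (star (u p) * v p) := by
  rw [inner_eq_integral]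
  have h1 : ∫ p, (starRingEnd ℂ) (x p) * y p ∂(weighted P.f a) =
      ∫ p, star (u p) * v p ∂(weighted P.f a) := by
    refine integral_congr_ae ?_
    filter_upwards [hx, hy] with p h1 h2
    rw [h1, h2]
    rfl
  rw [h1, integral_weighted P.measurable_f P.f_nonneg, setIntegral_strip_eq]
  · simp only [Complex.real_smul]
  · intro p hp
    simp [h0 p hp]

theorem abs_V_le (ha : 0 < a) (hB : a * P.B ≤ 1 / 4) :
    ∀ᵐ p ∂(weighted P.f a), |P.V p| ≤ P.B ^ 2 + 50 * (a * P.B ^ 3) :=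
  ae_weighted_of_ae (Eventually.of_forall fun p hp => by
    have h1 := abs_V_sub_Veff_le (P := P) ha hB (mem_strip.1 hp).le
    have h2 := abs_Veff_le (P := P) p.1
    have : P.V p = (P.V p - P.Veff p.1) + P.Veff p.1 := by ring
    rw [this]
    exact (abs_add_le _ _).trans (by linarith))

variable (ha : 0 < a) (hB : a * P.B ≤ 1 / 4)

/-- Multiplication by the potential `V`. -/
def MV : Lp ℂ 2 (weighted P.f a) →L[ℂ] Lp ℂ 2 (weighted P.f a) :=
  mulL P.measurable_V (P.abs_V_le ha hB)

/-- The first order operator `∂₂ - β` annihilating the transverse ground state. -/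
def D (a : ℝ) (ψ : ℝ × ℝ → ℂ) (p : ℝ × ℝ) : ℂ := fderiv ℝ ψ p (0, 1) - (P.β a p : ℂ) * ψ p

theorem D_eq_zero {ψ : ℝ × ℝ → ℂ} (hψ : IsTest (Ω₀ a) ψ) {p : ℝ × ℝ} (hp : p ∉ Ω₀ a) :
    P.D a ψ p = 0 := by
  have hp' : p ∉ tsupport ψ := fun h => hp (hψ.2.2 h)
  rw [D, image_eq_zero_of_notMem_tsupport hp', fderiv_of_notMem_tsupport ℝ hp']
  simp

include ha hB

theorem continuous_D {ψ : ℝ × ℝ → ℂ} (hψ : IsTest (Ω₀ a) ψ) :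
    Continuous (P.D a ψ) ∧ HasCompactSupport (P.D a ψ) := by
  refine continuous_of_strip (K := tsupport ψ) ?_ hψ.2.1 hψ.2.2 fun p hp => ?_
  · exact (hψ.continuous_fderiv_apply (0, 1)).continuousOn.sub
      ((Complex.continuous_ofReal.comp_continuousOn (P.continuousOn_β ha hB)).mul
        hψ.1.continuous.continuousOn)
  · rw [D, image_eq_zero_of_notMem_tsupport hp, fderiv_of_notMem_tsupport ℝ hp]
    simp

/-- Expand `|∂₂ψ - βψ|²`. The cross terms combine to `β ∂₂|ψ|²`, and `integral_green` with `w = ψ`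
trades them for `E₁ + V + β²`; the terms in `β²` then cancel. -/
theorem integral_ground_state {ψ : ℝ × ℝ → ℂ} (hψ : IsTest (Ω₀ a) ψ) :
    ∫ p, (P.f p : ℂ) * (star (fderiv ℝ ψ p (0, 1)) * fderiv ℝ ψ p (0, 1)) =
      (∫ p, (P.f p : ℂ) * (star (P.D a ψ p) * P.D a ψ p)) +
      (E₁ a * ∫ p, (P.f p : ℂ) * (star (ψ p) * ψ p)) +
      ∫ p, (P.f p : ℂ) * (star (ψ p) * (P.V p * ψ p)) := by
  have hV := Complex.continuous_ofReal.comp_continuousOn (P.continuousOn_V ha hB)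
  have hf := (Complex.continuous_ofReal.comp P.continuous_f).continuousOn (s := Ω₀ a)
  have hψc := hψ.1.continuous.continuousOn (s := Ω₀ a)
  have hψd := (hψ.continuous_fderiv_apply (0, 1)).continuousOn (s := Ω₀ a)
  have hD := (P.continuous_D ha hB hψ).1.continuousOn (s := Ω₀ a)
  have hK : ∀ p ∉ tsupport ψ, ψ p = 0 := fun p hp => image_eq_zero_of_notMem_tsupport hp
  have hK' : ∀ p ∉ tsupport ψ, fderiv ℝ ψ p = 0 := fun p hp => fderiv_of_notMem_tsupport ℝ hp
  have i1 := continuous_of_strip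
    (g := fun p => (P.f p : ℂ) * (star (fderiv ℝ ψ p (0, 1)) * fderiv ℝ ψ p (0, 1)))
    (hf.mul (hψd.star.mul hψd)) hψ.2.1 hψ.2.2 (fun p hp => by simp [hK' p hp])
  have i2 := continuous_of_strip
    (g := fun p => (P.f p : ℂ) * (star (P.D a ψ p) * P.D a ψ p))
    (hf.mul (hD.star.mul hD)) hψ.2.1 hψ.2.2 (fun p hp => by simp [D, hK p hp, hK' p hp])
  have i3 := continuous_of_strip (g := fun p => (P.f p : ℂ) * (star (ψ p) * ψ p))
    (hf.mul (hψc.star.mul hψc)) hψ.2.1 hψ.2.2 (fun p hp => by simp [hK p hp])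
  have i4 := continuous_of_strip (g := fun p => (P.f p : ℂ) * (star (ψ p) * (P.V p * ψ p)))
    (hf.mul (hψc.star.mul (hV.mul hψc))) hψ.2.1 hψ.2.2 (fun p hp => by simp [hK p hp])
  have j1 := i1.1.integrable_of_hasCompactSupport (μ := volume) i1.2
  have j2 := i2.1.integrable_of_hasCompactSupport (μ := volume) i2.2
  have j3 := i3.1.integrable_of_hasCompactSupport (μ := volume) i3.2
  have j4 := i4.1.integrable_of_hasCompactSupport (μ := volume) i4.2
  have key := P.integral_green ha hB hψ hψc hψd fun s t _ => hasDerivAt_slice_snd hψ.1 s t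
  have j5 : Integrable (fun p => (P.f p : ℂ) * (star (P.D a ψ p) * P.D a ψ p) +
      (E₁ a : ℂ) * ((P.f p : ℂ) * (star (ψ p) * ψ p))) volume := j2.add (j3.const_mul _)
  have j6 : Integrable (fun p => ((P.f p : ℂ) * (star (P.D a ψ p) * P.D a ψ p) +
      (E₁ a : ℂ) * ((P.f p : ℂ) * (star (ψ p) * ψ p))) +
      (P.f p : ℂ) * (star (ψ p) * (P.V p * ψ p))) volume := j5.add j4
  rw [← sub_eq_zero, ← key, ← integral_const_mul, ← integral_add j2 (j3.const_mul _),
    ← integral_add j5 j4, ← integral_sub j1 j6]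
  refine integral_congr_ae (Eventually.of_forall fun p => ?_)
  simp only [D, star_sub, star_mul', Complex.star_def, Complex.conj_ofReal]
  push_cast
  ring

/-- A weighted Poincaré inequality. The quotient `ψ / mode` has `t`-derivative `Dψ / mode` and
equals `√a ψ(s, 0)` on the centre line, where `f = 1` and `χ₁ = 1`. Integrating from the centre to
`t` is harmless, because the cosine decreases away from the centre: the ratio of its value at `t` to
that at an intermediate point is at most 1. -/
theorem gap_pointwise {ψ : ℝ × ℝ → ℂ} (hψ : IsTest (Ω₀ a) ψ) {s t : ℝ} (ht : |t| < a) :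
    P.f (s, t) * ‖ψ (s, t) - (√a : ℝ) * ψ (s, 0) * (P.mode a (s, t) : ℝ)‖ ^ 2 ≤
      a * ∫ r in Set.Ioo (-a) a, P.f (s, r) * ‖P.D a ψ (s, r)‖ ^ 2 := by
  have hDc := (P.continuous_D ha hB hψ).1
  have hfc := P.continuous_f
  set I := ∫ r in Set.Ioo (-a) a, P.f (s, r) * ‖P.D a ψ (s, r)‖ ^ 2 with hI
  have hint : IntegrableOn (fun r => P.f (s, r) * ‖P.D a ψ (s, r)‖ ^ 2) (Set.Ioo (-a) a) := by
    have : Continuous fun r => P.f (s, r) * ‖P.D a ψ (s, r)‖ ^ 2 := by fun_prop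
    exact this.integrableOn_Icc.mono_set Set.Ioo_subset_Icc_self
  have ht' := abs_lt.1 ht
  have hsubset : Set.uIcc 0 t ⊆ Set.Ioo (-a) a := by
    intro r hr
    rcases Set.mem_uIcc.1 hr with h | h <;> constructor <;> linarith [h.1, h.2, ht'.1, ht'.2]
  have habs : ∀ r ∈ Set.Ioo (-a) a, |r| < a := fun r hr => abs_lt.2 hr
  have hm0 : ∀ r ∈ Set.Ioo (-a) a, (P.mode a (s, r) : ℂ) ≠ 0 := fun r hr =>
    Complex.ofReal_ne_zero.2 (P.mode_pos ha hB (p := (s, r)) (habs r hr)).ne'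
  set w : ℝ → ℂ := fun r => ψ (s, r) / (P.mode a (s, r) : ℝ) with hw
  have hwd : ∀ r ∈ Set.Ioo (-a) a, HasDerivAt w (P.D a ψ (s, r) / (P.mode a (s, r) : ℝ)) r := by
    intro r hr
    have h1 := (hasDerivAt_slice_snd hψ.1 s r).div
      (hasDerivAt_mode_snd (P := P) (s := s) ha hB (habs r hr)).ofReal_comp (hm0 r hr)
    refine h1.congr_deriv ?_
    have := hm0 r hr
    rw [D]
    push_cast
    field_simp
  have hmc : ContinuousOn (fun r => (P.mode a (s, r) : ℂ)) (Set.Ioo (-a) a) := fun r hr =>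
    (hasDerivAt_mode_snd (P := P) (s := s) ha hB
      (habs r hr)).ofReal_comp.continuousAt.continuousWithinAt
  have hwc : ContinuousOn (fun r => P.D a ψ (s, r) / (P.mode a (s, r) : ℂ)) (Set.uIcc 0 t) :=
    ((by fun_prop : Continuous fun r => P.D a ψ (s, r)).continuousOn.div hmc hm0).mono hsubset
  have hftc : ∫ r in (0 : ℝ)..t, P.D a ψ (s, r) / (P.mode a (s, r) : ℂ) = w t - w 0 :=
    intervalIntegral.integral_eq_sub_of_hasDerivAt (fun r hr => hwd r (hsubset hr))
      hwc.intervalIntegrable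
  have h0mem : (0 : ℝ) ∈ Set.Ioo (-a) a := ⟨by linarith, ha⟩
  have hf0 : P.f (s, 0) = 1 := by simp [f, F]
  have hw0 : w 0 = (√a : ℝ) * ψ (s, 0) := by
    simp only [hw, mode, hf0, χ₁]
    simp [mul_comm]
  set c : ℝ → ℝ := fun r => χ₁ (r / a) with hc
  have hcpos : ∀ r ∈ Set.Ioo (-a) a, 0 < c r := fun r hr => cos_pos ha (habs r hr)
  -- The weight `√f` cancels the one in the mode and leaves a pure cosine, for which the
  -- monotonicity is clear.
  have hsq : ∀ r, √(P.f (s, r)) * P.mode a (s, r) = c r / √a ∨ r ∉ Set.Ioo (-a) a := by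
    intro r
    by_cases hr : r ∈ Set.Ioo (-a) a
    · left
      have hfp := P.f_pos ha hB (s, r) (mem_strip.2 (habs r hr))
      have h1 := Real.sqrt_pos.2 hfp
      have h2 := Real.sqrt_pos.2 ha
      rw [mode, Real.sqrt_mul ha.le]
      field_simp
      rfl
    · exact Or.inr hr
  have hsq' : ∀ r ∈ Set.Ioo (-a) a, √(P.f (s, r)) * P.mode a (s, r) = c r / √a := fun r hr =>
    (hsq r).resolve_right (not_not.2 hr)
  have hsa := Real.sqrt_pos.2 ha
  set X := √(P.f (s, t)) * ‖ψ (s, t) - (√a : ℝ) * ψ (s, 0) * (P.mode a (s, t) : ℝ)‖ with hX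
  have htm : t ∈ Set.Ioo (-a) a := ht'
  have hX1 : X = c t / √a * ‖w t - w 0‖ := by
    have h1 : ψ (s, t) - (√a : ℝ) * ψ (s, 0) * (P.mode a (s, t) : ℝ) =
        (P.mode a (s, t) : ℝ) * (w t - w 0) := by
      rw [hw0, mul_sub, hw]
      simp only
      rw [mul_div_cancel₀ _ (hm0 t htm)]
      ring
    rw [hX, h1, norm_mul, Complex.norm_real, Real.norm_eq_abs,
      abs_of_pos (P.mode_pos ha hB (p := (s, t)) ht), ← mul_assoc, hsq' t htm]
  have hcle : ∀ r ∈ Set.uIoc 0 t, c t ≤ c r := by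
    intro r hr
    have hrt : |r| ≤ |t| := by
      rcases Set.mem_uIoc.1 hr with h | h
      · rw [abs_of_pos h.1, abs_of_pos (h.1.trans_le h.2)]
        exact h.2
      · rw [abs_of_nonpos h.2, abs_of_neg (h.1.trans_le h.2)]
        linarith [h.1]
    simp only [hc, χ₁]
    rw [← Real.cos_abs (Real.pi / 2 * (t / a)), ← Real.cos_abs (Real.pi / 2 * (r / a))]
    have hpi := Real.pi_pos
    simp only [abs_mul, abs_div, abs_of_pos hpi, abs_of_pos ha, abs_two]
    refine Real.cos_le_cos_of_nonneg_of_le_pi (by positivity) ?_ (by gcongr)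
    have : |t| / a ≤ 1 := by rw [div_le_one ha]; exact ht.le
    nlinarith
  have hIoc : Set.uIoc 0 t ⊆ Set.Ioo (-a) a := Set.uIoc_subset_uIcc.trans hsubset
  -- Cauchy–Schwarz in the form of Young's inequality with a free parameter; the choice `ε = X / a`
  -- below recovers `X² ≤ a I`.
  have hX2 : ∀ ε : ℝ, 0 < ε → X ≤ a * ε / 2 + I / (2 * ε) := by
    intro ε hε
    have n1 : ‖w t - w 0‖ ≤ ∫ r in Set.uIoc 0 t, ‖P.D a ψ (s, r) / (P.mode a (s, r) : ℂ)‖ := by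
      rw [← hftc]
      exact intervalIntegral.norm_integral_le_integral_norm_uIoc
    have hi1 : IntegrableOn (fun r => ‖P.D a ψ (s, r) / (P.mode a (s, r) : ℂ)‖)
        (Set.uIoc 0 t) :=
      (hwc.norm.integrableOn_compact isCompact_uIcc).mono_set Set.uIoc_subset_uIcc
    have hi2 : IntegrableOn (fun r => ε / 2 + P.f (s, r) * ‖P.D a ψ (s, r)‖ ^ 2 / (2 * ε))
        (Set.uIoc 0 t) :=
      (integrableOn_const (by simp [Set.uIoc])).add ((hint.mono_set hIoc).div_const _)
    calc X = c t / √a * ‖w t - w 0‖ := hX1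
      _ ≤ c t / √a * ∫ r in Set.uIoc 0 t, ‖P.D a ψ (s, r) / (P.mode a (s, r) : ℂ)‖ := by
        have := (hcpos t htm).le
        gcongr
      _ = ∫ r in Set.uIoc 0 t, c t / √a * ‖P.D a ψ (s, r) / (P.mode a (s, r) : ℂ)‖ :=
        (integral_const_mul _ _).symm
      _ ≤ ∫ r in Set.uIoc 0 t, (ε / 2 + P.f (s, r) * ‖P.D a ψ (s, r)‖ ^ 2 / (2 * ε)) := by
        refine setIntegral_mono_on (hi1.const_mul _) hi2 measurableSet_uIoc fun r hr => ?_
        have hra := hIoc hr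
        have hmp := P.mode_pos ha hB (p := (s, r)) (habs r hra)
        have h1 : c t / √a * ‖P.D a ψ (s, r) / (P.mode a (s, r) : ℂ)‖ ≤
            √(P.f (s, r)) * ‖P.D a ψ (s, r)‖ := by
          calc _ ≤ c r / √a * ‖P.D a ψ (s, r) / (P.mode a (s, r) : ℂ)‖ := by
                have := hcle r hr
                gcongr
            _ = _ := by
                rw [← hsq' r hra, norm_div, Complex.norm_real, Real.norm_eq_abs, abs_of_pos hmp]
                field_simp
        refine h1.trans ?_
        have h2 : P.f (s, r) * ‖P.D a ψ (s, r)‖ ^ 2 =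
            (√(P.f (s, r)) * ‖P.D a ψ (s, r)‖) ^ 2 := by
          rw [mul_pow, Real.sq_sqrt (P.f_nonneg _)]
        rw [h2]
        set Y := √(P.f (s, r)) * ‖P.D a ψ (s, r)‖
        have h3 : ε / 2 + Y ^ 2 / (2 * ε) - Y = (Y - ε) ^ 2 / (2 * ε) := by
          field_simp
          ring
        have h4 : 0 ≤ (Y - ε) ^ 2 / (2 * ε) := by positivity
        linarith
      _ = |t| * (ε / 2) +
          (∫ r in Set.uIoc 0 t, P.f (s, r) * ‖P.D a ψ (s, r)‖ ^ 2) / (2 * ε) := by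
        have hcst : IntegrableOn (fun _ : ℝ => ε / 2) (Set.uIoc 0 t) volume :=
          integrableOn_const (by simp [Set.uIoc])
        rw [integral_add hcst ((hint.mono_set hIoc).div_const _),
          setIntegral_const, integral_div, smul_eq_mul]
        congr 2
        rw [Set.uIoc, Real.volume_real_Ioc_of_le min_le_max, max_sub_min_eq_abs, sub_zero]
      _ ≤ a * (ε / 2) + I / (2 * ε) := by
        gcongr
        exact setIntegral_mono_set hint
          (Eventually.of_forall fun r => mul_nonneg (P.f_nonneg _) (sq_nonneg _))
          (Eventually.of_forall hIoc)
      _ = _ := by ring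
  have hX0 : 0 ≤ X := by positivity
  have hgoal : X ^ 2 ≤ a * I := by
    rcases hX0.eq_or_lt with h | h
    · rw [← h, zero_pow two_ne_zero]
      refine mul_nonneg ha.le (integral_nonneg fun r => mul_nonneg (P.f_nonneg _) (sq_nonneg _))
    · have h1 := hX2 (X / a) (by positivity)
      have h2 : a * (X / a) / 2 = X / 2 := by field_simp
      have h3 : I / (2 * (X / a)) = a * I / (2 * X) := by field_simp
      rw [h2, h3] at h1
      have h4 : X / 2 ≤ a * I / (2 * X) := by linarith
      rw [le_div_iff₀ (by positivity)] at h4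
      nlinarith
  rw [hX, mul_pow, Real.sq_sqrt (P.f_nonneg _)] at hgoal
  exact hgoal

end Profile

end QuantumStrip

/-! ### Spectral gap and lower bound for the energy -/

namespace QuantumStrip

open Filter Topology

namespace Profile

variable (P : Profile) {a : ℝ} (ha : 0 < a) (hB : a * P.B ≤ 1 / 4)

theorem integral_weighted' (a : ℝ) (g : ℝ × ℝ → ℝ) :
    ∫ p, g p ∂(weighted P.f a) = ∫ p in Ω₀ a, P.f p * g p :=
  integral_weighted P.measurable_f P.f_nonneg a g

theorem memLp_slice {a : ℝ} {ψ : ℝ × ℝ → ℂ} (hψ : IsTest (Ω₀ a) ψ) :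
    MemLp (fun s => (√a : ℝ) * ψ (s, 0)) 2 (volume : Measure ℝ) := by
  have hc : Continuous fun s => ((√a : ℝ) : ℂ) * ψ (s, 0) := by
    have := hψ.1.continuous
    fun_prop
  refine hc.memLp_of_hasCompactSupport ?_
  refine HasCompactSupport.mul_left ?_
  refine HasCompactSupport.intro (hψ.2.1.isCompact.image continuous_fst) fun s hs => ?_
  exact image_eq_zero_of_notMem_tsupport fun h => hs ⟨_, h, rfl⟩

include ha hB

theorem memLp_of_continuous {g : ℝ × ℝ → ℂ} (hg : Continuous g) (hs : HasCompactSupport g) :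
    MemLp g 2 (weighted P.f a) := by
  obtain ⟨M, hM⟩ := hg.bounded_above_of_compact_support hs
  refine memLp_of_le_indicator hs.isCompact.measurableSet
    (weighted_lt_top (fun p hp => (P.f_bounds_strip ha hB p hp).2) hs.isCompact)
    hg.aestronglyMeasurable (L := M) (Eventually.of_forall fun p => ?_)
  by_cases hp : p ∈ tsupport g
  · rw [Set.indicator_of_mem hp]
    exact hM p
  · rw [Set.indicator_of_notMem hp, image_eq_zero_of_notMem_tsupport hp, norm_zero]

/-- The transverse energy, in terms of the ground state. -/
theorem norm_sq_snd_eq {x : Lp ℂ 2 (weighted P.f a)} {g d : Lp ℂ 2 (weighted P.f a)}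
    {ψ : ℝ × ℝ → ℂ} (hψ : IsTest (Ω₀ a) ψ) (hx : ∀ᵐ p ∂(weighted P.f a), x p = ψ p)
    (hg : ∀ᵐ p ∂(weighted P.f a), g p = fderiv ℝ ψ p (0, 1))
    (hd : ∀ᵐ p ∂(weighted P.f a), d p = P.D a ψ p) :
    ‖g‖ ^ 2 = ‖d‖ ^ 2 + E₁ a * ‖x‖ ^ 2 + (inner ℂ x (P.MV ha hB x)).re := by
  have h0 : ∀ p ∉ Ω₀ a, ψ p = 0 := fun p hp =>
    image_eq_zero_of_notMem_tsupport fun h => hp (hψ.2.2 h)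
  have h0' : ∀ p ∉ Ω₀ a, fderiv ℝ ψ p (0, 1) = 0 := fun p hp => by
    rw [fderiv_of_notMem_tsupport ℝ fun h => hp (hψ.2.2 h)]
    rfl
  have hV : ∀ᵐ p ∂(weighted P.f a), P.MV ha hB x p = (P.V p : ℂ) * ψ p := by
    filter_upwards [coeFn_mulL P.measurable_V (P.abs_V_le ha hB) x, hx] with p h1 h2
    rw [MV, h1, h2]
  have key := P.integral_ground_state ha hB hψ
  rw [← P.inner_eq_of_ae hg hg h0', ← P.inner_eq_of_ae hd hd fun p hp => P.D_eq_zero hψ hp,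
    ← P.inner_eq_of_ae hx hx h0, ← P.inner_eq_of_ae hx hV h0, inner_self_eq_norm_sq_to_K,
    inner_self_eq_norm_sq_to_K, inner_self_eq_norm_sq_to_K] at key
  have := congrArg Complex.re key
  simp only [Complex.add_re, Complex.coe_algebraMap] at this
  norm_cast at this

/-- The spectral gap of the transverse operator. -/
theorem norm_sub_mode_le {x d : Lp ℂ 2 (weighted P.f a)} {ψ : ℝ × ℝ → ℂ}
    (hψ : IsTest (Ω₀ a) ψ) (hx : ∀ᵐ p ∂(weighted P.f a), x p = ψ p)
    (hd : ∀ᵐ p ∂(weighted P.f a), d p = P.D a ψ p) :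
    ‖x - P.J ha hB ((memLp_slice (a := a) hψ).toLp _)‖ ^ 2 ≤ 2 * a ^ 2 * ‖d‖ ^ 2 := by
  have hJ := P.coeFn_J_of_eq ha hB (memLp_slice (a := a) hψ).coeFn_toLp
  have e1 : ‖x - P.J ha hB ((memLp_slice (a := a) hψ).toLp _)‖ ^ 2 =
      ∫ p in Ω₀ a, P.f p * ‖ψ p - (√a : ℝ) * ψ (p.1, 0) * (P.mode a p : ℝ)‖ ^ 2 := by
    rw [norm_sq_eq_integral, ← P.integral_weighted' a]
    refine integral_congr_ae ?_
    filter_upwards [Lp.coeFn_sub x (P.J ha hB ((memLp_slice (a := a) hψ).toLp _)), hx, hJ]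
      with p h1 h2 h3
    rw [h1, Pi.sub_apply, h2, h3]
  have e2 : ‖d‖ ^ 2 = ∫ p in Ω₀ a, P.f p * ‖P.D a ψ p‖ ^ 2 := by
    rw [norm_sq_eq_integral, ← P.integral_weighted' a]
    refine integral_congr_ae ?_
    filter_upwards [hd] with p h1
    rw [h1]
  have hDc := P.continuous_D ha hB hψ
  have hc : Continuous fun p => P.f p * ‖P.D a ψ p‖ ^ 2 := by
    have := P.continuous_f
    have := hDc.1
    fun_prop
  have hs : HasCompactSupport fun p => P.f p * ‖P.D a ψ p‖ ^ 2 :=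
    HasCompactSupport.mul_left (hDc.2.comp_left (g := fun z : ℂ => ‖z‖ ^ 2) (by simp))
  have hi := (hc.integrable_of_hasCompactSupport hs (μ := volume)).restrict (s := Ω₀ a)
  rw [e1, e2]
  rw [restrict_strip'] at hi ⊢
  set ν := (volume : Measure ℝ).restrict (Set.Ioo (-a) a)
  have hG := hi.integral_prod_left.comp_fst ν
  calc _ ≤ ∫ p, a * ∫ r, P.f (p.1, r) * ‖P.D a ψ (p.1, r)‖ ^ 2 ∂ν
        ∂((volume : Measure ℝ).prod ν) := by
        refine integral_mono_of_nonneg (Eventually.of_forall fun p =>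
          mul_nonneg (P.f_nonneg p) (sq_nonneg _)) (hG.const_mul a) ?_
        rw [← restrict_strip']
        refine (ae_restrict_iff' (isOpen_strip a).measurableSet).2
          (Eventually.of_forall fun p hp => ?_)
        exact P.gap_pointwise ha hB hψ (mem_strip.1 hp)
    _ = 2 * a ^ 2 * ∫ p, P.f p * ‖P.D a ψ p‖ ^ 2 ∂((volume : Measure ℝ).prod ν) := by
        rw [integral_const_mul, integral_prod _ hi,
          integral_fun_fst (fun s => ∫ r, P.f (s, r) * ‖P.D a ψ (s, r)‖ ^ 2 ∂ν)]
        -- The bound of `gap_pointwise` does not depend on `t`, so integrating over the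
        -- cross-section multiplies the factor `a` by the width `2a`.
        have : ν.real Set.univ = 2 * a := by
          simp only [ν, Measure.real, Measure.restrict_apply_univ, Real.volume_Ioo]
          rw [ENNReal.toReal_ofReal (by linarith)]
          ring
        rw [this, smul_eq_mul]
        ring

/-- The lower bound for the energy of a thin strip. -/
theorem energy_lower_bound {v c lam : ℝ} (hV : ∀ s, v ≤ P.Veff s)
    (hc : c + lam ≤ v - 50 * (a * P.B ^ 3))
    {x : Lp ℂ 2 (weighted P.f a) × WithLp 2 (Lp ℂ 2 (weighted P.f a) × Lp ℂ 2 (weighted P.f a))}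
    (hx : x ∈ testGradient P.f a) :
    c * ‖x.1‖ ^ 2 + ‖x.2.fst‖ ^ 2 + (2 * a ^ 2)⁻¹ * ‖x.1 - P.J ha hB
      (ContinuousLinearMap.adjoint (P.J ha hB).toContinuousLinearMap x.1)‖ ^ 2 ≤
      ‖x.2‖ ^ 2 - (E₁ a + lam) * ‖x.1‖ ^ 2 := by
  obtain ⟨ψ, hψ, hx0, -, hx2⟩ := hx
  have hD := P.continuous_D ha hB hψ
  have hdm := P.memLp_of_continuous ha hB hD.1 hD.2
  have h1 := P.norm_sq_snd_eq ha hB hψ hx0 hx2 hdm.coeFn_toLp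
  have h2 := P.norm_sub_mode_le ha hB hψ hx0 hdm.coeFn_toLp
  -- The slice `√a ψ(s, 0)` need not be the projection of `ψ` onto the mode, but the projection is
  -- at least as close to `ψ`.
  have h3 := norm_sub_proj_le (P.J ha hB) x.1 ((memLp_slice (a := a) hψ).toLp _)
  have h4 : (v - 50 * (a * P.B ^ 3)) * ‖x.1‖ ^ 2 ≤ (inner ℂ x.1 (P.MV ha hB x.1)).re :=
    re_inner_mulL_ge P.measurable_V (P.abs_V_le ha hB) (ae_weighted_of_ae
      (Eventually.of_forall fun p hp => by
        have := abs_le.1 (abs_V_sub_Veff_le (P := P) ha hB (mem_strip.1 hp).le)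
        linarith [hV p.1, this.1])) x.1
  have h5 : ‖x.2‖ ^ 2 = ‖x.2.fst‖ ^ 2 + ‖x.2.snd‖ ^ 2 := WithLp.prod_norm_sq_eq_of_L2 _
  have h6 : (2 * a ^ 2)⁻¹ * ‖x.1 - P.J ha hB
      (ContinuousLinearMap.adjoint (P.J ha hB).toContinuousLinearMap x.1)‖ ^ 2 ≤
      ‖(hdm.toLp _ : Lp ℂ 2 (weighted P.f a))‖ ^ 2 := by
    rw [inv_mul_le_iff₀ (by positivity)]
    exact h3.trans h2
  have h7 := mul_le_mul_of_nonneg_right hc (sq_nonneg ‖x.1‖)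
  rw [h5, h1]
  linarith

end Profile

end QuantumStrip

namespace QuantumStrip

open Filter Topology

/-! ### Bounded Lipschitz functions -/

/-- `u` is bounded by `M` and Lipschitz with constant `C`. -/
def IsBddLip {X A : Type*} [PseudoEMetricSpace X] [NormedRing A] (C M : NNReal) (u : X → A) :
    Prop := LipschitzWith C u ∧ ∀ p, ‖u p‖ ≤ M

namespace IsBddLip

variable {X A : Type*} [PseudoMetricSpace X] [NormedRing A] {C D M N : NNReal} {u v : X → A}

theorem mul (hu : IsBddLip C M u) (hv : IsBddLip D N v) :
    IsBddLip (M * D + C * N) (M * N) fun p => u p * v p := by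
  refine ⟨LipschitzWith.of_dist_le_mul fun p q => ?_, fun p => ?_⟩
  · have h1 : u p * v p - u q * v q = u p * (v p - v q) + (u p - u q) * v q := by noncomm_ring
    have h2 := hu.1.dist_le_mul p q
    have h3 := hv.1.dist_le_mul p q
    rw [dist_eq_norm] at h2 h3 ⊢
    rw [h1]
    push_cast
    calc _ ≤ ‖u p‖ * ‖v p - v q‖ + ‖u p - u q‖ * ‖v q‖ :=
          (norm_add_le _ _).trans (add_le_add (norm_mul_le _ _) (norm_mul_le _ _))
      _ ≤ M * (D * dist p q) + C * dist p q * N := by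
          have h4 := hu.2 p
          have h5 := hv.2 q
          gcongr
      _ = _ := by ring
  · push_cast
    have h4 := hu.2 p
    have h5 := hv.2 p
    exact (norm_mul_le _ _).trans (by gcongr)

theorem add (hu : IsBddLip C M u) (hv : IsBddLip D N v) :
    IsBddLip (C + D) (M + N) fun p => u p + v p :=
  ⟨hu.1.add hv.1, fun p => (norm_add_le _ _).trans (add_le_add (hu.2 p) (hv.2 p))⟩

theorem sub (hu : IsBddLip C M u) (hv : IsBddLip D N v) :
    IsBddLip (C + D) (M + N) fun p => u p - v p :=
  ⟨hu.1.sub hv.1, fun p => (norm_sub_le _ _).trans (add_le_add (hu.2 p) (hv.2 p))⟩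

theorem const (c : A) : IsBddLip (X := X) 0 ‖c‖₊ fun _ => c :=
  ⟨LipschitzWith.const c, fun _ => le_rfl⟩

theorem comp_fst {u : ℝ → A} (hu : IsBddLip C M u) :
    IsBddLip C M fun p : ℝ × ℝ => u p.1 :=
  ⟨by
    have h := hu.1.comp (LipschitzWith.prod_fst (α := ℝ) (β := ℝ))
    rwa [mul_one] at h, fun p => hu.2 p.1⟩

theorem comp_snd {u : ℝ → A} (hu : IsBddLip C M u) :
    IsBddLip C M fun p : ℝ × ℝ => u p.2 :=
  ⟨by
    have h := hu.1.comp (LipschitzWith.prod_snd (α := ℝ) (β := ℝ))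
    rwa [mul_one] at h, fun p => hu.2 p.2⟩

theorem ofReal {u : X → ℝ} (hu : IsBddLip C M u) : IsBddLip C M fun p => (u p : ℂ) :=
  ⟨by
    have h := Complex.isometry_ofReal.lipschitz.comp hu.1
    rwa [one_mul] at h, fun p => by
    simpa using hu.2 p⟩

theorem inv {u : X → ℝ} (hu : IsBddLip C M u) (h : ∀ p, 1 / 2 ≤ u p) :
    IsBddLip (4 * C) 2 fun p => (u p)⁻¹ := by
  refine ⟨LipschitzWith.of_dist_le_mul fun p q => ?_, fun p => ?_⟩
  · have h2 := hu.1.dist_le_mul p q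
    have hp := h p
    have hq := h q
    rw [Real.dist_eq] at h2 ⊢
    have h1 : (u p)⁻¹ - (u q)⁻¹ = (u q - u p) / (u p * u q) := by
      field_simp
    rw [h1, abs_div, abs_of_pos (by positivity : 0 < u p * u q), div_le_iff₀ (by positivity),
      abs_sub_comm]
    push_cast
    have h3 : 1 / 4 ≤ u p * u q := by nlinarith
    have h4 : 0 ≤ (C : ℝ) * dist p q := by positivity
    nlinarith
  · have hp := h p
    rw [norm_inv, Real.norm_of_nonneg (by linarith)]
    exact (inv_anti₀ (by norm_num) hp).trans (by norm_num)

/-- With `u ≥ 1/4` the sum of two values of the root is at least 1, so taking the root does not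
increase the Lipschitz constant. -/
theorem sqrt {u : X → ℝ} (hu : IsBddLip C M u) (h : ∀ p, 1 / 4 ≤ u p) :
    IsBddLip C (M + 1) fun p => √(u p) := by
  have hs : ∀ p, 1 / 2 ≤ √(u p) := fun p =>
    Real.le_sqrt_of_sq_le ((by norm_num : (1 / 2 : ℝ) ^ 2 = 1 / 4).trans_le (h p))
  refine ⟨LipschitzWith.of_dist_le_mul fun p q => ?_, fun p => ?_⟩
  · refine le_trans ?_ (hu.1.dist_le_mul p q)
    have e : u p - u q = (√(u p) - √(u q)) * (√(u p) + √(u q)) := by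
      have h1 := Real.sq_sqrt (by linarith [h p] : 0 ≤ u p)
      have h2 := Real.sq_sqrt (by linarith [h q] : 0 ≤ u q)
      linear_combination h2 - h1
    rw [Real.dist_eq, Real.dist_eq, e, abs_mul]
    refine le_mul_of_one_le_right (abs_nonneg _) ?_
    exact le_trans (by linarith [hs p, hs q]) (le_abs_self _)
  · rw [Real.norm_of_nonneg (Real.sqrt_nonneg _)]
    push_cast
    have h1 := hu.2 p
    rw [Real.norm_of_nonneg (by linarith [h p])] at h1
    refine Real.sqrt_le_iff.2 ⟨by positivity, ?_⟩
    nlinarith [M.2]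

end IsBddLip

theorem IsTest.isBddLip {V : Type*} [NormedAddCommGroup V] [NormedSpace ℝ V] {Y : Set V}
    {φ : V → ℂ} (h : IsTest Y φ) : ∃ C M, IsBddLip C M φ := by
  obtain ⟨C, hC⟩ := ContDiff.lipschitzWith_of_hasCompactSupport h.2.1 h.1 (by simp)
  obtain ⟨M, hM⟩ := h.1.continuous.bounded_above_of_compact_support h.2.1
  exact ⟨C, M.toNNReal, hC, fun p => (hM p).trans (Real.le_coe_toNNReal M)⟩

/-- The projection of `ℝ` onto `[-a, a]`. -/
def clamp (a t : ℝ) : ℝ := max (-a) (min a t)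

theorem abs_clamp_le {a : ℝ} (ha : 0 ≤ a) (t : ℝ) : |clamp a t| ≤ a :=
  abs_le.2 ⟨le_max_left _ _, max_le (by linarith) (min_le_left _ _)⟩

theorem clamp_of_abs_le {a t : ℝ} (h : |t| ≤ a) : clamp a t = t := by
  have := abs_le.1 h
  rw [clamp, min_eq_right this.2, max_eq_right this.1]

theorem isBddLip_clamp {a : ℝ} (ha : 0 ≤ a) : IsBddLip 1 a.toNNReal (clamp a) :=
  ⟨(LipschitzWith.id.const_min a).const_max (-a), fun t => by
    rw [Real.coe_toNNReal a ha]
    exact abs_clamp_le ha t⟩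

/-- The transverse ground state `cos (π t / 2a)`, extended by zero. -/
def cutMode (a t : ℝ) : ℝ := χ₁ (clamp a t / a)

theorem cutMode_nonneg {a : ℝ} (ha : 0 < a) (t : ℝ) : 0 ≤ cutMode a t := by
  have h := abs_le.1 (abs_clamp_le ha.le t)
  have hpi := Real.pi_pos
  have h1 : clamp a t / a ≤ 1 := by rw [div_le_one ha]; exact h.2
  have h2 : -1 ≤ clamp a t / a := by rw [le_div_iff₀ ha]; linarith [h.1]
  refine Real.cos_nonneg_of_mem_Icc ⟨?_, ?_⟩ <;> nlinarith

theorem cutMode_eq_zero {a : ℝ} (ha : 0 < a) {t : ℝ} (h : a ≤ |t|) : cutMode a t = 0 := by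
  rcases le_abs.1 h with h | h
  · rw [cutMode, clamp, min_eq_left h, max_eq_right (by linarith), div_self ha.ne', χ₁, mul_one,
      Real.cos_pi_div_two]
  · rw [cutMode, clamp, min_eq_right (by linarith), max_eq_left (by linarith), neg_div,
      div_self ha.ne', χ₁, mul_neg, mul_one, Real.cos_neg, Real.cos_pi_div_two]

theorem exists_isBddLip_χ₁ {a : ℝ} (ha : 0 < a) : ∃ C, IsBddLip C 1 fun t => χ₁ (t / a) := by
  have h1 : LipschitzWith 1 Real.cos := Real.lipschitzWith_cos
  have h2 : LipschitzWith (Real.pi / 2 / a).toNNReal fun x : ℝ => Real.pi / 2 * (x / a) := by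
    refine LipschitzWith.of_dist_le_mul fun x y => ?_
    rw [Real.dist_eq, Real.dist_eq, Real.coe_toNNReal _ (by positivity), ← mul_sub, ← sub_div,
      abs_mul, abs_of_pos (by positivity : 0 < Real.pi / 2), abs_div, abs_of_pos ha]
    exact le_of_eq (by ring)
  exact ⟨_, h1.comp h2, fun t => by simpa [χ₁] using Real.abs_cos_le_one _⟩

theorem exists_isBddLip_cutMode {a : ℝ} (ha : 0 < a) : ∃ C, IsBddLip C 1 (cutMode a) := by
  obtain ⟨C, hC⟩ := exists_isBddLip_χ₁ ha
  exact ⟨_, hC.1.comp (isBddLip_clamp ha.le).1, fun t => hC.2 _⟩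

/-! ### The weight `√f` as a globally Lipschitz function -/

namespace Profile

variable (P : Profile) {a : ℝ}

/-- The function `√f`, extended from the strip to a bounded Lipschitz function. -/
def q (a : ℝ) (p : ℝ × ℝ) : ℝ := √(P.f (p.1, clamp a p.2))

theorem q_eq {p : ℝ × ℝ} (hp : |p.2| ≤ a) : P.q a p = √(P.f p) := by
  rw [q, clamp_of_abs_le hp]

section

variable (ha : 0 < a) (hB : a * P.B ≤ 1 / 4)
include ha hB

theorem le_q (p : ℝ × ℝ) : 1 / 2 ≤ P.q a p :=
  Real.le_sqrt_of_sq_le (by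
    linarith [(f_bounds (P := P) (p := (p.1, clamp a p.2)) ha hB (abs_clamp_le ha.le p.2)).1])

/-- Clamping `t` keeps `F ≥ 3/8` and `f ≥ 1/2` on the whole plane, which permits both square roots.
-/
theorem exists_isBddLip_q : ∃ C M, IsBddLip C M (P.q a) := by
  have hκ : IsBddLip P.B P.B fun p : ℝ × ℝ => P.κ p.1 :=
    IsBddLip.comp_fst ⟨P.lipschitz_κ, P.abs_κ_le⟩
  have hσ : IsBddLip P.B P.B fun p : ℝ × ℝ => P.σ p.1 :=
    IsBddLip.comp_fst ⟨P.lipschitz_σ, fun s => by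
      rw [Real.norm_of_nonneg (P.σ_nonneg s)]
      exact P.σ_le s⟩
  have ht : IsBddLip 1 a.toNNReal fun p : ℝ × ℝ => clamp a p.2 := (isBddLip_clamp ha.le).comp_snd
  have h1 := (IsBddLip.const (1 : ℝ)).sub (ht.mul hκ)
  have hF := (h1.mul h1).add ((ht.mul ht).mul hσ)
  have hF' : (fun p : ℝ × ℝ => (1 - clamp a p.2 * P.κ p.1) * (1 - clamp a p.2 * P.κ p.1) +
      clamp a p.2 * clamp a p.2 * P.σ p.1) = fun p => P.F (p.1, clamp a p.2) := by
    ext p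
    simp only [F]
    ring
  rw [hF'] at hF
  have hf := hF.sqrt fun p => by
    linarith [(F_bounds (P := P) (p := (p.1, clamp a p.2)) ha hB (abs_clamp_le ha.le p.2)).1]
  exact ⟨_, _, hf.sqrt fun p => by
    have := (f_bounds (P := P) (p := (p.1, clamp a p.2)) ha hB (abs_clamp_le ha.le p.2)).1
    exact (by norm_num : (1 / 4 : ℝ) ≤ 1 / 2).trans this⟩

/-- Inside the strip `q` is the fourth root of `F`, whose logarithmic `s`-derivative is `∂₁F / (4F)
= m`. Differentiability holds where `κ` and `σ` are differentiable, that is, almost everywhere. -/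
theorem hasFDerivAt_q {p : ℝ × ℝ} (hp : |p.2| < a) (hκ : DifferentiableAt ℝ P.κ p.1)
    (hσ : DifferentiableAt ℝ P.σ p.1) :
    ∃ L : ℝ × ℝ →L[ℝ] ℝ, HasFDerivAt (P.q a) L p ∧ L (1, 0) = P.m p * P.q a p := by
  have hF := (F_bounds (P := P) ha hB hp.le).1
  have hf := (f_bounds (P := P) ha hB hp.le).1
  have k1 := hκ.hasDerivAt.comp_hasFDerivAt p (hasFDerivAt_fst (𝕜 := ℝ) (E := ℝ) (F := ℝ))
  have k2 := hσ.hasDerivAt.comp_hasFDerivAt p (hasFDerivAt_fst (𝕜 := ℝ) (E := ℝ) (F := ℝ))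
  have k3 : HasFDerivAt (fun p : ℝ × ℝ => p.2) (ContinuousLinearMap.snd ℝ ℝ ℝ) p := hasFDerivAt_snd
  have k4 : HasFDerivAt P.F _ p := (((k3.mul k1).const_sub 1).pow 2).add ((k3.pow 2).mul k2)
  have k5 := (k4.sqrt (by linarith)).sqrt (by
    change P.f p ≠ 0
    linarith)
  have hq : P.q a =ᶠ[𝓝 p] fun p => √(√(P.F p)) := by
    filter_upwards [(isOpen_strip a).mem_nhds (mem_strip.2 hp)] with r hr
    exact P.q_eq (mem_strip.1 hr).le
  refine ⟨_, k5.congr_of_eventuallyEq hq, ?_⟩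
  have e1 : P.q a p = √(P.f p) := P.q_eq hp.le
  have e2 : √(P.F p) = P.f p := rfl
  have e3 : √(P.f p) ^ 2 = P.f p := Real.sq_sqrt (P.f_nonneg p)
  have e4 : P.F p = √(P.f p) ^ 4 := by rw [← sq_f ha hB hp.le, ← e3]; ring_nf; rw [e3]
  have e5 : 0 < √(P.f p) := Real.sqrt_pos.2 (by linarith)
  rw [e1, e2, m, e4]
  simp
  generalize √(P.f p) = r at e3 e5 ⊢
  rw [← e3]
  field_simp
  ring

end

end Profile

end QuantumStrip

/-! ### Longitudinal integration by parts: the adjoint of `J` maps into `W^{1,2}(ℝ)` -/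

namespace QuantumStrip

open Filter Topology

theorem integrable_conj_mul {α : Type*} [MeasurableSpace α] {μ : Measure α} (x y : Lp ℂ 2 μ) :
    Integrable (fun p => (starRingEnd ℂ) (x p) * y p) μ := by
  simpa [RCLike.inner_apply, mul_comm] using L2.integrable_inner (𝕜 := ℂ) x y

namespace Profile

variable (P : Profile) {a : ℝ}

theorem ae_differentiableAt : ∀ᵐ p : ℝ × ℝ,
    DifferentiableAt ℝ P.κ p.1 ∧ DifferentiableAt ℝ P.σ p.1 := by
  have h : ∀ᵐ s, DifferentiableAt ℝ P.κ s ∧ DifferentiableAt ℝ P.σ s := by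
    filter_upwards [P.lipschitz_κ.ae_differentiableAt_real, P.lipschitz_σ.ae_differentiableAt_real]
      with s h1 h2
    exact ⟨h1, h2⟩
  exact Measure.quasiMeasurePreserving_fst.ae h

variable (ha : 0 < a) (hB : a * P.B ≤ 1 / 4)

theorem abs_f_le (ha : 0 < a) (hB : a * P.B ≤ 1 / 4) :
    ∀ᵐ p ∂(weighted P.f a), |P.f p| ≤ 3 / 2 :=
  ae_weighted_of_ae (Eventually.of_forall fun p hp => by
    rw [abs_of_nonneg (P.f_nonneg p)]
    exact (P.f_bounds_strip ha hB p hp).2)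

theorem abs_inv_f_le (ha : 0 < a) (hB : a * P.B ≤ 1 / 4) :
    ∀ᵐ p ∂(weighted P.f a), |(P.f p)⁻¹| ≤ 2 :=
  ae_weighted_of_ae (Eventually.of_forall fun p hp => by
    rw [abs_of_nonneg (inv_nonneg.2 (P.f_nonneg p))]
    exact (inv_anti₀ (by norm_num) (P.f_bounds_strip ha hB p hp).1).trans (by norm_num))

theorem ae_abs_m_le (ha : 0 < a) (hB : a * P.B ≤ 1 / 4) :
    ∀ᵐ p ∂(weighted P.f a), |P.m p| ≤ 2 * (a * P.B) :=
  ae_weighted_of_ae (Eventually.of_forall fun _ hp => abs_m_le ha hB (mem_strip.1 hp).le)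

/-- Multiplication by `f`. -/
def Mf : Lp ℂ 2 (weighted P.f a) →L[ℂ] Lp ℂ 2 (weighted P.f a) :=
  mulL P.measurable_f (P.abs_f_le ha hB)

/-- Multiplication by `1 / f`. -/
def Mi : Lp ℂ 2 (weighted P.f a) →L[ℂ] Lp ℂ 2 (weighted P.f a) :=
  mulL P.measurable_f.inv (P.abs_inv_f_le ha hB)

/-- Multiplication by `m`. -/
def Mm : Lp ℂ 2 (weighted P.f a) →L[ℂ] Lp ℂ 2 (weighted P.f a) :=
  mulL P.measurable_m (P.ae_abs_m_le ha hB)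

include ha in
theorem f_mul_mode (p : ℝ × ℝ) (hf : 0 < P.f p) :
    P.f p * P.mode a p = (√a)⁻¹ * (χ₁ (p.2 / a) * √(P.f p)) := by
  have h1 := Real.sqrt_pos.2 ha
  have h2 := Real.sqrt_pos.2 hf
  have h3 := Real.sq_sqrt hf.le
  rw [mode, Real.sqrt_mul ha.le]
  generalize √(P.f p) = r at h2 h3 ⊢
  rw [← h3]
  field_simp

include ha hB

/-- Since `f · mode = a^{-1/2} χ₁ √f`, the integrand is, up to this constant, the `s`-derivative of
the Lipschitz function `φ χ₁ q ψ`, whose support is compact; the term with `m` comes from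
differentiating `q`. -/
theorem integral_longitudinal {φ : ℝ → ℂ} (hφ : IsTest Set.univ φ) {ψ : ℝ × ℝ → ℂ}
    (hψ : IsTest (Ω₀ a) ψ) :
    ∫ p in Ω₀ a, P.f p • (deriv φ p.1 * (P.mode a p : ℝ) * ψ p +
      φ p.1 * (P.mode a p : ℝ) * (fderiv ℝ ψ p (1, 0) + P.m p * ψ p)) = 0 := by
  obtain ⟨C₁, M₁, h1⟩ := hφ.isBddLip
  obtain ⟨C₂, h2⟩ := exists_isBddLip_χ₁ ha
  obtain ⟨C₃, M₃, h3⟩ := P.exists_isBddLip_q ha hB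
  obtain ⟨C₄, M₄, h4⟩ := hψ.isBddLip
  have hΦ := ((h1.comp_fst.mul h2.ofReal.comp_snd).mul h3.ofReal).mul h4
  have hs : HasCompactSupport fun p : ℝ × ℝ =>
      φ p.1 * (χ₁ (p.2 / a) : ℂ) * (P.q a p : ℂ) * ψ p := hψ.2.1.mul_left
  have h0 := integral_fderiv_eq_zero hΦ.1 hs (1, 0)
  have hK : ∀ p ∉ tsupport ψ, ψ p = 0 := fun p hp => image_eq_zero_of_notMem_tsupport hp
  have hK' : ∀ p ∉ tsupport ψ, fderiv ℝ ψ p = 0 := fun p hp => fderiv_of_notMem_tsupport ℝ hp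
  rw [setIntegral_strip_eq fun p hp => by
    have : p ∉ tsupport ψ := fun h => hp (hψ.2.2 h)
    simp [hK p this, hK' p this]]
  rw [← mul_zero (((√a)⁻¹ : ℝ) : ℂ), ← h0, ← integral_const_mul]
  refine integral_congr_ae ?_
  filter_upwards [P.ae_differentiableAt] with p hp
  by_cases hpK : p ∈ tsupport ψ
  · have hpa := mem_strip.1 (hψ.2.2 hpK)
    obtain ⟨L, hL, hL1⟩ := P.hasFDerivAt_q ha hB hpa hp.1 hp.2
    have k1 := (hφ.1.differentiable (by simp) p.1).hasDerivAt.hasFDerivAt.comp p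
      (hasFDerivAt_fst (𝕜 := ℝ) (E := ℝ) (F := ℝ))
    have k2' : HasDerivAt (fun t => χ₁ (t / a))
        (-Real.sin (Real.pi / 2 * (p.2 / a)) * (Real.pi / 2 * (1 / a))) p.2 :=
      (Real.hasDerivAt_cos _).comp p.2 (((hasDerivAt_id p.2).div_const a).const_mul (Real.pi / 2))
    have k2 := k2'.ofReal_comp.hasFDerivAt.comp p (hasFDerivAt_snd (𝕜 := ℝ) (E := ℝ) (F := ℝ))
    have k3 := Complex.ofRealCLM.hasFDerivAt.comp p hL
    have k4 := (hψ.1.differentiable (by simp) p).hasFDerivAt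
    have k := ((k1.mul k2).mul k3).mul k4
    have e : fderiv ℝ (fun p : ℝ × ℝ => φ p.1 * (χ₁ (p.2 / a) : ℂ) * (P.q a p : ℂ) * ψ p) p (1, 0) =
        (deriv φ p.1 * ψ p + φ p.1 * (fderiv ℝ ψ p (1, 0) + P.m p * ψ p)) *
          ((χ₁ (p.2 / a) * √(P.f p) : ℝ) : ℂ) := by
      rw [HasFDerivAt.fderiv (f := fun p : ℝ × ℝ =>
        φ p.1 * (χ₁ (p.2 / a) : ℂ) * (P.q a p : ℂ) * ψ p) k]
      simp only [add_apply, smul_apply, ContinuousLinearMap.comp_apply, hL1, P.q_eq hpa.le]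
      simp [P.q_eq hpa.le]
      ring
    rw [e]
    have e2 := P.f_mul_mode ha p (P.f_pos ha hB p (hψ.2.2 hpK))
    have e3 : (P.f p : ℂ) * (P.mode a p : ℂ) =
        (((√a)⁻¹ : ℝ) : ℂ) * ((χ₁ (p.2 / a) * √(P.f p) : ℝ) : ℂ) := by
      rw [← Complex.ofReal_mul, e2, Complex.ofReal_mul]
    rw [Complex.real_smul]
    linear_combination (deriv φ p.1 * ψ p + φ p.1 * (fderiv ℝ ψ p (1, 0) + P.m p * ψ p)) * e3
  · rw [fderiv_of_notMem_tsupport ℝ fun h => hpK (tsupport_mul_subset_right h)]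
    simp [hK p hpK, hK' p hpK]

/-- The projection onto the first mode maps the form domain to the Sobolev space of the line. -/
theorem proj_mem_sobolevLine {x : Lp ℂ 2 (weighted P.f a) ×
      WithLp 2 (Lp ℂ 2 (weighted P.f a) × Lp ℂ 2 (weighted P.f a))}
    (hx : x ∈ testGradient P.f a) :
    (ContinuousLinearMap.adjoint (P.J ha hB).toContinuousLinearMap x.1,
      ContinuousLinearMap.adjoint (P.J ha hB).toContinuousLinearMap
        (P.Mf ha hB x.2.fst + P.Mm ha hB x.1)) ∈ sobolevLine := by
  obtain ⟨ψ, hψ, hx0, hx1, -⟩ := hx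
  intro φ hφ
  rw [integral_mul_eq_inner hφ.memLp, integral_mul_eq_inner hφ.deriv.memLp,
    ContinuousLinearMap.adjoint_inner_right, ContinuousLinearMap.adjoint_inner_right,
    ← add_eq_zero_iff_eq_neg]
  have hstar : ∀ {χ : ℝ → ℂ} (h : MemLp χ 2 (volume : Measure ℝ)),
      ∀ᵐ p ∂(weighted P.f a), P.J ha hB (star h.toLp) p = star (χ p.1) * (P.mode a p : ℝ) :=
    fun {χ} h => P.coeFn_J_of_eq ha hB (φ' := fun s => star (χ s)) (by
      filter_upwards [h.coeFn_toLp, Lp.coeFn_star h.toLp] with s h1 h2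
      rw [h2, Pi.star_apply, h1])
  rw [inner_eq_integral, inner_eq_integral,
    ← integral_add (integrable_conj_mul _ _) (integrable_conj_mul _ _)]
  rw [← P.integral_longitudinal ha hB hφ hψ, ← integral_weighted P.measurable_f P.f_nonneg]
  refine integral_congr_ae ?_
  filter_upwards [hx0, hx1, hstar hφ.memLp, hstar hφ.deriv.memLp,
    Lp.coeFn_add (P.Mf ha hB x.2.fst) (P.Mm ha hB x.1),
    coeFn_mulL P.measurable_f (P.abs_f_le ha hB) x.2.fst,
    coeFn_mulL P.measurable_m (P.ae_abs_m_le ha hB) x.1,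
    ae_weighted_of_ae (f := P.f) (a := a) (Eventually.of_forall (P.f_pos ha hB))]
    with p h1 h2 h3 h4 h5 h6 h7 h8
  have h9 : (P.f p : ℂ) ≠ 0 := Complex.ofReal_ne_zero.2 h8.ne'
  simp only [LinearIsometry.coe_toContinuousLinearMap]
  rw [h3, h4, h5, Pi.add_apply, Mf, Mm, h6, h7, h1, h2]
  simp only [Complex.star_def, map_mul, Complex.conj_conj, Complex.conj_ofReal]
  push_cast
  -- The longitudinal gradient component is `f⁻¹ ∂₁ψ`, and `Mf` removes the inverse.
  rw [mul_inv_cancel_left₀ h9]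

end Profile

end QuantumStrip

/-! ### `J` maps test functions into the form domain -/

namespace QuantumStrip

open Filter Topology

namespace Profile

variable (P : Profile) {a : ℝ} (ha : 0 < a) (hB : a * P.B ≤ 1 / 4)

/-- The function `φ ⊗ mode`, extended by zero. -/
def tensorMode (a : ℝ) (φ : ℝ → ℂ) (p : ℝ × ℝ) : ℂ := φ p.1 * (P.mode a p : ℝ)

/-- The truncations of `φ ⊗ mode` with compact support in the strip. -/
def truncMode (a : ℝ) (φ : ℝ → ℂ) (m : ℕ) (p : ℝ × ℝ) : ℂ :=
  φ p.1 * (((√a)⁻¹ * (P.q a p)⁻¹ * max (cutMode a p.2 - 1 / (m + 1)) 0 : ℝ) : ℂ)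

include ha hB

omit hB in
theorem tensorMode_eq {p : ℝ × ℝ} (hp : |p.2| ≤ a) (φ : ℝ → ℂ) :
    P.tensorMode a φ p = φ p.1 * (((√a)⁻¹ * (P.q a p)⁻¹ * cutMode a p.2 : ℝ) : ℂ) := by
  rw [tensorMode, mode, P.q_eq hp, cutMode, clamp_of_abs_le hp, Real.sqrt_mul ha.le,
    div_eq_mul_inv, mul_inv]
  congr 2
  ring

/-- The constants do not depend on `m`: lowering the cosine by `1/(m+1)` and taking the positive
part gives compact support in the open strip without increasing the Lipschitz constant, which a
multiplicative cutoff would not achieve so directly. -/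
theorem exists_truncMode_bdd {φ : ℝ → ℂ} (hφ : IsTest Set.univ φ) :
    ∃ C M, ∀ m, IsBddLip C M (P.truncMode a φ m) := by
  obtain ⟨C₁, M₁, h1⟩ := hφ.isBddLip
  obtain ⟨C₂, h2⟩ := exists_isBddLip_cutMode ha
  obtain ⟨C₃, M₃, h3⟩ := P.exists_isBddLip_q ha hB
  have hcut : ∀ m : ℕ, IsBddLip C₂ 1 fun t => max (cutMode a t - 1 / (m + 1)) 0 := fun m => by
    refine ⟨?_, fun t => ?_⟩
    · have := (h2.1.sub (LipschitzWith.const (1 / ((m : ℝ) + 1)))).max_const 0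
      rwa [add_zero] at this
    · have h4 := h2.2 t
      rw [Real.norm_of_nonneg (cutMode_nonneg ha t)] at h4
      rw [Real.norm_of_nonneg (le_max_right _ _)]
      have h5 : (0 : ℝ) ≤ 1 / (m + 1) := by positivity
      exact max_le (by linarith) (by simp)
  exact ⟨_, _, fun m => h1.comp_fst.mul
    (((IsBddLip.const _).mul (h3.inv (P.le_q ha hB))).mul (hcut m).comp_snd).ofReal⟩

omit ha hB in
theorem truncMode_eq_zero (φ : ℝ → ℂ) (m : ℕ) {p : ℝ × ℝ}
    (hp : p ∉ tsupport φ ×ˢ {t | 1 / ((m : ℝ) + 1) ≤ cutMode a t}) : P.truncMode a φ m p = 0 := by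
  by_cases h1 : p.1 ∈ tsupport φ
  · have h2 : cutMode a p.2 - 1 / ((m : ℝ) + 1) ≤ 0 := by
      by_contra h
      exact hp ⟨h1, by
        rw [Set.mem_ofPred_eq]
        linarith⟩
    rw [truncMode, max_eq_right h2]
    simp
  · rw [truncMode, image_eq_zero_of_notMem_tsupport h1, zero_mul]

omit hB in
theorem tsupport_truncMode_subset (φ : ℝ → ℂ) (m : ℕ) :
    tsupport (P.truncMode a φ m) ⊆ tsupport φ ×ˢ Set.Ioo (-a) a := by
  obtain ⟨C₂, h2⟩ := exists_isBddLip_cutMode ha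
  have hcl : IsClosed (tsupport φ ×ˢ {t | 1 / ((m : ℝ) + 1) ≤ cutMode a t}) :=
    (isClosed_tsupport φ).prod (isClosed_le continuous_const h2.1.continuous)
  refine (closure_minimal (fun p hp => ?_) hcl).trans (Set.prod_mono le_rfl fun t ht => ?_)
  · by_contra h
    exact hp (P.truncMode_eq_zero φ m h)
  · have h3 : (0 : ℝ) < 1 / (m + 1) := by positivity
    by_contra h
    have h4 : a ≤ |t| := by
      by_contra h5
      exact h (abs_lt.1 (not_le.1 h5))
    rw [Set.mem_ofPred_eq, cutMode_eq_zero ha h4] at ht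
    linarith

omit ha hB in
theorem hasFDerivAt_comp_fst {φ : ℝ → ℂ} (hφ : IsTest Set.univ φ) (p : ℝ × ℝ) :
    HasFDerivAt (fun p : ℝ × ℝ => φ p.1)
      ((ContinuousLinearMap.toSpanSingleton ℝ (deriv φ p.1)).comp
        (ContinuousLinearMap.fst ℝ ℝ ℝ)) p :=
  (hφ.1.differentiable (by simp) p.1).hasDerivAt.hasFDerivAt.comp p hasFDerivAt_fst

/-- In `s` the mode is proportional to `1/q`, hence the sign of `m`; in `t` its logarithmic
derivative is `β`. The first conclusion concerns the factor without the cosine, which measures the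
effect of the truncation. -/
theorem hasFDerivAt_tensorMode {φ : ℝ → ℂ} (hφ : IsTest Set.univ φ) {p : ℝ × ℝ} (hp : |p.2| < a)
    (hκ : DifferentiableAt ℝ P.κ p.1) (hσ : DifferentiableAt ℝ P.σ p.1) :
    DifferentiableAt ℝ (fun p => φ p.1 * (((√a)⁻¹ * (P.q a p)⁻¹ : ℝ) : ℂ)) p ∧
    ∃ L : ℝ × ℝ →L[ℝ] ℂ, HasFDerivAt (P.tensorMode a φ) L p ∧
      L (1, 0) = (deriv φ p.1 - P.m p * φ p.1) * (P.mode a p : ℝ) ∧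
      L (0, 1) = (P.β a p : ℂ) * P.tensorMode a φ p := by
  obtain ⟨L, hL, hL1⟩ := P.hasFDerivAt_q ha hB hp hκ hσ
  have hq := P.le_q ha hB p
  have k1 := hasFDerivAt_comp_fst hφ p
  have k3 := ((hasDerivAt_inv (by linarith : P.q a p ≠ 0)).comp_hasFDerivAt p hL).const_mul (√a)⁻¹
  have k2 : HasDerivAt (fun t => χ₁ (t / a))
      (-Real.sin (Real.pi / 2 * (p.2 / a)) * (Real.pi / 2 * (1 / a))) p.2 :=
    (Real.hasDerivAt_cos _).comp p.2 (((hasDerivAt_id p.2).div_const a).const_mul (Real.pi / 2))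
  have k2' := k2.comp_hasFDerivAt p (hasFDerivAt_snd (𝕜 := ℝ) (E := ℝ) (F := ℝ))
  have k4 := Complex.ofRealCLM.hasFDerivAt.comp p (k3.mul k2')
  have k := k1.mul k4
  have hev : P.tensorMode a φ =ᶠ[𝓝 p] fun p =>
      φ p.1 * (((√a)⁻¹ * (P.q a p)⁻¹ * χ₁ (p.2 / a) : ℝ) : ℂ) := by
    filter_upwards [(isOpen_strip a).mem_nhds (mem_strip.2 hp)] with r hr
    have hr' := (mem_strip.1 hr).le
    rw [P.tensorMode_eq ha hr', cutMode, clamp_of_abs_le hr']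
  have k' := k.congr_of_eventuallyEq hev
  refine ⟨(k1.mul (Complex.ofRealCLM.hasFDerivAt.comp p k3)).differentiableAt, _, k', ?_, ?_⟩
  · have e : P.mode a p = (√a)⁻¹ * (P.q a p)⁻¹ * χ₁ (p.2 / a) := by
      rw [mode, P.q_eq hp.le, Real.sqrt_mul ha.le, div_eq_mul_inv, mul_inv]
      ring
    have hq0 : (P.q a p : ℂ) ≠ 0 := Complex.ofReal_ne_zero.2 (by linarith)
    have ha0 : ((√a : ℝ) : ℂ) ≠ 0 := Complex.ofReal_ne_zero.2 (Real.sqrt_pos.2 ha).ne'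
    rw [e]
    simp [hL1]
    field_simp
    ring
  · have h1 : HasDerivAt (fun t : ℝ => (p.1, t)) ((0 : ℝ), (1 : ℝ)) p.2 :=
      (hasDerivAt_const p.2 p.1).prodMk (hasDerivAt_id p.2)
    have h2 := k'.comp_hasDerivAt p.2 h1
    have h3 := ((hasDerivAt_mode_snd (P := P) (s := p.1) ha hB hp).ofReal_comp).const_mul (φ p.1)
    rw [h2.unique h3, tensorMode]
    push_cast
    ring

/-- The cosine is bounded below by a positive number near an interior point, so for large `m` the
truncation there is `φ ⊗ mode` minus `1/(m+1)` times a fixed differentiable function. -/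
theorem tendsto_fderiv_truncMode {φ : ℝ → ℂ} (hφ : IsTest Set.univ φ) {p : ℝ × ℝ}
    (hp : |p.2| < a) (hκ : DifferentiableAt ℝ P.κ p.1) (hσ : DifferentiableAt ℝ P.σ p.1) :
    Tendsto (fun m => fderiv ℝ (P.truncMode a φ m) p) atTop
      (𝓝 (fderiv ℝ (P.tensorMode a φ) p)) := by
  obtain ⟨h1, L, hL, -⟩ := P.hasFDerivAt_tensorMode ha hB hφ hp hκ hσ
  set g : ℝ × ℝ → ℂ := fun p => φ p.1 * (((√a)⁻¹ * (P.q a p)⁻¹ : ℝ) : ℂ) with hg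
  obtain ⟨C₂, h2⟩ := exists_isBddLip_cutMode ha
  have hc : 0 < cutMode a p.2 := by
    rw [cutMode, clamp_of_abs_le hp.le]
    exact cos_pos ha hp
  have hnhds : ∀ᶠ r : ℝ × ℝ in 𝓝 p, cutMode a p.2 / 2 < cutMode a r.2 :=
    (h2.1.continuous.comp continuous_snd).continuousAt.eventually_const_lt
      (by simpa using half_lt_self hc)
  have hlim : Tendsto (fun m : ℕ => 1 / ((m : ℝ) + 1)) atTop (𝓝 0) :=
    tendsto_one_div_add_atTop_nhds_zero_nat
  have hm : ∀ᶠ m : ℕ in atTop, fderiv ℝ (P.truncMode a φ m) p =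
      fderiv ℝ (P.tensorMode a φ) p - (1 / ((m : ℝ) + 1)) • fderiv ℝ g p := by
    filter_upwards [hlim.eventually_lt_const (half_pos hc)] with m hm
    have hev : P.truncMode a φ m =ᶠ[𝓝 p] fun r =>
        P.tensorMode a φ r - (1 / ((m : ℝ) + 1)) • g r := by
      filter_upwards [hnhds, (isOpen_strip a).mem_nhds (mem_strip.2 hp)] with r hr1 hr2
      rw [truncMode, max_eq_left (by linarith), P.tensorMode_eq ha (mem_strip.1 hr2).le, hg,
        Complex.real_smul]
      push_cast
      ring
    rw [hev.fderiv_eq]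
    exact (hL.differentiableAt.hasFDerivAt.sub (h1.hasFDerivAt.const_smul (1 / ((m : ℝ) + 1)))).fderiv
  have hlim2 : Tendsto (fun m : ℕ => fderiv ℝ (P.tensorMode a φ) p -
      (1 / ((m : ℝ) + 1)) • fderiv ℝ g p) atTop (𝓝 (fderiv ℝ (P.tensorMode a φ) p)) := by
    have h := (hlim.smul_const (fderiv ℝ g p)).const_sub (fderiv ℝ (P.tensorMode a φ) p)
    have h0 : fderiv ℝ (P.tensorMode a φ) p - (0 : ℝ) • fderiv ℝ g p =
        fderiv ℝ (P.tensorMode a φ) p :=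
      (congrArg _ (zero_smul ℝ (fderiv ℝ g p))).trans (sub_zero _)
    exact h.trans_eq (congrArg 𝓝 h0)
  exact hlim2.congr' (hm.mono fun m h => h.symm)

/-- Inside the strip the support of `φ ⊗ mode` reaches up to the boundary, so mollification alone
does not apply; the truncations are Lipschitz with compact support in the open strip and converge
boundedly. -/
theorem hasGradient_tensorMode {φ : ℝ → ℂ} (hφ : IsTest Set.univ φ) :
    HasGradient P.f a (P.tensorMode a φ) := by
  obtain ⟨C, M, hCM⟩ := P.exists_truncMode_bdd ha hB hφ
  have hK : IsCompact (tsupport φ ×ˢ Set.Icc (-a) a) := hφ.2.1.isCompact.prod isCompact_Icc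
  have hsub := fun m => P.tsupport_truncMode_subset ha φ m
  have hsubK : ∀ m, tsupport (P.truncMode a φ m) ⊆ tsupport φ ×ˢ Set.Icc (-a) a := fun m =>
    (hsub m).trans (Set.prod_mono le_rfl Set.Ioo_subset_Icc_self)
  refine HasGradient.of_tendsto (v := P.truncMode a φ) (c := 1 / 2) (b := 3 / 2) (by norm_num)
    (P.f_bounds_strip ha hB)
    (fun m => LipschitzWith.hasGradient P.measurable_f (c := 1 / 2) (b := 3 / 2) (by norm_num)
      (P.f_bounds_strip ha hB) (hCM m).1
      (hK.of_isClosed_subset (isClosed_tsupport _) (hsubK m))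
      ((hsub m).trans (Set.prod_mono (Set.subset_univ _) le_rfl))) hK
    (fun m p _ hp => ?_) (L := max M C) (fun m p _ => ⟨?_, ?_⟩) ?_ ?_
  · have hp' : p ∉ tsupport (P.truncMode a φ m) := fun h => hp (hsubK m h)
    exact ⟨image_eq_zero_of_notMem_tsupport hp', fderiv_of_notMem_tsupport ℝ hp'⟩
  · exact ((hCM m).2 p).trans (le_max_left _ _)
  · exact (norm_fderiv_le_of_lipschitz ℝ (hCM m).1).trans (le_max_right _ _)
  · refine Eventually.of_forall fun p hp => ?_
    have hlim : Tendsto (fun m : ℕ => 1 / ((m : ℝ) + 1)) atTop (𝓝 0) :=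
      tendsto_one_div_add_atTop_nhds_zero_nat
    have h1 := (hlim.const_sub (cutMode a p.2)).max (tendsto_const_nhds (x := (0 : ℝ)))
    rw [sub_zero, max_eq_left (cutMode_nonneg ha p.2)] at h1
    rw [P.tensorMode_eq ha (mem_strip.1 hp).le]
    exact ((Complex.continuous_ofReal.tendsto _).comp (h1.const_mul _)).const_mul _
  · filter_upwards [P.ae_differentiableAt] with p hp hpa
    exact P.tendsto_fderiv_truncMode ha hB hφ (mem_strip.1 hpa) hp.1 hp.2

/-- The mode is an exact weak solution of the transverse eigenvalue equation with right-hand side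
`E₁ + V`: in `integral_green` with `w = φ ⊗ mode` and `∂₂w = βw`, the terms in `β²` cancel. -/
theorem integral_transversal {φ : ℝ → ℂ} (hφ : IsTest Set.univ φ) {ψ : ℝ × ℝ → ℂ}
    (hψ : IsTest (Ω₀ a) ψ) :
    ∫ p, (P.f p : ℂ) * (star (fderiv ℝ ψ p (0, 1)) * ((P.β a p : ℂ) * P.tensorMode a φ p)) =
      E₁ a * (∫ p, (P.f p : ℂ) * (star (ψ p) * P.tensorMode a φ p)) +
      ∫ p, (P.f p : ℂ) * (star (ψ p) * (P.V p * P.tensorMode a φ p)) := by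
  have hβ := Complex.continuous_ofReal.comp_continuousOn (P.continuousOn_β ha hB)
  have hV := Complex.continuous_ofReal.comp_continuousOn (P.continuousOn_V ha hB)
  have hf := (Complex.continuous_ofReal.comp P.continuous_f).continuousOn (s := Ω₀ a)
  have hψc := hψ.1.continuous.continuousOn (s := Ω₀ a)
  have hψd := (hψ.continuous_fderiv_apply (0, 1)).continuousOn (s := Ω₀ a)
  have hη : ContinuousOn (P.tensorMode a φ) (Ω₀ a) := by
    obtain ⟨C₂, h2⟩ := exists_isBddLip_χ₁ ha
    have h3 := h2.1.continuous
    have h4 := P.continuous_f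
    have h5 := hφ.1.continuous
    intro p hp
    have h6 : √(a * P.f p) ≠ 0 := (Real.sqrt_pos.2 (mul_pos ha (P.f_pos ha hB p hp))).ne'
    have h7 : ContinuousAt (P.mode a) p :=
      ContinuousAt.div (f := fun p : ℝ × ℝ => χ₁ (p.2 / a)) (g := fun p => √(a * P.f p))
        (h3.comp continuous_snd).continuousAt (by fun_prop) h6
    exact ((h5.comp continuous_fst).continuousAt.mul
      (Complex.continuous_ofReal.continuousAt.comp h7)).continuousWithinAt
  have hK : ∀ p ∉ tsupport ψ, ψ p = 0 := fun p hp => image_eq_zero_of_notMem_tsupport hp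
  have hK' : ∀ p ∉ tsupport ψ, fderiv ℝ ψ p = 0 := fun p hp => fderiv_of_notMem_tsupport ℝ hp
  have i1 := continuous_of_strip
    (g := fun p => (P.f p : ℂ) * (star (fderiv ℝ ψ p (0, 1)) *
      ((P.β a p : ℂ) * P.tensorMode a φ p)))
    (hf.mul (hψd.star.mul (hβ.mul hη))) hψ.2.1 hψ.2.2 (fun p hp => by simp [hK' p hp])
  have i2 := continuous_of_strip
    (g := fun p => (P.f p : ℂ) * (star (ψ p) * P.tensorMode a φ p))
    (hf.mul (hψc.star.mul hη)) hψ.2.1 hψ.2.2 (fun p hp => by simp [hK p hp])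
  have i3 := continuous_of_strip
    (g := fun p => (P.f p : ℂ) * (star (ψ p) * (P.V p * P.tensorMode a φ p)))
    (hf.mul (hψc.star.mul (hV.mul hη))) hψ.2.1 hψ.2.2 (fun p hp => by simp [hK p hp])
  have j1 := i1.1.integrable_of_hasCompactSupport (μ := volume) i1.2
  have j2 := i2.1.integrable_of_hasCompactSupport (μ := volume) i2.2
  have j3 := i3.1.integrable_of_hasCompactSupport (μ := volume) i3.2
  have key := P.integral_green ha hB hψ hη (w' := fun p => (P.β a p : ℂ) * P.tensorMode a φ p)
    (hβ.mul hη) fun s t ht => by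
      have h3 := ((hasDerivAt_mode_snd (P := P) (s := s) ha hB ht).ofReal_comp).const_mul (φ s)
      refine h3.congr_deriv ?_
      rw [tensorMode]
      push_cast
      ring
  have j4 : Integrable (fun p => (E₁ a : ℂ) * ((P.f p : ℂ) * (star (ψ p) * P.tensorMode a φ p)) +
      (P.f p : ℂ) * (star (ψ p) * (P.V p * P.tensorMode a φ p))) volume := (j2.const_mul _).add j3
  rw [← sub_eq_zero, ← key, ← integral_const_mul, ← integral_add (j2.const_mul _) j3,
    ← integral_sub j1 j4]
  refine integral_congr_ae (Eventually.of_forall fun p => ?_)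
  push_cast
  ring

/-- Products of test functions with the transverse ground state belong to the form domain. -/
theorem exists_gradient_J {y : L2Line × L2Line} (hy : y ∈ testLine) :
    ∃ g, (P.J ha hB y.1, g) ∈ (testGradient P.f a).topologicalClosure ∧
      g.fst = P.Mi ha hB (P.J ha hB y.2) - P.Mi ha hB (P.Mm ha hB (P.J ha hB y.1)) ∧
      ∀ x ∈ testGradient P.f a, inner ℂ x.2.snd g.snd =
        (E₁ a : ℂ) * inner ℂ x.1 (P.J ha hB y.1) +
          inner ℂ x.1 (P.MV ha hB (P.J ha hB y.1)) := by
  obtain ⟨φ, hφ, h0, h1⟩ := hy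
  obtain ⟨⟨w, g⟩, hw, hw0, hw1, hw2⟩ := P.hasGradient_tensorMode ha hB hφ
  have j0 := P.coeFn_J_of_eq ha hB h0
  have j1 := P.coeFn_J_of_eq ha hB h1
  have hwJ : w = P.J ha hB y.1 := by
    refine Lp.ext ?_
    filter_upwards [hw0, j0] with p h2 h3
    rw [h3]
    exact h2
  subst hwJ
  have hd : ∀ᵐ p ∂(weighted P.f a),
      fderiv ℝ (P.tensorMode a φ) p (1, 0) = (deriv φ p.1 - P.m p * φ p.1) * (P.mode a p : ℝ) ∧
      fderiv ℝ (P.tensorMode a φ) p (0, 1) = (P.β a p : ℂ) * P.tensorMode a φ p :=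
    ae_weighted_of_ae (by
      filter_upwards [P.ae_differentiableAt] with p hp hpa
      obtain ⟨-, L, hL, h2, h3⟩ :=
        P.hasFDerivAt_tensorMode ha hB hφ (mem_strip.1 hpa) hp.1 hp.2
      rw [hL.fderiv]
      exact ⟨h2, h3⟩)
  refine ⟨g, hw, ?_, fun x hx => ?_⟩
  · refine Lp.ext ?_
    filter_upwards [hw1, hd, j0, j1,
      Lp.coeFn_sub (P.Mi ha hB (P.J ha hB y.2)) (P.Mi ha hB (P.Mm ha hB (P.J ha hB y.1))),
      coeFn_mulL P.measurable_f.inv (P.abs_inv_f_le ha hB) (P.J ha hB y.2),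
      coeFn_mulL P.measurable_f.inv (P.abs_inv_f_le ha hB) (P.Mm ha hB (P.J ha hB y.1)),
      coeFn_mulL P.measurable_m (P.ae_abs_m_le ha hB) (P.J ha hB y.1)]
      with p k1 k2 k3 k4 k5 k6 k7 k8
    rw [k5, Pi.sub_apply, Mi, k6, k7, Mm, k8, k3, k4]
    refine Eq.trans k1 ?_
    rw [k2.1, Pi.inv_apply]
    ring
  · obtain ⟨ψ, hψ, hx0, -, hx2⟩ := hx
    have z0 : ∀ p ∉ Ω₀ a, ψ p = 0 := fun p hp =>
      image_eq_zero_of_notMem_tsupport fun h => hp (hψ.2.2 h)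
    have z1 : ∀ p ∉ Ω₀ a, fderiv ℝ ψ p (0, 1) = 0 := fun p hp => by
      rw [fderiv_of_notMem_tsupport ℝ fun h => hp (hψ.2.2 h)]
      rfl
    have hg : ∀ᵐ p ∂(weighted P.f a), g.snd p = (P.β a p : ℂ) * P.tensorMode a φ p := by
      filter_upwards [hw2, hd] with p k1 k2
      exact k1.trans k2.2
    have hV : ∀ᵐ p ∂(weighted P.f a), P.MV ha hB (P.J ha hB y.1) p =
        (P.V p : ℂ) * P.tensorMode a φ p := by
      filter_upwards [coeFn_mulL P.measurable_V (P.abs_V_le ha hB) (P.J ha hB y.1), hw0]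
        with p k1 k2
      rw [MV, k1]
      exact congrArg _ k2
    rw [P.inner_eq_of_ae hx2 hg z1, P.inner_eq_of_ae hx0 hw0 z0, P.inner_eq_of_ae hx0 hV z0]
    exact P.integral_transversal ha hB hφ hψ

end Profile

end QuantumStrip

/-! ### Quantitative resolvent estimates and the choice of constants -/

namespace QuantumStrip

open Filter Topology

namespace Profile

variable (P : Profile) {a : ℝ}

/-- The transported Dirichlet Laplacian of the strip. -/
def Hhat {a : ℝ} (ha : 0 < a) : L2Strip →ₗ.[ℂ] L2Strip :=
  transport (unitaryTransform P.measurable_f ha)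
    (energyOperator (testGradient P.f a).topologicalClosure)

variable (ha : 0 < a) (hB : a * P.B ≤ 1 / 4)
include ha hB

/-- Used twice: at `E₁ + z`, where the lower bound comes from the spectral analysis above, and at a
negative `z`, where positivity of the form is enough. -/
theorem exists_strip_resolvent {c lam : ℝ} (hc : 0 < c)
    (h : ∀ x ∈ testGradient P.f a, c * ‖x.1‖ ^ 2 ≤ ‖x.2‖ ^ 2 - lam * ‖x.1‖ ^ 2) :
    ∃ R, IsFormResolvent (testGradient P.f a).topologicalClosure
        ((0 : Lp ℂ 2 (weighted P.f a) →L[ℂ] Lp ℂ 2 (weighted P.f a)) -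
          (lam : ℂ) • ContinuousLinearMap.id ℂ (Lp ℂ 2 (weighted P.f a))) R ∧
      IsResolventAt (P.Hhat ha) lam
        (directSumZero (unitaryTransform P.measurable_f ha) R) := by
  have h' := forall_mem_closure_le (by fun_prop) (by fun_prop) h
  have hW : ∀ x ∈ (testGradient P.f a).topologicalClosure, c * ‖x.1‖ ^ 2 ≤ ‖x.2‖ ^ 2 +
      (inner ℂ x.1 (((0 : Lp ℂ 2 (weighted P.f a) →L[ℂ] Lp ℂ 2 (weighted P.f a)) -
          (lam : ℂ) • ContinuousLinearMap.id ℂ (Lp ℂ 2 (weighted P.f a))) x.1)).re := fun x hx => by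
    refine (h' x hx).trans_eq ?_
    rw [sub_apply, zero_apply, smul_apply, ContinuousLinearMap.id_apply, zero_sub, inner_neg_right,
      inner_smul_right, Complex.neg_re, Complex.re_ofReal_mul, re_inner_self]
    ring
  obtain ⟨R, hR⟩ := exists_isFormResolvent _
    (testGradient P.f a).isClosed_topologicalClosure _ hc hW
  refine ⟨R, hR, isResolventAt_transport (hR.isResolventAt hc hW fun x => ?_) _
    (unitaryTransform_surjective P.measurable_f ha (P.f_pos ha hB))⟩
  rw [mem_graph_energyOperator fun w hw => testGradient_dense P.measurable_f (c := 1 / 2)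
    (b := 3 / 2) (by norm_num) (P.f_bounds_strip ha hB) w hw, zero_apply, sub_zero]

theorem norm_Mi_sub_Mf_le : ‖P.Mi ha hB - P.Mf ha hB‖ ≤ 5 * (a * P.B) := by
  refine ContinuousLinearMap.opNorm_le_bound _ (by positivity) fun ψ =>
    Lp.norm_le_mul_norm_of_ae_le_mul ?_
  filter_upwards [coeFn_mulL P.measurable_f.inv (P.abs_inv_f_le ha hB) ψ,
    coeFn_mulL P.measurable_f (P.abs_f_le ha hB) ψ, Lp.coeFn_sub (P.Mi ha hB ψ) (P.Mf ha hB ψ),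
    ae_weighted_of_ae (f := P.f) (a := a) (Q := fun p => |(P.f p)⁻¹ - P.f p| ≤ 5 * (a * P.B))
      (Eventually.of_forall fun p hp => abs_inv_f_sub_f_le ha hB (mem_strip.1 hp).le)]
    with p h1 h2 h3 h4
  rw [sub_apply, h3, Pi.sub_apply, Mi, Mf, h1, h2, Pi.inv_apply, ← sub_mul, norm_mul,
    ← Complex.ofReal_sub, Complex.norm_real, Real.norm_eq_abs]
  gcongr

theorem norm_Mm_le : ‖P.Mm ha hB‖ ≤ 2 * (a * P.B) :=
  norm_mulL_le _ _ (by positivity) (P.ae_abs_m_le ha hB)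

theorem norm_Mi_le : ‖P.Mi ha hB‖ ≤ 2 :=
  norm_mulL_le _ _ (by norm_num) (P.abs_inv_f_le ha hB)

omit ha hB in
theorem ae_abs_Veff_le : ∀ᵐ s : ℝ, |P.Veff s| ≤ P.B ^ 2 := Eventually.of_forall P.abs_Veff_le

theorem norm_MV_sub_le (y : L2Line) : ‖P.MV ha hB (P.J ha hB y) -
    P.J ha hB (mulL P.continuous_Veff.measurable P.ae_abs_Veff_le y)‖ ≤
      50 * (a * P.B ^ 3) * ‖y‖ := by
  rw [← (P.J ha hB).norm_map y]
  refine Lp.norm_le_mul_norm_of_ae_le_mul ?_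
  filter_upwards [coeFn_mulL P.measurable_V (P.abs_V_le ha hB) (P.J ha hB y),
    P.coeFn_J_of_eq ha hB (coeFn_mulL P.continuous_Veff.measurable P.ae_abs_Veff_le y),
    P.coeFn_J ha hB y, Lp.coeFn_sub (P.MV ha hB (P.J ha hB y))
      (P.J ha hB (mulL P.continuous_Veff.measurable P.ae_abs_Veff_le y)),
    ae_weighted_of_ae (f := P.f) (a := a)
      (Q := fun p => |P.V p - P.Veff p.1| ≤ 50 * (a * P.B ^ 3))
      (Eventually.of_forall fun p hp => abs_V_sub_Veff_le ha hB (mem_strip.1 hp).le)]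
    with p h1 h2 h3 h4 h5
  have e : (P.V p : ℂ) * (y p.1 * (P.mode a p : ℝ)) - P.Veff p.1 * y p.1 * (P.mode a p : ℝ) =
      ((P.V p - P.Veff p.1 : ℝ) : ℂ) * (y p.1 * (P.mode a p : ℝ)) := by
    push_cast
    ring
  rw [h4, Pi.sub_apply, MV, h1, h2, h3, e, norm_mul, Complex.norm_real, Real.norm_eq_abs]
  gcongr

/-- Comparison of the resolvents of the strip and of the effective operator. -/
theorem norm_strip_resolvent_sub_le {v z c : ℝ} (hv : ∀ s, v ≤ P.Veff s) (hc : 0 < c)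
    (hc1 : c ≤ 1) (hcz : c + z ≤ v - 50 * (a * P.B ^ 3)) {Re : L2Line →L[ℂ] L2Line}
    (hRe : IsFormResolvent sobolevLine (mulL P.continuous_Veff.measurable P.ae_abs_Veff_le -
      (z : ℂ) • ContinuousLinearMap.id ℂ L2Line) Re)
    (hlow : ∀ x, c * ‖x‖ ^ 2 ≤ (inner ℂ x ((mulL P.continuous_Veff.measurable P.ae_abs_Veff_le -
      (z : ℂ) • ContinuousLinearMap.id ℂ L2Line) x)).re) :
    ∃ R, IsResolventAt (P.Hhat ha) ((E₁ a + z : ℝ) : ℂ) R ∧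
      ‖R - directSumZero modeEmbedding Re‖ ≤ (200 * P.B ^ 3 / c ^ 2 + 2 / c) * a := by
  have h1 := fun x hx => P.energy_lower_bound ha hB hv hcz (x := x) hx
  obtain ⟨R, hR, hR'⟩ := P.exists_strip_resolvent ha hB (lam := E₁ a + z) hc fun x hx => by
    refine le_trans ?_ (h1 x hx)
    have h2 : 0 ≤ (2 * a ^ 2)⁻¹ * ‖x.1 - P.J ha hB
      (ContinuousLinearMap.adjoint (P.J ha hB).toContinuousLinearMap x.1)‖ ^ 2 := by positivity
    linarith [sq_nonneg ‖x.2.fst‖]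
  refine ⟨_, hR', ?_⟩
  have hB1 : (1 : ℝ) ≤ P.B := P.one_le
  have hB3 : a * P.B ≤ a * (P.B : ℝ) ^ 3 := by
    gcongr
    exact le_self_pow₀ hB1 (by norm_num)
  have hB0 : 0 ≤ a * (P.B : ℝ) := by positivity
  have hε : 0 ≤ 50 * (a * (P.B : ℝ) ^ 3) := by positivity
  -- Here `ε = 50 a B³`, the error in the potential; as `B ≥ 1` it dominates the bounds `5aB`, `2aB`
  -- and `4aB` of the other operators.
  have key := norm_formResolvent_sub_le sobolevLine_le_closure isClosed_sobolevLine (P.J ha hB)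
    (Mf := P.Mf ha hB) (Mi := P.Mi ha hB) (Mm := P.Mm ha hB) (MV := P.MV ha hB) hc hc1 hε ha
    hR hRe hlow (inner_mulL _ _) (inner_mulL _ _) h1
    (fun x hx => P.proj_mem_sobolevLine ha hB hx) (fun y hy => P.exists_gradient_J ha hB hy)
    ((P.norm_Mi_sub_Mf_le ha hB).trans (by linarith))
    ((P.norm_Mm_le ha hB).trans (by linarith))
    ((ContinuousLinearMap.opNorm_comp_le _ _).trans
      ((mul_le_mul (P.norm_Mi_le ha hB) (P.norm_Mm_le ha hB) (norm_nonneg _) zero_le_two).trans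
        (by linarith)))
    (P.norm_MV_sub_le ha hB)
  -- Both resolvents on `L²(Π)` are conjugates by the same isometry of operators on the weighted
  -- space, so the norm of their difference does not grow.
  have hJ : modeEmbedding = (unitaryTransform P.measurable_f ha).comp (P.J ha hB) :=
    LinearIsometry.ext fun φ => (P.unitaryTransform_J ha hB φ).symm
  rw [hJ, directSumZero_comp, ← directSumZero_sub]
  refine (norm_directSumZero_le _ _).trans (key.trans_eq ?_)
  ring

omit ha hB in
/-- The thin strip limit. -/
theorem thin_limit {v z : ℝ} (hv : ∀ s, v ≤ P.Veff s) (hz : z < 0) (hzv : z < v) :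
    ∃ Re, IsResolventAt (lineLaplacian + mulOperator P.Veff) z Re ∧
      ∃ a₀ : ℝ, 0 < a₀ ∧ a₀ * P.B ≤ 1 / 4 ∧ ∃ C : ℝ, 0 < C ∧ ∀ (a : ℝ) (ha : 0 < a), a ≤ a₀ →
        (z : ℂ) ∈ resSet (P.Hhat ha) ∧
        ∃ R, IsResolventAt (P.Hhat ha) ((E₁ a + z : ℝ) : ℂ) R ∧
          ‖R - directSumZero modeEmbedding Re‖ ≤ C * a := by
  have hB1 : (1 : ℝ) ≤ P.B := P.one_le
  -- Half of the distance `v - z` serves as coercivity constant, the other half absorbs the error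
  -- `50 a B³`; hence the two entries in the minimum defining `a₀`, the first of which ensures `aB ≤
  -- 1/4`. The cap at 1 is demanded by the comparison.
  set c := min ((v - z) / 2) 1 with hcdef
  have hc : 0 < c := lt_min (by linarith) one_pos
  have hc2 : c ≤ (v - z) / 2 := min_le_left _ _
  obtain ⟨hlow, Re, hRe, hRe'⟩ := exists_line_resolvent P.continuous_Veff.measurable
    P.ae_abs_Veff_le (z := z) hc fun s => by linarith [hv s]
  refine ⟨Re, hRe', min (1 / (4 * P.B)) ((v - z) / (100 * P.B ^ 3)), ?_, ?_,
    200 * P.B ^ 3 / c ^ 2 + 2 / c, by positivity, fun a ha haa => ?_⟩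
  · have := sub_pos.2 hzv
    positivity
  · calc _ ≤ 1 / (4 * (P.B : ℝ)) * P.B := by
          gcongr
          exact min_le_left _ _
      _ = 1 / 4 := by field_simp
  · have hB : a * P.B ≤ 1 / 4 := by
      have h1 := haa.trans (min_le_left _ _)
      rw [le_div_iff₀ (by positivity)] at h1
      linarith
    have hB3 : 50 * (a * (P.B : ℝ) ^ 3) ≤ (v - z) / 2 := by
      have h1 := haa.trans (min_le_right _ _)
      rw [le_div_iff₀ (by positivity)] at h1
      linarith
    -- The form is nonnegative, so `z < 0` alone puts `z` in the resolvent set.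
    obtain ⟨R, -, hR⟩ := P.exists_strip_resolvent ha hB (lam := z) (c := -z) (by linarith)
      fun x _ => by
        have := sq_nonneg ‖x.2‖
        linarith
    exact ⟨⟨_, hR⟩, P.norm_strip_resolvent_sub_le ha hB hv hc (min_le_right _ _)
      (by linarith) hRe hlow⟩

end Profile

end QuantumStrip

namespace QuantumStrip

open Filter Topology

/-! ### Locally Lipschitz functions on the line -/

/-- A locally Lipschitz function is absolutely continuous on intervals and so is the integral of its
derivative. This turns the `L^∞` hypotheses on derivatives into global Lipschitz constants. -/
theorem lipschitzWith_of_ae_abs_deriv_le {g : ℝ → ℝ} (hg : LocallyLipschitz g) {B : NNReal}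
    (h : ∀ᵐ s, |deriv g s| ≤ B) : LipschitzWith B g := by
  refine LipschitzWith.of_dist_le_mul fun x y => ?_
  obtain ⟨K, hK⟩ := (hg.locallyLipschitzOn (s := Set.uIcc y x)).exists_lipschitzOnWith_of_compact
    isCompact_uIcc
  rw [Real.dist_eq, Real.dist_eq, ← hK.absolutelyContinuousOnInterval.integral_deriv_eq_sub]
  exact intervalIntegral.norm_integral_le_of_norm_le_const_ae (f := deriv g)
    (C := B) (h.mono fun s hs _ => hs)

theorem ae_differentiableAt_of_locallyLipschitz {X : Type*} [NormedAddCommGroup X]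
    [NormedSpace ℝ X] [FiniteDimensional ℝ X] {g : ℝ → X} (hg : LocallyLipschitz g) :
    ∀ᵐ s, DifferentiableAt ℝ g s := by
  have h : ∀ᵐ s : ℝ, ∀ n : ℕ, s ∈ Set.Icc (-(n : ℝ)) n →
      DifferentiableWithinAt ℝ g (Set.Icc (-(n : ℝ)) n) s := by
    rw [ae_all_iff]
    intro n
    obtain ⟨K, hK⟩ :=
      (hg.locallyLipschitzOn (s := Set.Icc (-(n : ℝ)) n)).exists_lipschitzOnWith_of_compact
        isCompact_Icc
    exact hK.ae_differentiableWithinAt_of_mem_real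
  filter_upwards [h] with s hs
  obtain ⟨n, hn⟩ := exists_nat_gt |s|
  have hn' := abs_lt.1 hn
  exact (hs n ⟨hn'.1.le, hn'.2.le⟩).differentiableAt (Icc_mem_nhds hn'.1 hn'.2)

/-- The set where a continuous function exceeds `M` is open, so it is empty once it is null.
Essential bounds thereby become pointwise ones. -/
theorem le_of_ae_le {g : ℝ → ℝ} (hg : Continuous g) {M : ℝ} (h : ∀ᵐ s, g s ≤ M) (s : ℝ) :
    g s ≤ M := by
  by_contra hs
  have h0 : {s | M < g s} = ∅ :=
    (isOpen_lt continuous_const hg).eq_empty_of_measure_zero (μ := volume)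
      (by simpa [ae_iff] using h)
  have h1 : s ∈ {s | M < g s} := not_le.1 hs
  rw [h0] at h1
  exact h1

theorem ae_norm_le_eLpNorm {X : Type*} [NormedAddCommGroup X] {g : ℝ → X}
    (hg : MemLp g ∞ volume) : ∀ᵐ s, ‖g s‖ ≤ (eLpNorm g ∞ volume).toReal := by
  filter_upwards [ae_le_lpNorm_exponent_top hg] with s hs
  rwa [toReal_eLpNorm hg.aestronglyMeasurable]

/-! ### From the geometric hypotheses to a profile -/

namespace Strip

variable {n : ℕ} (S : Strip n)

theorem locallyLipschitz_k (hS : S.ThinAssumption) (j : Fin n) : LocallyLipschitz (S.k j) :=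
  (ContDiff.locallyLipschitz (𝕂 := ℝ) (contDiff_inner (𝕜 := ℝ))).comp
    (hS.locallyLipschitz_Γ.prodMk (S.locallyLipschitz_N j))

theorem locallyLipschitz_kΘ (hS : S.ThinAssumption) : LocallyLipschitz S.kΘ := by
  have h : ∀ t : Finset (Fin n), LocallyLipschitz fun s => ∑ j ∈ t, S.k j s * S.Θ s j := by
    intro t
    classical
    induction t using Finset.induction_on with
    | empty => simpa using LocallyLipschitz.const (0 : ℝ)
    | insert j t hj ih =>
      simp only [Finset.sum_insert hj]
      refine LocallyLipschitz.add ?_ ih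
      have h1 : LocallyLipschitz fun s => S.Θ s j :=
        (EuclideanSpace.proj (𝕜 := ℝ) j).lipschitz.locallyLipschitz.comp S.locallyLipschitz_Θ
      have h2 : ContDiff ℝ 1 fun p : ℝ × ℝ => p.1 * p.2 := contDiff_fst.mul contDiff_snd
      exact h2.locallyLipschitz.comp ((S.locallyLipschitz_k hS j).prodMk h1)
  exact h Finset.univ

theorem locallyLipschitz_normSq (hS : S.ThinAssumption) :
    LocallyLipschitz fun s => ‖deriv S.Θ s‖ ^ 2 :=
  (ContDiff.locallyLipschitz (𝕂 := ℝ) (contDiff_norm_sq ℝ)).comp hS.locallyLipschitz_Θ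

theorem abs_kΘ_le (hS : S.ThinAssumption) (s : ℝ) : |S.kΘ s| ≤ S.normKΘ :=
  le_of_ae_le (g := fun s => |S.kΘ s|) (S.locallyLipschitz_kΘ hS).continuous.abs
    (ae_norm_le_eLpNorm hS.bounded_kΘ) s

theorem norm_deriv_Θ_le (hS : S.ThinAssumption) (s : ℝ) :
    ‖deriv S.Θ s‖ ≤ (eLpNorm (deriv S.Θ) ∞ volume).toReal :=
  le_of_ae_le (g := fun s => ‖deriv S.Θ s‖) hS.locallyLipschitz_Θ.continuous.norm
    (ae_norm_le_eLpNorm hS.bounded_deriv_Θ) s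

theorem ae_abs_deriv_normSq_le (hS : S.ThinAssumption) :
    ∀ᵐ s, |deriv (fun s => ‖deriv S.Θ s‖ ^ 2) s| ≤
      2 * ((eLpNorm (deriv S.Θ) ∞ volume).toReal *
        (eLpNorm (deriv (deriv S.Θ)) ∞ volume).toReal) := by
  filter_upwards [ae_differentiableAt_of_locallyLipschitz hS.locallyLipschitz_Θ,
    ae_norm_le_eLpNorm hS.bounded_deriv_deriv_Θ] with s h1 h2
  have h3 : deriv (fun s => ‖deriv S.Θ s‖ ^ 2) s = _ := h1.hasDerivAt.norm_sq.deriv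
  rw [h3, abs_mul, abs_two]
  have h4 := S.norm_deriv_Θ_le hS s
  have h5 := abs_real_inner_le_norm (deriv S.Θ s) (deriv (deriv S.Θ) s)
  have h6 : ‖deriv S.Θ s‖ * ‖deriv (deriv S.Θ) s‖ ≤ (eLpNorm (deriv S.Θ) ∞ volume).toReal *
      (eLpNorm (deriv (deriv S.Θ)) ∞ volume).toReal := by gcongr
  linarith

/-- The metric of a strip satisfying the assumptions of the thin strip limit is given by bounded
Lipschitz functions. -/
theorem exists_profile (hS : S.ThinAssumption) : ∃ P : Profile,
    P.κ = S.kΘ ∧ P.σ = (fun s => ‖deriv S.Θ s‖ ^ 2) ∧ S.normKΘ ≤ P.B := by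
  set M₁ := S.normKΘ
  set M₂ := (eLpNorm (deriv S.kΘ) ∞ volume).toReal
  set L₁ := (eLpNorm (deriv S.Θ) ∞ volume).toReal
  set L₂ := (eLpNorm (deriv (deriv S.Θ)) ∞ volume).toReal
  have hM₁ : 0 ≤ M₁ := ENNReal.toReal_nonneg
  have hM₂ : 0 ≤ M₂ := ENNReal.toReal_nonneg
  have hL₁ : 0 ≤ L₁ := ENNReal.toReal_nonneg
  have hL₂ : 0 ≤ L₂ := ENNReal.toReal_nonneg
  have hL₁₂ : 0 ≤ L₁ * L₂ := by positivity
  have hL₁' : 0 ≤ L₁ ^ 2 := by positivity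
  -- A sum of all the bounds needed: `M₁` and `M₂` for `κ` and its Lipschitz constant, `L₁²` for
  -- `σ`, and `2 L₁ L₂` for its Lipschitz constant since `σ' = 2⟪Θ', Θ''⟫`. The summand 1 provides
  -- `1 ≤ B`.
  set B : NNReal := ⟨1 + M₁ + M₂ + L₁ ^ 2 + 2 * (L₁ * L₂), by positivity⟩
  have hB : (B : ℝ) = 1 + M₁ + M₂ + L₁ ^ 2 + 2 * (L₁ * L₂) := rfl
  refine ⟨⟨S.kΘ, fun s => ‖deriv S.Θ s‖ ^ 2, B, ?_, ?_, ?_, fun s => ?_,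
    fun s => sq_nonneg _, fun s => ?_⟩, rfl, rfl, ?_⟩
  · rw [← NNReal.coe_le_coe, hB, NNReal.coe_one]
    linarith
  · refine lipschitzWith_of_ae_abs_deriv_le (S.locallyLipschitz_kΘ hS) ?_
    filter_upwards [ae_norm_le_eLpNorm hS.bounded_deriv_kΘ] with s hs
    rw [Real.norm_eq_abs] at hs
    linarith
  · refine lipschitzWith_of_ae_abs_deriv_le (S.locallyLipschitz_normSq hS) ?_
    filter_upwards [S.ae_abs_deriv_normSq_le hS] with s hs
    linarith
  · linarith [S.abs_kΘ_le hS s]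
  · have : ‖deriv S.Θ s‖ ^ 2 ≤ L₁ ^ 2 := by
      have := S.norm_deriv_Θ_le hS s
      gcongr
    linarith
  · change M₁ ≤ (B : ℝ)
    linarith

theorem z₀_le_Veff (hS : S.ThinAssumption) (s : ℝ) : S.z₀ ≤ S.Veff s := by
  have h1 : S.kΘ s ^ 2 ≤ S.normKΘ ^ 2 := by
    rw [← sq_abs]
    have := S.abs_kΘ_le hS s
    gcongr
  rw [z₀, Veff]
  linarith [sq_nonneg ‖deriv S.Θ s‖]

theorem z₀_nonpos : S.z₀ ≤ 0 := by
  rw [z₀]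
  linarith [sq_nonneg S.normKΘ]

end Strip

end QuantumStrip

end

/-- Norm-resolvent convergence of `Ĥ - E₁` to `H_eff ⊕ 0` for thin strips. The first three
conjuncts say that `a ‖k·Θ‖_∞ < 1` holds for the half-widths considered and that the resolvents
`(Ĥ - E₁ - z)⁻¹` and `(H_eff - z)⁻¹` exist. -/
theorem corollary6p3 {n : ℕ} (S : QuantumStrip.Strip n) (hS : S.ThinAssumption)
    (z : ℝ) (hz : z < S.z₀) :
    (z : ℂ) ∈ QuantumStrip.resSet S.Heff ∧
    ∃ a₀ : ℝ, 0 < a₀ ∧ ∃ C : ℝ, 0 < C ∧ ∀ (a : ℝ) (ha : 0 < a), a ≤ a₀ →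
      a * S.normKΘ < 1 ∧
      (z : ℂ) ∈ QuantumStrip.resSet (S.Hhat ha) ∧
      ((QuantumStrip.E₁ a + z : ℝ) : ℂ) ∈ QuantumStrip.resSet (S.Hhat ha) ∧
      ‖QuantumStrip.res (S.Hhat ha) ((QuantumStrip.E₁ a + z : ℝ) : ℂ) -
          QuantumStrip.directSumZero QuantumStrip.modeEmbedding
            (QuantumStrip.res S.Heff (z : ℂ))‖ ≤ C * a := by
  obtain ⟨P, hκ, hσ, hB⟩ := S.exists_profile hS
  have hf : P.f = S.f := by
    ext p
    simp only [QuantumStrip.Profile.f, QuantumStrip.Profile.F, hκ, hσ, QuantumStrip.Strip.f]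
  have hV : P.Veff = S.Veff := by
    ext s
    simp only [QuantumStrip.Profile.Veff, hκ, hσ, QuantumStrip.Strip.Veff]
  have hH : ∀ (a : ℝ) (ha : 0 < a), P.Hhat ha = S.Hhat ha := by
    intro a ha
    -- The Hilbert spaces depend on `f`, so the equality `P.f = S.f` is used by generalising over
    -- `f` and substituting rather than by rewriting.
    have : ∀ (f : ℝ × ℝ → ℝ) (hm : Measurable f), f = S.f →
        QuantumStrip.transport (QuantumStrip.unitaryTransform hm ha)
          (QuantumStrip.energyOperator (QuantumStrip.testGradient f a).topologicalClosure) =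
        S.Hhat ha := by
      rintro f hm rfl
      rfl
    exact this P.f P.measurable_f hf
  obtain ⟨Re, hRe, a₀, ha₀, ha₀B, C, hC, h⟩ := P.thin_limit (v := S.z₀) (z := z)
    (fun s => by
      rw [hV]
      exact S.z₀_le_Veff hS s)
    (hz.trans_le S.z₀_nonpos) hz
  rw [hV] at hRe
  refine ⟨⟨Re, hRe⟩, a₀, ha₀, C, hC, fun a ha haa => ?_⟩
  obtain ⟨h1, R, hR, hle⟩ := h a ha haa
  rw [hH a ha] at h1 hR
  refine ⟨?_, h1, ⟨R, hR⟩, ?_⟩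
  -- The bound `a₀ B ≤ 1/4` was retained for this: `B` dominates the norm of `k·Θ`.
  · have h2 : a * S.normKΘ ≤ a₀ * P.B := by
      have : 0 ≤ S.normKΘ := ENNReal.toReal_nonneg
      gcongr
    linarith
  · rwa [QuantumStrip.res_eq hR, QuantumStrip.res_eq (show
      QuantumStrip.IsResolventAt S.Heff z Re from hRe)]
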